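/- There exist a program $P$ for the random access machine and a constant $c$ such that the following holds. Let $G$ be a line graph, i.e. a finite simple graph isomorphic to the line graph $L(H)$ of some finite simple graph $H$ (the vertices of $L(H)$ are the edges of $H$, and two distinct edges are adjacent if they share an end vertex), and let $n$ and $m$ be the numbers of vertices and edges of $G$. Given only $G$, by adjacency lists in an arbitrary order, $P$ halts after at most $c\,(n+m+1)$ steps and outputs a maximum bisection of $G$. That is, \textsc{Max Bisection} on (unweighted) line graphs can be solved in time linear in $n+m$. Moreover, the bisection that is output is also a maximum cut of $G$. Here a cut of $G=(V,E)$ is a bipartition $(A,B)$ of $V$, its size is the number of edges of $G$ between $A$ and $B$, and a bisection is a cut with $-1\le |A|-|B|\le 1$; a maximum bisection (maximum cut) is a bisection (cut) whose size is largest among all bisections (all cuts) of $G$. The machine has registers and arrays of cells that hold natural numbers and are initially $0$ outside the input. Its unit-cost operations are: setting a register to a constant, addition and truncated subtraction of registers, reading and writing an array cell whose index is in a register, and comparing two registers ($<$ or $=$) for a branch or a loop. All numbers that occur during the computation are smaller than $c\,(n+m+1)$, so that words of $\log_2(n+m+1)+O(1)$ bits suffice. -/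

import Mathlib

/-! ### Cuts and bisections of finite simple graphs -/

section Graphs

variable {V : Type*} [Fintype V] [DecidableEq V]

/-- A cut of a graph with vertex set `V`: a bipartition `(A, B)` of `V`. -/
def IsCut (A B : Finset V) : Prop :=
  Disjoint A B ∧ A ∪ B = Finset.univ

/-- A bisection: a cut `(A, B)` with `-1 ≤ |A| - |B| ≤ 1`. -/
def IsBisection (A B : Finset V) : Prop :=
  IsCut A B ∧ -1 ≤ (A.card : ℤ) - (B.card : ℤ) ∧ (A.card : ℤ) - (B.card : ℤ) ≤ 1

open Classical in
/-- The number of edges between `A` and `B` (for disjoint `A` and `B`, every such edge is one pair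
of `SimpleGraph.interedges`). -/
noncomputable def cutSize (G : SimpleGraph V) (A B : Finset V) : ℕ :=
  (G.interedges A B).card

/-- `(A, B)` is a cut of maximum size among all cuts. -/
def IsMaxCut (G : SimpleGraph V) (A B : Finset V) : Prop :=
  IsCut A B ∧ ∀ A' B' : Finset V, IsCut A' B' → cutSize G A' B' ≤ cutSize G A B

/-- `(A, B)` is a bisection of maximum size among all bisections: a solution of Max Bisection. -/
def IsMaxBisection (G : SimpleGraph V) (A B : Finset V) : Prop :=
  IsBisection A B ∧ ∀ A' B' : Finset V, IsBisection A' B' → cutSize G A' B' ≤ cutSize G A B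

/-- `G` is a line graph: it is isomorphic to the line graph of some finite simple graph. -/
def IsLineGraph (G : SimpleGraph V) : Prop :=
  ∃ (U : Type) (_ : Finite U) (H : SimpleGraph U), Nonempty (G ≃g H.lineGraph)

end Graphs

/-! ### A random access machine with bounded words and unit-cost instructions -/

namespace RAM

/-- The memory: registers, and arrays of cells, both named by natural numbers. A program mentions
only finitely many registers and arrays; cells inside an array are addressed by register contents. -/
structure Memory where
  reg : ℕ → ℕ
  arr : ℕ → ℕ → ℕ

/-- Write `k` into register `x`. -/
def Memory.setReg (s : Memory) (x k : ℕ) : Memory :=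
  { s with reg := Function.update s.reg x k }

/-- Write `k` into cell `i` of array `a`. -/
def Memory.setArr (s : Memory) (a i k : ℕ) : Memory :=
  { s with arr := Function.update s.arr a (Function.update (s.arr a) i k) }

/-- Tests compare two registers. -/
inductive Test where
  | lt (x y : ℕ)
  | eq (x y : ℕ)

/-- The test holds in the memory `s`. -/
def Test.Holds (s : Memory) : Test → Prop
  | .lt x y => s.reg x < s.reg y
  | .eq x y => s.reg x = s.reg y

/-- Programs. The elementary instructions are
`const x k`: `x := k`; `add x y z`: `x := y + z`; `sub x y z`: `x := y - z` (truncated at `0`);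
`load x a y`: `x := a[y]`; `store a y x`: `a[y] := x`, for registers `x y z` and an array `a`. -/
inductive Prog where
  | skip
  | const (x k : ℕ)
  | add (x y z : ℕ)
  | sub (x y z : ℕ)
  | load (x a y : ℕ)
  | store (a y x : ℕ)
  | seq (p q : Prog)
  | ite (b : Test) (p q : Prog)
  | while (b : Test) (p : Prog)

/-- `Exec W p s t s'`: on a machine whose words hold the numbers below `W`, the program `p`, started
in the memory `s`, halts after exactly `t` steps in the memory `s'`. Every elementary instruction
and every evaluation of a test is one step. The execution is deterministic, and it is stuck (so that
no such `t` and `s'` exist) if a number that is not below `W` would be produced. -/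
inductive Exec (W : ℕ) : Prog → Memory → ℕ → Memory → Prop where
  | skip (s : Memory) : Exec W .skip s 1 s
  | const (s : Memory) (x k : ℕ) (h : k < W) : Exec W (.const x k) s 1 (s.setReg x k)
  | add (s : Memory) (x y z : ℕ) (h : s.reg y + s.reg z < W) :
      Exec W (.add x y z) s 1 (s.setReg x (s.reg y + s.reg z))
  | sub (s : Memory) (x y z : ℕ) (h : s.reg y - s.reg z < W) :
      Exec W (.sub x y z) s 1 (s.setReg x (s.reg y - s.reg z))
  | load (s : Memory) (x a y : ℕ) (h : s.arr a (s.reg y) < W) :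
      Exec W (.load x a y) s 1 (s.setReg x (s.arr a (s.reg y)))
  | store (s : Memory) (a y x : ℕ) (hy : s.reg y < W) (hx : s.reg x < W) :
      Exec W (.store a y x) s 1 (s.setArr a (s.reg y) (s.reg x))
  | seq {p q : Prog} {s s' s'' : Memory} {t t' : ℕ}
      (hp : Exec W p s t s') (hq : Exec W q s' t' s'') : Exec W (.seq p q) s (t + t') s''
  | ite_true {b : Test} {p q : Prog} {s s' : Memory} {t : ℕ}
      (hb : b.Holds s) (hp : Exec W p s t s') : Exec W (.ite b p q) s (t + 1) s'
  | ite_false {b : Test} {p q : Prog} {s s' : Memory} {t : ℕ}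
      (hb : ¬ b.Holds s) (hq : Exec W q s t s') : Exec W (.ite b p q) s (t + 1) s'
  | while_true {b : Test} {p : Prog} {s s' s'' : Memory} {t t' : ℕ}
      (hb : b.Holds s) (hp : Exec W p s t s') (hw : Exec W (.while b p) s' t' s'') :
      Exec W (.while b p) s (t + t' + 1) s''
  | while_false {b : Test} {p : Prog} {s : Memory}
      (hb : ¬ b.Holds s) : Exec W (.while b p) s 1 s

/-! ### Input and output conventions for graphs -/

/-- `adj` is an adjacency-list representation of `G`: `adj v` lists the neighbours of `v`, each
exactly once, in an arbitrary order. -/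
def IsAdjLists {n : ℕ} (G : SimpleGraph (Fin n)) (adj : Fin n → List (Fin n)) : Prop :=
  ∀ v, (adj v).Nodup ∧ ∀ w, w ∈ adj v ↔ G.Adj v w

/-- The initial memory that holds the adjacency lists `adj`: register `0` holds `n`, array `1` holds
the lists `adj 0, adj 1, …, adj (n - 1)` one after the other, and array `0` holds `n + 1` offsets:
the list of `v` occupies the cells `i` of array `1` with `arr 0 v ≤ i < arr 0 (v + 1)`. All other
registers and cells are `0`. -/
def inputMemory {n : ℕ} (adj : Fin n → List (Fin n)) : Memory where
  reg x := if x = 0 then n else 0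
  arr a i :=
    if a = 0 then
      if i ≤ n then ((List.ofFn fun u => (adj u).length).take i).sum else 0
    else if a = 1 then (((List.ofFn adj).flatten).map Fin.val).getD i 0
    else 0

/-- The set of vertices `v` for which cell `v` of array `2` (the output array) holds `k`. -/
def outputClass (n : ℕ) (s : Memory) (k : ℕ) : Finset (Fin n) :=
  Finset.univ.filter fun v => s.arr 2 v = k

end RAM

/-! Let `G` be the line graph of `H`, so that the vertices of `G` are the edges of `H`, and give
every edge of `H` a sign. The imbalance of a vertex of `H` is the sum of the signs at it, and the
energy is the sum of the squared imbalances. Expanding the squares, the energy equals `2n` plus the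
sum of `y e * y f` over ordered adjacent pairs, that is `2n + 2m - 4 * cut` (`energy_eq`,
`sum_adj_sign`). A maximum cut of `G` is therefore an assignment of signs of minimum energy.

The parity of an imbalance is that of the degree. Hence a vertex of odd degree contributes at least
`1`, and a component of `H` with only even degrees and an odd number of edges contributes at least
`4`: its imbalances are even, and they sum to twice an odd number. Both bounds are attained
together. Join every vertex of odd degree to an auxiliary vertex `0` by an edge that stays
uncoloured, and colour alternately along Euler tours. The tour from `0` takes in every component
with odd degrees and leaves imbalances in `{-1, 0, 1}`; each later tour stays in a component with
even degrees and can leave only its start unbalanced, by `±2`, exactly when the number of edges is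
odd (`energy_le_of_alternating`). If the alternation is carried over from one tour to the next, all
signs together sum to `0` or `1`, so the optimal cut is also a bisection (`Toured.step`,
`Toured.isMax`). The tours come from Hierholzer's algorithm, whose correctness is a parity argument
(`Tour.top_eq`, `Tour.push`, `Tour.pop`).

Since `H` is not given, every vertex of `G` receives two labels that act as the ends of its edge.
All that is needed of them is that the number of coincidences `coin` of two distinct vertices is `1`
or `0` according to adjacency. In each component, one of three candidates is the full clique of
edges at one end of a chosen edge (`LineData.exists_seed`). From a correct first clique the
remaining labels are forced (`Lab.faithful_scan`), and the result passes a counting test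
(`Lab.passes_of_faithful`). Conversely, whatever passes the test has the right coincidences
(`Lab.coin_of_passes`), so a wrong candidate that passes does no harm, and one that fails is undone.

The linear running time follows from potentials: an attempt costs at most a constant times the size
of its component, and the tours cost a constant per entry of the incidence lists and per start
vertex. -/

set_option linter.unusedSimpArgs false

namespace RAM

/-! ### Total correctness with exact running time -/

section Logic

variable {W : ℕ}

/-- The program `p`, started in `s`, halts, and `Q` holds of its running time and final memory. -/
def Ok (W : ℕ) (p : Prog) (s : Memory) (Q : ℕ → Memory → Prop) : Prop :=
  ∃ t s', Exec W p s t s' ∧ Q t s'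

theorem Ok.mono {p : Prog} {s : Memory} {Q R : ℕ → Memory → Prop} (h : Ok W p s Q)
    (hQR : ∀ t s', Q t s' → R t s') : Ok W p s R := by
  obtain ⟨t, s', he, hq⟩ := h
  exact ⟨t, s', he, hQR _ _ hq⟩

-- The rules for loop-free programs are equivalences in weakest-precondition form, so that `simp`
-- evaluates a program symbolically and leaves only word bounds, branch conditions and the
-- postcondition.
@[simp] theorem ok_skip {s : Memory} {Q : ℕ → Memory → Prop} : Ok W .skip s Q ↔ Q 1 s := by
  constructor
  · rintro ⟨_, _, ⟨⟩, h⟩; exact h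
  · intro h; exact ⟨_, _, .skip s, h⟩

@[simp] theorem ok_const {s : Memory} {x k : ℕ} {Q : ℕ → Memory → Prop} :
    Ok W (.const x k) s Q ↔ k < W ∧ Q 1 (s.setReg x k) := by
  constructor
  · rintro ⟨_, _, ⟨⟩, h⟩; exact ⟨by assumption, h⟩
  · rintro ⟨hk, h⟩; exact ⟨_, _, .const s x k hk, h⟩

@[simp] theorem ok_add {s : Memory} {x y z : ℕ} {Q : ℕ → Memory → Prop} :
    Ok W (.add x y z) s Q ↔
      s.reg y + s.reg z < W ∧ Q 1 (s.setReg x (s.reg y + s.reg z)) := by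
  constructor
  · rintro ⟨_, _, ⟨⟩, h⟩; exact ⟨by assumption, h⟩
  · rintro ⟨hk, h⟩; exact ⟨_, _, .add s x y z hk, h⟩

@[simp] theorem ok_sub {s : Memory} {x y z : ℕ} {Q : ℕ → Memory → Prop} :
    Ok W (.sub x y z) s Q ↔
      s.reg y - s.reg z < W ∧ Q 1 (s.setReg x (s.reg y - s.reg z)) := by
  constructor
  · rintro ⟨_, _, ⟨⟩, h⟩; exact ⟨by assumption, h⟩
  · rintro ⟨hk, h⟩; exact ⟨_, _, .sub s x y z hk, h⟩

@[simp] theorem ok_load {s : Memory} {x a y : ℕ} {Q : ℕ → Memory → Prop} :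
    Ok W (.load x a y) s Q ↔
      s.arr a (s.reg y) < W ∧ Q 1 (s.setReg x (s.arr a (s.reg y))) := by
  constructor
  · rintro ⟨_, _, ⟨⟩, h⟩; exact ⟨by assumption, h⟩
  · rintro ⟨hk, h⟩; exact ⟨_, _, .load s x a y hk, h⟩

@[simp] theorem ok_store {s : Memory} {x a y : ℕ} {Q : ℕ → Memory → Prop} :
    Ok W (.store a y x) s Q ↔
      s.reg y < W ∧ s.reg x < W ∧ Q 1 (s.setArr a (s.reg y) (s.reg x)) := by
  constructor
  · rintro ⟨_, _, ⟨⟩, h⟩; exact ⟨by assumption, by assumption, h⟩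
  · rintro ⟨hy, hx, h⟩; exact ⟨_, _, .store s a y x hy hx, h⟩

theorem ok_seq {p q : Prog} {s : Memory} {Q : ℕ → Memory → Prop} :
    Ok W (.seq p q) s Q ↔ Ok W p s (fun t s' => Ok W q s' (fun t' s'' => Q (t + t') s'')) := by
  constructor
  · rintro ⟨_, _, h, hQ⟩
    cases h with
    | seq hp hq => exact ⟨_, _, hp, _, _, hq, hQ⟩
  · rintro ⟨_, _, hp, _, _, hq, hQ⟩
    exact ⟨_, _, .seq hp hq, hQ⟩

theorem ok_ite_true {b : Test} {p q : Prog} {s : Memory} {Q : ℕ → Memory → Prop}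
    (hb : b.Holds s) (h : Ok W p s (fun t s' => Q (t + 1) s')) : Ok W (.ite b p q) s Q := by
  obtain ⟨_, _, hp, hQ⟩ := h
  exact ⟨_, _, .ite_true hb hp, hQ⟩

theorem ok_ite_false {b : Test} {p q : Prog} {s : Memory} {Q : ℕ → Memory → Prop}
    (hb : ¬ b.Holds s) (h : Ok W q s (fun t s' => Q (t + 1) s')) : Ok W (.ite b p q) s Q := by
  obtain ⟨_, _, hp, hQ⟩ := h
  exact ⟨_, _, .ite_false hb hp, hQ⟩

theorem ok_ite {b : Test} {p q : Prog} {s : Memory} {Q : ℕ → Memory → Prop} :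
    Ok W (.ite b p q) s Q ↔
      (b.Holds s → Ok W p s (fun t s' => Q (t + 1) s')) ∧
      (¬ b.Holds s → Ok W q s (fun t s' => Q (t + 1) s')) := by
  constructor
  · rintro ⟨_, _, h, hQ⟩
    cases h with
    | ite_true hb hp => exact ⟨fun _ => ⟨_, _, hp, hQ⟩, fun h => absurd hb h⟩
    | ite_false hb hp => exact ⟨fun h => absurd h hb, fun _ => ⟨_, _, hp, hQ⟩⟩
  · rintro ⟨h1, h2⟩
    by_cases hb : b.Holds s
    · exact ok_ite_true hb (h1 hb)
    · exact ok_ite_false hb (h2 hb)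

@[simp] theorem ok_ite_lt {x y : ℕ} {p q : Prog} {s : Memory} {Q : ℕ → Memory → Prop} :
    Ok W (.ite (.lt x y) p q) s Q ↔
      (s.reg x < s.reg y → Ok W p s (fun t s' => Q (t + 1) s')) ∧
      (¬ s.reg x < s.reg y → Ok W q s (fun t s' => Q (t + 1) s')) := ok_ite

@[simp] theorem ok_ite_eq {x y : ℕ} {p q : Prog} {s : Memory} {Q : ℕ → Memory → Prop} :
    Ok W (.ite (.eq x y) p q) s Q ↔
      (s.reg x = s.reg y → Ok W p s (fun t s' => Q (t + 1) s')) ∧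
      (¬ s.reg x = s.reg y → Ok W q s (fun t s' => Q (t + 1) s')) := ok_ite

/-- Loop rule: an invariant with a ghost parameter and a potential that pays for the time. -/
theorem Ok.while {γ : Type*} {b : Test} {p : Prog} (Inv : γ → Memory → Prop) (Φ : γ → ℕ)
    (hbody : ∀ g s, Inv g s → b.Holds s →
      Ok W p s (fun t s' => ∃ g', Inv g' s' ∧ t + 1 + Φ g' ≤ Φ g))
    (g : γ) (s : Memory) (h : Inv g s) :
    Ok W (.while b p) s (fun t s' => ∃ g', Inv g' s' ∧ ¬ b.Holds s' ∧ t + Φ g' ≤ Φ g + 1) := by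
  -- Each iteration pays at least for its test, so the potential drops strictly; it bounds the
  -- number of iterations and the time alike.
  induction hk : Φ g using Nat.strong_induction_on generalizing g s with
  | _ k ih =>
    by_cases hb : b.Holds s
    · obtain ⟨t, s', he, g', hI, ht⟩ := hbody g s h hb
      obtain ⟨t', s'', he', g'', hI', hb', ht'⟩ := ih (Φ g') (by omega) g' s' hI rfl
      exact ⟨_, _, .while_true hb he he', g'', hI', hb', by omega⟩
    · exact ⟨1, s, .while_false hb, g, h, hb, by omega⟩

/-! ### Evaluation of tests, registers and arrays after a write -/

@[simp] theorem holds_lt {s : Memory} {x y : ℕ} : (Test.lt x y).Holds s ↔ s.reg x < s.reg y :=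
  Iff.rfl

@[simp] theorem reg_setReg (s : Memory) (x k y : ℕ) :
    (s.setReg x k).reg y = if y = x then k else s.reg y := by
  simp [Memory.setReg, Function.update_apply]

@[simp] theorem arr_setReg (s : Memory) (x k : ℕ) : (s.setReg x k).arr = s.arr := rfl

@[simp] theorem reg_setArr (s : Memory) (a i k : ℕ) : (s.setArr a i k).reg = s.reg := rfl

@[simp] theorem arr_setArr (s : Memory) (a i k b : ℕ) :
    (s.setArr a i k).arr b = if b = a then Function.update (s.arr a) i k else s.arr b := by
  simp only [Memory.setArr, Function.update_apply]

/-- Sequential composition of a list of programs. -/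
def block : List Prog → Prog
  | [] => .skip
  | p :: ps => .seq p (block ps)

@[simp] theorem ok_block_nil {s : Memory} {Q : ℕ → Memory → Prop} :
    Ok W (block []) s Q ↔ Q 1 s := ok_skip

@[simp] theorem ok_block_cons {p : Prog} {ps : List Prog} {s : Memory} {Q : ℕ → Memory → Prop} :
    Ok W (block (p :: ps)) s Q ↔
      Ok W p s (fun t s' => Ok W (block ps) s' (fun t' s'' => Q (t + t') s'')) := ok_seq

/-! ### Registers and arrays that a program leaves unchanged -/

/-- The registers that a program may write. -/
def Prog.wr : Prog → List ℕ
  | .skip => []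
  | .const x _ => [x]
  | .add x _ _ => [x]
  | .sub x _ _ => [x]
  | .load x _ _ => [x]
  | .store _ _ _ => []
  | .seq p q => p.wr ++ q.wr
  | .ite _ p q => p.wr ++ q.wr
  | .while _ p => p.wr

/-- The arrays that a program may write. -/
def Prog.wa : Prog → List ℕ
  | .skip => []
  | .const _ _ => []
  | .add _ _ _ => []
  | .sub _ _ _ => []
  | .load _ _ _ => []
  | .store a _ _ => [a]
  | .seq p q => p.wa ++ q.wa
  | .ite _ p q => p.wa ++ q.wa
  | .while _ p => p.wa

/-- `s'` agrees with `s` outside the registers `R` and the arrays `A`. -/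
def Frame (R A : List ℕ) (s s' : Memory) : Prop :=
  (∀ r, r ∉ R → s'.reg r = s.reg r) ∧ (∀ a, a ∉ A → s'.arr a = s.arr a)

theorem Frame.refl {R A : List ℕ} (s : Memory) : Frame R A s s :=
  ⟨fun _ _ => rfl, fun _ _ => rfl⟩

theorem Frame.trans {R A : List ℕ} {s s' s'' : Memory} (h : Frame R A s s')
    (h' : Frame R A s' s'') : Frame R A s s'' :=
  ⟨fun r hr => (h'.1 r hr).trans (h.1 r hr), fun a ha => (h'.2 a ha).trans (h.2 a ha)⟩

theorem Frame.mono {R A R' A' : List ℕ} {s s' : Memory} (h : Frame R A s s') (hR : R ⊆ R')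
    (hA : A ⊆ A') : Frame R' A' s s' :=
  ⟨fun r hr => h.1 r (fun h => hr (hR h)), fun a ha => h.2 a (fun h => ha (hA h))⟩

theorem Frame.setReg {R A : List ℕ} (s : Memory) {x : ℕ} (k : ℕ) (h : x ∈ R) :
    Frame R A s (s.setReg x k) :=
  ⟨fun r hr => by rw [reg_setReg, if_neg (by rintro rfl; exact hr h)], fun _ _ => rfl⟩

theorem Frame.setArr {R A : List ℕ} (s : Memory) {a : ℕ} (i k : ℕ) (h : a ∈ A) :
    Frame R A s (s.setArr a i k) :=
  ⟨fun _ _ => rfl, fun b hb => by rw [arr_setArr, if_neg (by rintro rfl; exact hb h)]⟩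

/-- The footprint is read off the syntax, so for a concrete program `decide` proves that a register
or an array is preserved, and specifications need to mention only what changes. -/
theorem Exec.frame {p : Prog} {s s' : Memory} {t : ℕ} (h : Exec W p s t s') :
    Frame p.wr p.wa s s' := by
  induction h with
  | skip s => exact Frame.refl _
  | const s x k h => exact ⟨fun r hr => by simp_all [Prog.wr], fun a ha => by simp⟩
  | add s x y z h => exact ⟨fun r hr => by simp_all [Prog.wr], fun a ha => by simp⟩
  | sub s x y z h => exact ⟨fun r hr => by simp_all [Prog.wr], fun a ha => by simp⟩
  | load s x y z h => exact ⟨fun r hr => by simp_all [Prog.wr], fun a ha => by simp⟩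
  | store s a y x hy hx => exact ⟨fun r hr => by simp, fun a ha => by simp_all [Prog.wa]⟩
  | seq _ _ h1 h2 =>
    exact (h1.mono (by simp [Prog.wr]) (by simp [Prog.wa])).trans
      (h2.mono (by simp [Prog.wr]) (by simp [Prog.wa]))
  | ite_true _ _ h => exact h.mono (by simp [Prog.wr]) (by simp [Prog.wa])
  | ite_false _ _ h => exact h.mono (by simp [Prog.wr]) (by simp [Prog.wa])
  | while_true _ _ _ h1 h2 => exact h1.trans h2
  | while_false _ => exact Frame.refl _

theorem Ok.frame {p : Prog} {s : Memory} {Q : ℕ → Memory → Prop} (h : Ok W p s Q) :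
    Ok W p s (fun t s' => Q t s' ∧ Frame p.wr p.wa s s') := by
  obtain ⟨t, s', he, hQ⟩ := h
  exact ⟨t, s', he, hQ, he.frame⟩

/-! ### Loops over a segment of an array -/

/-- For every cell of array `a` with index from the content of `j` to that of `hi` (exclusive):
load it into `y` and run `body`. Register `2` holds `1`. -/
def forArr (a j hi y : ℕ) (body : Prog) : Prog :=
  .while (.lt j hi) (block [.load y a j, body, .add j j 2])

/-- The invariant is indexed by the processed prefix of the segment, so that it can be stated with
list operations. The hypothesis `hI` says that it ignores the loop registers; `hk` is purely
syntactic. -/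
theorem ok_forArr {a j hi y : ℕ} {body : Prog} {s : Memory} (xs : List ℕ)
    (Inv : List ℕ → Memory → Prop) (T : ℕ → ℕ)
    (h1 : s.reg 2 = 1)
    (hhi : s.reg hi = s.reg j + xs.length)
    (hxs : ∀ i (h : i < xs.length), s.arr a (s.reg j + i) = xs[i])
    (hW : s.reg j + xs.length < W) (hxW : ∀ x ∈ xs, x < W)
    (hk : 2 ∉ j :: y :: body.wr ∧ hi ∉ j :: y :: body.wr ∧ j ∉ y :: body.wr ∧ a ∉ body.wa)
    (hI : ∀ l s s', Frame [j, y] [] s s' → Inv l s → Inv l s')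
    (h0 : Inv [] s)
    (hbody : ∀ pre x suf s', xs = pre ++ x :: suf → Frame (j :: y :: body.wr) body.wa s s' →
      s'.reg y = x → Inv pre s' →
      Ok W body s' (fun t s'' => Inv (pre ++ [x]) s'' ∧ t ≤ T x)) :
    Ok W (forArr a j hi y body) s (fun t s' => Inv xs s' ∧
      Frame (j :: y :: body.wr) body.wa s s' ∧ t ≤ (xs.map (fun x => T x + 4)).sum + 1) := by
  obtain ⟨hk2, hkhi, hkj, hka⟩ := hk
  have hjhi : hi ≠ j := fun h => hkhi (by simp [h])
  have hj2 : 2 ≠ j := fun h => hk2 (by simp [h])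
  have hjy : j ≠ y := fun h => hkj (by simp [h])
  -- The ghost `i` counts processed entries and the potential is the cost of the others. Beyond the
  -- body an iteration takes `4` steps: the load, the increment, the end of the block and the loop
  -- test.
  refine (Ok.while (γ := ℕ) (fun i s' => i ≤ xs.length ∧ s'.reg j = s.reg j + i ∧
      Frame (j :: y :: body.wr) body.wa s s' ∧ Inv (xs.take i) s')
    (fun i => ((xs.drop i).map (fun x => T x + 4)).sum) ?_ 0 s ?_).mono ?_
  · rintro i s' ⟨hi1, hi2, hfr, hinv⟩ hb
    rw [holds_lt, hi2, hfr.1 hi hkhi, hhi] at hb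
    have hilt : i < xs.length := by omega
    have hval : s'.arr a (s'.reg j) = xs[i] := by rw [hfr.2 a hka, hi2, hxs i hilt]
    simp only [ok_block_cons, ok_load, hval]
    refine ⟨hxW _ (List.getElem_mem _), ?_⟩
    have hfr1 : Frame [j, y] [] s' (s'.setReg y xs[i]) := Frame.setReg _ _ (by simp)
    have hsplit : xs = xs.take i ++ xs[i] :: xs.drop (i + 1) := by simp
    have hfr2 := hfr.trans (hfr1.mono (by simp) (by simp))
    refine ((hbody (xs.take i) xs[i] (xs.drop (i + 1)) _ hsplit hfr2
      (by simp) (hI _ _ _ hfr1 hinv))).frame.mono ?_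
    rintro t s'' ⟨⟨hinv', ht⟩, hfr3⟩
    have hfr4 := hfr2.trans (hfr3.mono (by simp) (List.Subset.refl _))
    have e1 : s''.reg j = s.reg j + i := by
      rw [hfr3.1 j (fun h => hkj (by simp [h]))]; simp [hjy, hi2]
    have e2 : s''.reg 2 = 1 := by rw [hfr4.1 2 hk2, h1]
    simp only [ok_add, ok_block_nil, e1, e2]
    refine ⟨by omega, i + 1, ⟨hilt, by simp; omega, ?_, ?_⟩, ?_⟩
    · exact hfr4.trans (Frame.setReg _ _ (by simp))
    · rw [List.take_succ_eq_append_getElem hilt]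
      exact hI _ _ _ (Frame.setReg _ _ (by simp)) hinv'
    · rw [List.drop_eq_getElem_cons hilt, List.map_cons, List.sum_cons]
      omega
  · exact ⟨Nat.zero_le _, by simp, Frame.refl _, by simpa using h0⟩
  · rintro t s' ⟨i, ⟨hi1, hi2, hfr, hinv⟩, hb, ht⟩
    rw [holds_lt, hi2, hfr.1 hi hkhi, hhi] at hb
    have : i = xs.length := by omega
    subst this
    simp only [List.drop_length, List.map_nil, List.sum_nil, List.drop_zero] at ht
    exact ⟨by simpa using hinv, hfr, by omega⟩

end Logic

end RAM

namespace RAM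

/-! ### The input graph in memory -/

section Input

variable {n W : ℕ} {off nb : ℕ → ℕ} {nbl : ℕ → List ℕ}

/-- The functions `off` and `nb` store the lists `nbl v` for `v < n` one after the other. -/
structure Input (n W : ℕ) (off nb : ℕ → ℕ) (nbl : ℕ → List ℕ) : Prop where
  off_lt : ∀ v, off v + (nbl v).length < W
  off_succ : ∀ v < n, off (v + 1) = off v + (nbl v).length
  nb_get : ∀ v < n, ∀ i (h : i < (nbl v).length), nb (off v + i) = (nbl v)[i]
  lt_of_mem : ∀ v, ∀ y ∈ nbl v, y < n
  nbl_out : ∀ v, n ≤ v → nbl v = []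
  off_end : off (n + 1) = 0
  n_lt : 100 * (n + 1) < W

/-- The part of the memory that never changes: the input and the small constants. -/
structure Base (n : ℕ) (off nb : ℕ → ℕ) (s : Memory) : Prop where
  arr_off : s.arr 0 = off
  arr_nb : s.arr 1 = nb
  reg_n : s.reg 0 = n
  reg_zero : s.reg 1 = 0
  reg_one : s.reg 2 = 1
  reg_two : s.reg 3 = 2
  reg_three : s.reg 4 = 3

theorem Base.of_frame {R A : List ℕ} {s s' : Memory} (h : Base n off nb s) (hf : Frame R A s s')
    (hR : ∀ r < 5, r ∉ R) (hA : ∀ a < 2, a ∉ A) : Base n off nb s' where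
  arr_off := (hf.2 0 (hA 0 (by decide))).trans h.arr_off
  arr_nb := (hf.2 1 (hA 1 (by decide))).trans h.arr_nb
  reg_n := (hf.1 0 (hR 0 (by decide))).trans h.reg_n
  reg_zero := (hf.1 1 (hR 1 (by decide))).trans h.reg_zero
  reg_one := (hf.1 2 (hR 2 (by decide))).trans h.reg_one
  reg_two := (hf.1 3 (hR 3 (by decide))).trans h.reg_two
  reg_three := (hf.1 4 (hR 4 (by decide))).trans h.reg_three

/-- For every neighbour `y` of the vertex in register `v`: load `y` into register `15` and run
`body`. -/
def forNbr (v : ℕ) (body : Prog) : Prog :=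
  block [.load 13 0 v, .add 14 v 2, .load 14 0 14, forArr 1 13 14 15 body]

/-- The value `e = n` is admitted on purpose: `n` stands for a missing vertex, with an empty list,
and saves case distinctions in the program. -/
theorem ok_forNbr (hin : Input n W off nb nbl) {v : ℕ} {body : Prog} {s : Memory}
    (hB : Base n off nb s) {e : ℕ} (hve : s.reg v = e) (he : e ≤ n) (hv : v ≠ 13)
    (Inv : List ℕ → Memory → Prop) (T : ℕ)
    (hR : ∀ r < 5, r ∉ body.wr) (hA : ∀ a < 2, a ∉ body.wa)
    (hk : 13 ∉ body.wr ∧ 14 ∉ body.wr)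
    (hI : ∀ l s s', Frame [13, 14, 15] [] s s' → Inv l s → Inv l s')
    (h0 : Inv [] s)
    (hbody : ∀ pre x suf s', nbl e = pre ++ x :: suf → x < n → Base n off nb s' →
      Frame (13 :: 14 :: 15 :: body.wr) body.wa s s' → s'.reg 15 = x → Inv pre s' →
      Ok W body s' (fun t s'' => Inv (pre ++ [x]) s'' ∧ t ≤ T)) :
    Ok W (forNbr v body) s (fun t s' => Inv (nbl e) s' ∧
      Base n off nb s' ∧ Frame (13 :: 14 :: 15 :: body.wr) body.wa s s' ∧
      t ≤ (T + 4) * (nbl e).length + 5) := by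
  have hbd := hin.off_lt
  have hn := hin.n_lt
  unfold forNbr
  simp only [ok_block_cons, ok_load, ok_add, reg_setReg, arr_setReg, hB.arr_off, hB.reg_one,
    if_neg hv, hve, if_true, if_false, Nat.reduceEqDiff]
  refine ⟨by have := hbd e; omega, by omega, by have := hbd (e + 1); omega, ?_⟩
  set s1 : Memory := ((s.setReg 13 (off e)).setReg 14 (e + 1)).setReg 14 (off (e + 1)) with hs1
  have hfr1 : Frame [13, 14, 15] [] s s1 :=
    ((Frame.setReg _ _ (by simp)).trans (Frame.setReg _ _ (by simp))).trans
      (Frame.setReg _ _ (by simp))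
  have hB1 : Base n off nb s1 := hB.of_frame hfr1 (by decide) (by decide)
  have hj : s1.reg 13 = off e := by simp [hs1]
  have hh : s1.reg 14 = off (e + 1) := by simp [hs1]
  have hfrw : ∀ s', Frame (13 :: 15 :: body.wr) body.wa s1 s' →
      Frame (13 :: 14 :: 15 :: body.wr) body.wa s s' := fun s' h =>
    (hfr1.mono (by simp) (by simp)).trans (h.mono (by intro; simp; tauto) (by simp))
  have hBf : ∀ s', Frame (13 :: 14 :: 15 :: body.wr) body.wa s s' → Base n off nb s' := by
    intro s' h
    refine hB.of_frame h ?_ hA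
    intro r hr
    have := hR r hr
    simp only [List.mem_cons, not_or]
    exact ⟨by omega, by omega, by omega, this⟩
  have key : Ok W (forArr 1 13 14 15 body) s1 (fun t s' => Inv (nbl e) s' ∧
      Base n off nb s' ∧ Frame (13 :: 14 :: 15 :: body.wr) body.wa s s' ∧
      t ≤ (T + 4) * (nbl e).length + 1) := by
    rcases Nat.lt_or_ge e n with hlt | hge
    · refine (ok_forArr (nbl e) Inv (fun _ => T) hB1.reg_one ?_ ?_ ?_ ?_ ?_ ?_ (hI _ _ _ hfr1 h0) ?_).mono ?_
      · rw [hh, hj, hin.off_succ e hlt]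
      · intro i h
        rw [hB1.arr_nb, hj, hin.nb_get e hlt i h]
      · rw [hj]; exact hbd e
      · intro x hx
        have := hin.lt_of_mem e x hx
        omega
      · have := hR 2 (by decide)
        have := hA 1 (by decide)
        simp_all
      · intro l s s' h
        exact hI _ _ _ (h.mono (by simp) (by simp))
      · intro pre x suf s' hs hfr hx hi
        exact hbody pre x suf s' hs (hin.lt_of_mem e x (by simp [hs])) (hBf _ (hfrw _ hfr))
          (hfrw _ hfr) hx hi
      · rintro t s' ⟨h1, h2, h3⟩
        refine ⟨h1, hBf _ (hfrw _ h2), hfrw _ h2, h3.trans ?_⟩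
        simp [mul_comm]
    -- Offset `n + 1` is outside the input and reads `0`, so for the missing vertex the upper end of
    -- the segment is `0` and the loop stops at once.
    · have hen : e = n := le_antisymm he hge
      have hnil : nbl e = [] := hin.nbl_out e hge
      refine ⟨1, s1, .while_false ?_, ?_⟩
      · rw [holds_lt, hj, hh, hen, hin.off_end]
        omega
      · rw [hnil]
        exact ⟨hI _ _ _ hfr1 h0, hB1, hfr1.mono (by simp) (by simp), by simp⟩
  refine key.mono ?_
  rintro t s' ⟨h1, h2, h3, h4⟩
  simp only [ok_block_nil]
  exact ⟨h1, h2, h3, by omega⟩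

end Input

end RAM

namespace RAM

/-! ### Seeding: a first clique at a vertex -/

section Seed

variable {n W : ℕ} {off nb : ℕ → ℕ} {nbl : ℕ → List ℕ}

/-- Mark the neighbours of the vertex in register `5` by `1` in array `5`, and put the last one
into register `7`. -/
def markFirst : Prog :=
  block [.add 7 0 1, forNbr 5 (block [.store 5 15 2, .add 7 15 1])]

/-- Raise the marks of the neighbours of the vertex in register `7` from `1` to `2`, and put the
`k`-th of these vertices into register `8`. -/
def markSecond (k : ℕ) : Prog :=
  block [.const 9 0, .const 16 k, .add 8 0 1,
    forNbr 7 (block [.load 17 5 15,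
      .ite (.eq 17 2) (block [.store 5 15 3, .add 9 9 2,
        .ite (.eq 9 16) (.add 8 15 1) .skip]) .skip])]

/-- Raise the marks of the neighbours of the vertex in register `8` from `2` to `3`, and those of
the vertices in registers `7` and `8` to `3`. -/
def markThird : Prog :=
  block [forNbr 8 (block [.load 17 5 15, .ite (.eq 17 3) (.store 5 15 4) .skip]),
    .store 5 8 4, .store 5 7 4]

theorem ok_markFirst (hin : Input n W off nb nbl) {s : Memory} {e : ℕ} (hB : Base n off nb s)
    (he : s.reg 5 = e) (hen : e < n) (hS : ∀ y < n, s.arr 5 y = 0) :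
    Ok W markFirst s (fun t s' => (∀ y < n, s'.arr 5 y = if y ∈ nbl e then 1 else 0) ∧
      s'.reg 7 = (nbl e).getLastD n ∧ t ≤ 7 * (nbl e).length + 7) := by
  have hn := hin.n_lt
  simp only [markFirst, ok_block_cons, ok_add, hB.reg_n, hB.reg_zero]
  refine ⟨by omega, ?_⟩
  refine (ok_forNbr hin (e := e) (s := s.setReg 7 (n + 0))
    (hB.of_frame (R := [7]) (A := []) (Frame.setReg _ _ (by simp)) (by decide) (by decide))
    (by simp [he]) hen.le (by decide)
    (fun l s' => (∀ y < n, s'.arr 5 y = if y ∈ l then 1 else 0) ∧ s'.reg 7 = l.getLastD n) 3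
    (by decide) (by decide) (by decide) ?_ ?_ ?_).mono ?_
  · rintro l s s' ⟨hr, ha⟩ h
    simpa [hr, ha] using h
  · simpa using hS
  · rintro pre x suf s' hs hx hB' hfr h15 ⟨h1, h2⟩
    simp only [ok_block_cons, ok_store, ok_add, ok_block_nil, hB'.reg_one, hB'.reg_zero, h15,
      reg_setArr, reg_setReg, arr_setReg, arr_setArr]
    refine ⟨by omega, by omega, by omega, ⟨?_, by simp⟩, by omega⟩
    intro y hy
    by_cases hyx : y = x
    · simp [hyx]
    · simp [hyx, Function.update_apply, h1 y hy]
  · rintro t s' ⟨⟨h1, h2⟩, h3, h4, h5⟩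
    simp only [ok_block_nil]
    exact ⟨h1, h2, by omega⟩

/-- While the list of `f` is scanned, a mark `1` identifies a common neighbour of `e` and `f`. As
the list has no repetitions, no raised mark is met again, and register `9` counts the common
neighbours in order. For `k = 0` the counter never equals `k` after an increment, and register `8`
keeps the value `n`. -/
theorem ok_markSecond (hin : Input n W off nb nbl) (hnd : ∀ v, (nbl v).Nodup) {s : Memory}
    {e f k : ℕ} (hB : Base n off nb s) (hf : s.reg 7 = f) (hfn : f ≤ n) (hk : k < 3)
    (hS : ∀ y < n, s.arr 5 y = if y ∈ nbl e then 1 else 0) :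
    Ok W (markSecond k) s (fun t s' =>
      (∀ y < n, s'.arr 5 y = if y ∈ nbl e then (if y ∈ nbl f then 2 else 1) else 0) ∧
      s'.reg 8 = (if k = 0 then n else ((nbl f).filter (· ∈ nbl e)).getD (k - 1) n) ∧
      t ≤ 13 * (nbl f).length + 9) := by
  have hn := hin.n_lt
  simp only [markSecond, ok_block_cons, ok_add, ok_const, reg_setReg, OfNat.ofNat_ne_zero,
    OfNat.one_ne_ofNat, OfNat.zero_ne_ofNat, if_false, hB.reg_n, hB.reg_zero]
  refine ⟨by omega, by omega, by omega, ?_⟩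
  have hlen : ((nbl f).filter (· ∈ nbl e)).length < W :=
    lt_of_le_of_lt (List.length_filter_le _ _) (by have := hin.off_lt f; omega)
  set s1 := ((s.setReg 9 0).setReg 16 k).setReg 8 (n + 0) with hs1
  refine (ok_forNbr hin (e := f) (s := s1)
    (hB.of_frame (R := [9, 16, 8]) (A := []) (((Frame.setReg _ _ (by simp)).trans
      (Frame.setReg _ _ (by simp))).trans (Frame.setReg _ _ (by simp))) (by decide) (by decide))
    (by simp [hs1, hf]) hfn (by decide)
    (fun l s' =>
      (∀ y < n, s'.arr 5 y = if y ∈ nbl e then (if y ∈ l then 2 else 1) else 0) ∧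
      s'.reg 9 = (l.filter (· ∈ nbl e)).length ∧ s'.reg 16 = k ∧
      s'.reg 8 = (if k = 0 then n else (l.filter (· ∈ nbl e)).getD (k - 1) n)) 9
    (by simp [block, Prog.wr]; omega) (by simp [block, Prog.wa]; omega)
    (by simp [block, Prog.wr]) ?_ ?_ ?_).mono ?_
  · rintro l s s' ⟨hr, ha⟩ h
    simpa [hr, ha] using h
  · simpa [hs1] using hS
  · rintro pre x suf s' hs hx hB' hfr h15 ⟨h1, h2, h3, h4⟩
    have hxpre : x ∉ pre := by
      have := hnd f
      rw [hs, List.nodup_append] at this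
      intro h
      exact this.2.2 x h x (by simp) rfl
    have hpl : ((pre ++ [x]).filter (· ∈ nbl e)).length < W := by
      refine lt_of_le_of_lt (List.Sublist.length_le (List.Sublist.filter _ ?_)) hlen
      rw [hs]; simp
    have hSx := h1 x hx
    simp only [hxpre, if_false] at hSx
    by_cases hxe : x ∈ nbl e
    · simp only [hxe, if_true] at hSx
      have hpl' : (pre.filter (· ∈ nbl e)).length + 1 < W := by simpa [hxe] using hpl
      simp only [ok_block_cons, ok_store, ok_add, ok_block_nil, ok_load, ok_ite_eq, ok_skip,
        hB'.reg_one, hB'.reg_two, hB'.reg_zero, h15, h2, h3, hSx, h4,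
        reg_setArr, reg_setReg, arr_setReg, arr_setArr, OfNat.ofNat_ne_zero,
        OfNat.one_ne_ofNat, OfNat.zero_ne_ofNat, OfNat.ofNat_ne_one, if_true, if_false,
        Nat.reduceEqDiff, forall_const, not_true, false_imp_iff, and_true]
      have hS' : ∀ y < n, Function.update (s'.arr 5) x 2 y =
          if y ∈ nbl e then (if y ∈ pre ++ [x] then 2 else 1) else 0 := by
        intro y hy
        by_cases hyx : y = x
        · simp [hyx, hxe]
        · simp [hyx, Function.update_apply, h1 y hy]
      refine ⟨by omega, by omega, by omega, hpl', fun hk1 => ⟨by omega, ⟨hS', ?_, ?_⟩, by omega⟩,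
        fun hk1 => ⟨⟨hS', ?_, ?_⟩, by omega⟩⟩
      · simp [hxe]
      · have hk0 : k ≠ 0 := by omega
        have hk2 : k - 1 = (pre.filter (· ∈ nbl e)).length := by omega
        simp [hk0, hxe, hk2, List.getD_eq_getElem?_getD]
      · simp [hxe]
      · by_cases hk0 : k = 0
        · simp [hk0]
        · have hk2 : k - 1 ≠ (pre.filter (· ∈ nbl e)).length := by omega
          simp only [hk0, if_false, List.filter_append, List.getD_eq_getElem?_getD]
          rcases Nat.lt_or_ge (k - 1) (pre.filter (· ∈ nbl e)).length with hlt | hge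
          · rw [List.getElem?_append_left hlt]
            exact ⟨trivial, rfl⟩
          · rw [List.getElem?_eq_none hge, List.getElem?_eq_none]
            · exact ⟨trivial, rfl⟩
            · simp only [List.length_append, List.filter_singleton, hxe, decide_true, if_true,
                List.length_cons, List.length_nil, cond_true]
              omega
    · simp only [hxe, if_false] at hSx
      simp only [ok_block_cons, ok_store, ok_add, ok_block_nil, ok_load, ok_ite_eq, ok_skip,
        hB'.reg_one, h15, hSx, reg_setReg, arr_setReg, if_true, if_false,
        Nat.reduceEqDiff, OfNat.zero_ne_ofNat, zero_ne_one, not_false_iff, false_imp_iff,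
        forall_const, true_and]
      refine ⟨by omega, ⟨?_, ?_, ?_, ?_⟩, by omega⟩
      · intro y hy
        by_cases hyx : y = x
        · simp [hyx, hxe, hSx]
        · simp [hyx, h1 y hy]
      · simp [hxe, h2]
      · simp [h3]
      · simp [hxe, h4]
  · rintro t s' ⟨⟨h1, h2, h3, h4⟩, h5, h6, h7⟩
    simp only [ok_block_nil]
    exact ⟨h1, h4, by omega⟩

/-- The two final writes are there because in a simple graph `f` and `x` are not in their own lists,
but belong to the candidate. If one of them is `n`, the write goes to cell `n`, which no vertex
uses. -/
theorem ok_markThird (hin : Input n W off nb nbl) {s : Memory} {N F : List ℕ} {f x : ℕ}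
    (hB : Base n off nb s) (hf : s.reg 7 = f) (hfn : f ≤ n) (hx : s.reg 8 = x) (hxn : x ≤ n)
    (hS : ∀ y < n, s.arr 5 y = if y ∈ N then (if y ∈ F then 2 else 1) else 0) :
    Ok W markThird s (fun t s' =>
      (∀ y < n, s'.arr 5 y = if y = f ∨ y = x then 3 else
        if y ∈ N then (if y ∈ F then (if y ∈ nbl x then 3 else 2) else 1) else 0) ∧
      t ≤ 9 * (nbl x).length + 9) := by
  have hn := hin.n_lt
  simp only [markThird, ok_block_cons]
  refine (ok_forNbr hin (e := x) (s := s) hB hx hxn (by decide)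
    (fun l s' => (∀ y < n, s'.arr 5 y =
        if y ∈ N then (if y ∈ F then (if y ∈ l then 3 else 2) else 1) else 0)) 5
    (by decide) (by decide) (by decide) ?_ ?_ ?_).mono ?_
  · rintro l s s' ⟨hr, ha⟩ h
    simpa [hr, ha] using h
  · simpa using hS
  · rintro pre z suf s' hs hz hB' hfr h15 h1
    have hSz := h1 z hz
    have hb : s'.arr 5 z ≤ 3 := by rw [hSz]; split_ifs <;> omega
    simp only [ok_block_cons, ok_store, ok_block_nil, ok_load, ok_ite_eq, ok_skip,
        hB'.reg_two, hB'.reg_three, h15, 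
        reg_setArr, reg_setReg, arr_setReg, arr_setArr, if_true, if_false,
        Nat.reduceEqDiff]
    refine ⟨by omega, fun h2 => ⟨by omega, by omega, ?_, by omega⟩, fun h2 => ⟨?_, by omega⟩⟩
    · intro y hy
      by_cases hyz : y = z
      · subst hyz
        rw [h2] at hSz
        simp only [Function.update_self, List.mem_append, List.mem_singleton, or_true, if_true]
        split_ifs at hSz ⊢ <;> simp_all
      · simp [hyz, Function.update_apply, h1 y hy]
    · intro y hy
      by_cases hyz : y = z
      · subst hyz
        rw [hSz] at h2
        rw [hSz]
        simp only [List.mem_append, List.mem_singleton, or_true, if_true]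
        split_ifs at h2 ⊢ <;> simp_all
      · simp [hyz, h1 y hy]
  · rintro t s' ⟨h1, h2, h3, h4⟩
    simp only [ok_block_nil, ok_store, reg_setArr, arr_setArr, if_true,
      h3.1 8 (by decide), h3.1 7 (by decide), hf, hx, h2.reg_three]
    refine ⟨by omega, by omega, by omega, by omega, ?_, by omega⟩
    intro y hy
    by_cases hyf : y = f
    · simp [hyf]
    · by_cases hyx : y = x
      · simp [hyf, hyx, Function.update_apply]
      · simp [hyf, hyx, Function.update_apply, h1 y hy]

end Seed

end RAM

namespace RAM

/-! ### From marks to the queue: the candidates for a first clique -/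

section Seed

variable {n W : ℕ} {off nb : ℕ → ℕ} {nbl : ℕ → List ℕ}

/-- The array `q` starts with the entries of `l`. -/
def Queue (q : ℕ → ℕ) (l : List ℕ) : Prop := ∀ i (h : i < l.length), q i = l[i]

theorem Queue.concat {q : ℕ → ℕ} {l : List ℕ} (h : Queue q l) (y : ℕ) :
    Queue (Function.update q l.length y) (l ++ [y]) := by
  intro i hi
  rcases Nat.lt_or_ge i l.length with h1 | h1
  · rw [Function.update_of_ne (by omega), List.getElem_append_left h1, h i h1]
  · have : i = l.length := by simp at hi; omega
    subst this
    simp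

/-- Start the queue (array `6`, length in register `10`) with the vertex in register `5` and its
neighbours with mark `3`, give them a new label in array `3`, and clear the marks. -/
def seedQueue : Prog :=
  block [.add 6 6 2, .store 3 5 6, .store 6 1 5, .add 10 2 1,
    forNbr 5 (block [.load 17 5 15, .store 5 15 1,
      .ite (.eq 17 4) (block [.store 3 15 6, .store 6 10 15, .add 10 10 2]) .skip])]

/-- By `hS0` all nonzero marks sit on neighbours of `e`, so clearing along this one list restores
the array at a cost proportional to the degree of `e` instead of `n`. -/
theorem ok_seedQueue (hin : Input n W off nb nbl) (hnd : ∀ v, (nbl v).Nodup) {s : Memory}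
    {e L : ℕ} (hB : Base n off nb s) (he : s.reg 5 = e) (hen : e < n)
    (hL : s.reg 6 = L) (hLW : L + 1 < W) {T : ℕ → Prop} [DecidablePred T]
    (hS : ∀ y < n, s.arr 5 y ≤ 3) (hST : ∀ y ∈ nbl e, s.arr 5 y = 3 ↔ T y)
    (hS0 : ∀ y < n, y ∉ nbl e → s.arr 5 y = 0) :
    Ok W seedQueue s (fun t s' =>
      (∀ y, s'.arr 3 y = if y ∈ e :: (nbl e).filter (fun y => T y) then L + 1
        else s.arr 3 y) ∧
      Queue (s'.arr 6) (e :: (nbl e).filter (fun y => T y)) ∧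
      s'.reg 10 = (e :: (nbl e).filter (fun y => T y)).length ∧
      s'.reg 6 = L + 1 ∧ (∀ y < n, s'.arr 5 y = 0) ∧ t ≤ 12 * (nbl e).length + 10) := by
  have hn := hin.n_lt
  have hlen : (nbl e).length + 1 < W ∨ nbl e = [] := by
    rcases h : nbl e with _ | ⟨a, l⟩
    · simp
    · left
      have h1 : (nbl e).length ≤ n := by
        have := (hnd e).subperm (l₂ := List.range n)
          (fun y hy => List.mem_range.2 (hin.lt_of_mem e y hy))
        simpa using this.length_le
      rw [h] at h1
      omega
  simp only [seedQueue, ok_block_cons, ok_add, ok_store, reg_setReg, reg_setArr, arr_setReg,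
    arr_setArr, hB.reg_one, hB.reg_zero, he, hL, if_true, if_false, Nat.reduceEqDiff,
    OfNat.one_ne_ofNat]
  refine ⟨by omega, by omega, by omega, by omega, by omega, by omega, ?_⟩
  set s1 := ((((s.setReg 6 (L + 1)).setArr 3 e (L + 1)).setArr 6 0 e).setReg 10 (1 + 0)) with hs1
  have hfr1 : Frame [6, 10] [3, 6] s s1 :=
    (((Frame.setReg _ _ (by simp)).trans (Frame.setArr _ _ _ (by simp))).trans
      (Frame.setArr _ _ _ (by simp))).trans (Frame.setReg _ _ (by simp))
  refine (ok_forNbr hin (e := e) (s := s1) (hB.of_frame hfr1 (by decide) (by decide))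
    (by simp [hs1, he]) hen.le (by decide)
    (fun l s' =>
      (∀ y, s'.arr 3 y = if y ∈ e :: l.filter (fun y => T y) then L + 1
        else s.arr 3 y) ∧
      Queue (s'.arr 6) (e :: l.filter (fun y => T y)) ∧
      s'.reg 10 = (e :: l.filter (fun y => T y)).length ∧
      s'.reg 6 = L + 1 ∧ (∀ y < n, s'.arr 5 y = if y ∈ l then 0 else s.arr 5 y)) 8
    (by decide) (by decide) (by decide) ?_ ?_ ?_).mono ?_
  · rintro l s s' ⟨hr, ha⟩ h
    simpa [hr, ha] using h
  · refine ⟨fun y => ?_, ?_, ?_, ?_, ?_⟩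
    · simp [hs1, Function.update_apply]
    · intro i hi
      simp only [List.filter_nil, List.length_singleton, Nat.lt_one_iff] at hi
      subst hi
      simp [hs1]
    · simp [hs1]
    · simp [hs1]
    · simp [hs1]
  · rintro pre x suf s' hs hx hB' hfr h15 ⟨h1, h2, h3, h4, h5⟩
    have hxpre : x ∉ pre := by
      have := hnd e
      rw [hs, List.nodup_append] at this
      intro h
      exact this.2.2 x h x (by simp) rfl
    have hpl : (e :: pre.filter (fun y => T y)).length + 1 < W := by
      have h1 := List.length_filter_le (fun y => decide (T y)) pre
      have h2 : (nbl e).length = pre.length + suf.length + 1 := by simp [hs]; omega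
      have h3 : (nbl e).length ≤ n := by
        have := (hnd e).subperm (l₂ := List.range n)
          (fun y hy => List.mem_range.2 (hin.lt_of_mem e y hy))
        simpa using this.length_le
      simp only [List.length_cons]
      omega
    have hSx := h5 x hx
    simp only [hxpre, if_false] at hSx
    have hTx := hST x (by simp [hs])
    have hb := hS x hx
    have hS' : ∀ y < n, Function.update (s'.arr 5) x 0 y =
        if y ∈ pre ++ [x] then 0 else s.arr 5 y := by
      intro y hy
      by_cases hyx : y = x
      · simp [hyx]
      · simp [hyx, Function.update_apply, h5 y hy]
    simp only [ok_block_cons, ok_store, ok_add, ok_block_nil, ok_load, ok_ite_eq, ok_skip,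
        hB'.reg_one, hB'.reg_three, hB'.reg_zero, h15, hSx, h3, h4, reg_setReg, arr_setReg,
        reg_setArr, arr_setArr, if_true, if_false, Nat.reduceEqDiff, OfNat.one_ne_ofNat]
    refine ⟨by omega, by omega, by omega, fun hT => ?_, fun hT => ?_⟩
    · rw [hTx] at hT
      refine ⟨by omega, by omega, by omega, by omega, by omega, ⟨?_, ?_, ?_, trivial, hS'⟩, by omega⟩
      · intro y
        by_cases hyx : y = x
        · simp [hyx, hT]
        · simp [hyx, Function.update_apply, h1 y]
      · simpa [hT] using h2.concat x
      · simp [hT]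
    · rw [hTx] at hT
      refine ⟨⟨?_, ?_, ?_, trivial, hS'⟩, by omega⟩
      · simpa [hT] using h1
      · simpa [hT] using h2
      · simp [hT]
  · rintro t s' ⟨⟨h1, h2, h3, h4, h5⟩, h6, h7, h8⟩
    simp only [ok_block_nil]
    refine ⟨h1, h2, h3, h4, ?_, by omega⟩
    intro y hy
    rw [h5 y hy]
    split_ifs with hye
    · rfl
    · exact hS0 y hy hye

/-- The last neighbour of `e` (or `n`). -/
def seedF (n : ℕ) (nbl : ℕ → List ℕ) (e : ℕ) : ℕ := (nbl e).getLastD n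

/-- The `k`-th common neighbour of `e` and `seedF e` (or `n`). -/
def seedX (n : ℕ) (nbl : ℕ → List ℕ) (k e : ℕ) : ℕ :=
  if k = 0 then n else ((nbl (seedF n nbl e)).filter (· ∈ nbl e)).getD (k - 1) n

/-- The `k`-th candidate for a first clique that contains `e`. -/
def seedList (n : ℕ) (nbl : ℕ → List ℕ) (k e : ℕ) : List ℕ :=
  e :: (nbl e).filter (fun y => y = seedF n nbl e ∨ y = seedX n nbl k e ∨
    (y ∈ nbl (seedF n nbl e) ∧ y ∈ nbl (seedX n nbl k e)))

theorem seedF_mem (e : ℕ) : seedF n nbl e ∈ nbl e ∨ seedF n nbl e = n := by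
  unfold seedF
  rcases h : nbl e with _ | ⟨a, l⟩
  · simp
  · left
    have : (a :: l).getLastD n = (a :: l).getLast (by simp) := by
      simp [List.getLastD_eq_getLast?, List.getLast?_eq_getLast_of_ne_nil]
    rw [this]
    exact List.getLast_mem _

theorem seedX_mem (k e : ℕ) : (seedX n nbl k e ∈ nbl e ∧ seedX n nbl k e ∈ nbl (seedF n nbl e)) ∨
    seedX n nbl k e = n := by
  unfold seedX
  split_ifs
  · simp
  · rcases Nat.lt_or_ge (k - 1) ((nbl (seedF n nbl e)).filter (· ∈ nbl e)).length with h | h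
    · left
      rw [List.getD_eq_getElem _ _ h]
      have := List.getElem_mem h
      simp only [List.mem_filter, decide_eq_true_eq] at this
      exact ⟨this.2, this.1⟩
    · right
      exact List.getD_eq_default _ _ h

/-- Seed the queue with the `k`-th candidate for a first clique. -/
def seed (k : ℕ) : Prog :=
  block [markFirst, markSecond k, markThird, seedQueue]

/-- The time is bounded by the degrees of `e`, `seedF` and `seedX`. Each of them is in the component
of `e` or is the missing vertex `n`, so seeding can be charged to that component. -/
theorem ok_seed (hin : Input n W off nb nbl) (hnd : ∀ v, (nbl v).Nodup) {s : Memory}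
    {e L k : ℕ} (hB : Base n off nb s) (he : s.reg 5 = e) (hen : e < n) (hk : k < 3)
    (hL : s.reg 6 = L) (hLW : L + 1 < W) (hS : ∀ y < n, s.arr 5 y = 0) :
    Ok W (seed k) s (fun t s' =>
      (∀ y, s'.arr 3 y = if y ∈ seedList n nbl k e then L + 1 else s.arr 3 y) ∧
      Queue (s'.arr 6) (seedList n nbl k e) ∧
      s'.reg 10 = (seedList n nbl k e).length ∧
      s'.reg 6 = L + 1 ∧ (∀ y < n, s'.arr 5 y = 0) ∧
      Base n off nb s' ∧ Frame [6, 7, 8, 9, 10, 13, 14, 15, 16, 17] [3, 5, 6] s s' ∧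
      t ≤ 19 * (nbl e).length + 13 * (nbl (seedF n nbl e)).length +
        9 * (nbl (seedX n nbl k e)).length + 40) := by
  have hn := hin.n_lt
  have hFn : seedF n nbl e ≤ n := by
    rcases seedF_mem (n := n) (nbl := nbl) e with h | h
    · exact (hin.lt_of_mem _ _ h).le
    · exact h.le
  have hXn : seedX n nbl k e ≤ n := by
    rcases seedX_mem (n := n) (nbl := nbl) k e with h | h
    · exact (hin.lt_of_mem _ _ h.1).le
    · exact h.le
  -- The footprint does not depend on `k`; rewriting it to a closed term lets `decide` evaluate it.
  have hwr : ∀ k, (markSecond k).wr = (markSecond 0).wr := fun _ => rfl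
  have hwa : ∀ k, (markSecond k).wa = (markSecond 0).wa := fun _ => rfl
  simp only [seed, ok_block_cons]
  refine (ok_markFirst hin hB he hen hS).frame.mono ?_
  rintro t1 s1 ⟨⟨h1, h2, h3⟩, hf1⟩
  have hB1 := hB.of_frame hf1 (by decide) (by decide)
  refine (ok_markSecond hin hnd (e := e) (k := k) hB1 h2 hFn hk h1).frame.mono ?_
  rintro t2 s2 ⟨⟨h4, h5, h6⟩, hf2⟩
  rw [hwr, hwa] at hf2
  have hB2 := hB1.of_frame hf2 (by decide) (by decide)
  have h7 : s2.reg 7 = seedF n nbl e := by rw [hf2.1 7 (by decide), h2]; rfl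
  refine (ok_markThird hin (x := seedX n nbl k e) hB2 h7 hFn h5 hXn h4).frame.mono ?_
  rintro t3 s3 ⟨⟨h8, h9⟩, hf3⟩
  have hB3 := hB2.of_frame hf3 (by decide) (by decide)
  have hfr : Frame [6, 7, 8, 9, 10, 13, 14, 15, 16, 17] [3, 5, 6] s s3 :=
    ((hf1.mono (by decide) (by decide)).trans (hf2.mono (by decide) (by decide))).trans
      (hf3.mono (by decide) (by decide))
  have hfr6 : s3.reg 6 = L := by
    rw [hf3.1 6 (by decide), hf2.1 6 (by decide), hf1.1 6 (by decide), hL]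
  have hfr5 : s3.reg 5 = e := by
    rw [hf3.1 5 (by decide), hf2.1 5 (by decide), hf1.1 5 (by decide), he]
  refine (ok_seedQueue hin hnd hB3 hfr5 hen hfr6 hLW
    (T := fun y => y = seedF n nbl e ∨ y = seedX n nbl k e ∨
    (y ∈ nbl (seedF n nbl e) ∧ y ∈ nbl (seedX n nbl k e))) ?_ ?_ ?_).frame.mono ?_
  · intro y hy
    rw [h8 y hy]
    split_ifs <;> omega
  · intro y hy
    have hy' := hin.lt_of_mem _ _ hy
    rw [h8 y hy', if_pos hy]
    change (if _ then 3 else if y ∈ nbl (seedF n nbl e) then _ else _) = 3 ↔ _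
    split_ifs <;> simp_all <;> tauto
  · intro y hy hye
    rw [h8 y hy, if_neg, if_neg hye]
    rintro (rfl | rfl)
    · rcases seedF_mem (n := n) (nbl := nbl) e with h | h
      · exact hye h
      · omega
    · rcases seedX_mem (n := n) (nbl := nbl) k e with h | h
      · exact hye h.1
      · omega
  · rintro t4 s4 ⟨⟨g1, g2, g3, g4, g5, g6⟩, hf4⟩
    simp only [ok_block_nil]
    have ha3 : s3.arr 3 = s.arr 3 := by
      rw [hf3.2 3 (by decide), hf2.2 3 (by decide), hf1.2 3 (by decide)]
    rw [ha3] at g1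
    refine ⟨g1, g2, g3, g4, g5, hB3.of_frame hf4 (by decide) (by decide),
      hfr.trans (hf4.mono (by decide) (by decide)), ?_⟩
    have : (nbl ((nbl e).getLastD n)).length = (nbl (seedF n nbl e)).length := rfl
    omega

end Seed

end RAM

/-! ### Labelling the vertices of a line graph by pairs of cliques -/

section Labels

variable {U : Type*} {n : ℕ} {nbl : ℕ → List ℕ} {inc : ℕ → U → Prop}

/-- The lists `nbl e` are the adjacency lists of the line graph of a simple graph with edges
`0, …, n - 1` and incidence relation `inc`. -/
structure LineData (n : ℕ) (nbl : ℕ → List ℕ) (inc : ℕ → U → Prop) : Prop where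
  nodup : ∀ e, (nbl e).Nodup
  mem_iff : ∀ e y, y ∈ nbl e ↔ e < n ∧ y < n ∧ e ≠ y ∧ ∃ u, inc e u ∧ inc y u
  two : ∀ e < n, ∃ a b, a ≠ b ∧ ∀ u, inc e u ↔ u = a ∨ u = b
  simple : ∀ e < n, ∀ y < n, ∀ u v, u ≠ v → inc e u → inc y u → inc e v → inc y v → e = y

theorem LineData.symm (h : LineData n nbl inc) {e y : ℕ} (hy : y ∈ nbl e) : e ∈ nbl y := by
  rw [h.mem_iff] at hy ⊢
  obtain ⟨h1, h2, h3, u, h4, h5⟩ := hy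
  exact ⟨h2, h1, h3.symm, u, h5, h4⟩

theorem LineData.exists_other (h : LineData n nbl inc) {e : ℕ} (he : e < n) {u : U}
    (hu : inc e u) : ∃ v, v ≠ u ∧ ∀ w, inc e w ↔ w = u ∨ w = v := by
  obtain ⟨a, b, hab, hw⟩ := h.two e he
  rcases (hw u).1 hu with rfl | rfl
  · exact ⟨b, hab.symm, hw⟩
  · exact ⟨a, hab, fun w => by rw [hw]; tauto⟩

/-- The state of the labels `P`, `Q` while the component `C` is labelled: `l` lists the labelled
vertices of `C`, the labels in use lie in `(L₀, L]`, and nothing changed outside `l`. -/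
structure Lab (C : Finset ℕ) (L₀ : ℕ) (P₀ Q₀ P Q : ℕ → ℕ) (l : List ℕ) (L : ℕ) : Prop where
  nodup : l.Nodup
  sub : ∀ y ∈ l, y ∈ C
  out : ∀ y, y ∉ l → P y = P₀ y ∧ Q y = Q₀ y
  p_mem : ∀ y ∈ l, L₀ < P y ∧ P y ≤ L
  q_mem : ∀ y ∈ l, Q y = 0 ∨ (L₀ < Q y ∧ Q y ≤ L ∧ Q y ≠ P y)

/-- The labels in `(L₀, L]` correspond to vertices of the underlying graph. -/
def Faithful (inc : ℕ → U → Prop) (C : Finset ℕ) (L₀ : ℕ) (P Q : ℕ → ℕ) (L : ℕ) : Prop :=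
  ∃ ψ : ℕ → U, (∀ k, L₀ < k → k ≤ L → ∀ y ∈ C, (P y = k ∨ Q y = k) ↔ inc y (ψ k)) ∧
    ∀ k j, L₀ < k → k ≤ L → L₀ < j → j ≤ L → ψ k = ψ j → k = j

/-- The vertex `y` has a label in common with the first label of `e`. -/
def SharesP (P Q : ℕ → ℕ) (e y : ℕ) : Prop := P y = P e ∨ Q y = P e

instance (P Q : ℕ → ℕ) (e y : ℕ) : Decidable (SharesP P Q e y) :=
  inferInstanceAs (Decidable (_ ∨ _))

/-- First labels after the vertices in `pre` got the label `k` where needed. -/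
def scanP (P Q : ℕ → ℕ) (e k : ℕ) (pre : List ℕ) (y : ℕ) : ℕ :=
  if y ∈ pre ∧ ¬ SharesP P Q e y ∧ P y = 0 then k else P y

/-- Second labels after the vertices in `pre` got the label `k` where needed. -/
def scanQ (P Q : ℕ → ℕ) (e k : ℕ) (pre : List ℕ) (y : ℕ) : ℕ :=
  if y ∈ pre ∧ ¬ SharesP P Q e y ∧ P y ≠ 0 ∧ Q y = 0 then k else Q y

/-- The queue after the vertices in `pre` got a label where needed. -/
def scanL (P Q : ℕ → ℕ) (e : ℕ) (l pre : List ℕ) : List ℕ :=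
  l ++ pre.filter (fun y => ¬ SharesP P Q e y ∧ P y = 0)

/-! ### One step of the labelling, and the test that accepts it -/

variable {C : Finset ℕ} {L₀ L : ℕ} {P₀ Q₀ P Q : ℕ → ℕ} {l : List ℕ}

/-- This part of the invariant does not depend on the first clique being right. The label given out
is new, hence differs from every label in use, and vertices of `C` outside `l` still have both
labels `0`. -/
theorem Lab.scan (h : Lab C L₀ P₀ Q₀ P Q l L) (hd : LineData n nbl inc) {e : ℕ}
    (hC : ∀ e ∈ C, ∀ y ∈ nbl e, y ∈ C) (h0 : ∀ y ∈ C, P₀ y = 0 ∧ Q₀ y = 0)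
    (hL : L₀ ≤ L) (he : e ∈ l) :
    Lab C L₀ P₀ Q₀ (scanP P (Function.update Q e (L + 1)) e (L + 1) (nbl e))
      (scanQ P (Function.update Q e (L + 1)) e (L + 1) (nbl e))
      (scanL P (Function.update Q e (L + 1)) e l (nbl e)) (L + 1) := by
  have hee : e ∉ nbl e := by rw [hd.mem_iff]; tauto
  have hpe := h.p_mem e he
  set Q1 := Function.update Q e (L + 1) with hQ1
  have hQy : ∀ y, y ≠ e → Q1 y = Q y := fun y hy => Function.update_of_ne hy _ _
  have hQe : Q1 e = L + 1 := Function.update_self ..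
  have hmem : ∀ y, y ∈ scanL P Q1 e l (nbl e) ↔
      y ∈ l ∨ (y ∈ nbl e ∧ ¬ SharesP P Q1 e y ∧ P y = 0) := by
    intro y; simp [scanL]
  have hz : ∀ y ∈ nbl e, y ∉ l → P y = 0 ∧ Q y = 0 := by
    intro y hy hyl
    rw [(h.out y hyl).1, (h.out y hyl).2]
    exact h0 y (hC e (h.sub e he) y hy)
  refine ⟨?_, ?_, ?_, ?_, ?_⟩
  · rw [scanL, List.nodup_append]
    refine ⟨h.nodup, (hd.nodup e).filter _, ?_⟩
    rintro a ha b hb rfl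
    simp only [List.mem_filter, decide_eq_true_eq] at hb
    have := h.p_mem a ha
    omega
  · intro y hy
    rcases (hmem y).1 hy with h1 | h1
    · exact h.sub y h1
    · exact hC e (h.sub e he) y h1.1
  · intro y hy
    rw [hmem] at hy
    push Not at hy
    have hye : y ≠ e := by rintro rfl; exact hy.1 he
    have ho := h.out y hy.1
    refine ⟨?_, ?_⟩
    · rw [scanP, if_neg, ho.1]
      rintro ⟨h1, h2, h3⟩
      exact hy.2 h1 h2 h3
    · rw [scanQ, if_neg, hQy y hye, ho.2]
      rintro ⟨h1, h2, h3, h4⟩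
      exact h3 (hz y h1 hy.1).1
  · intro y hy
    rw [scanP]
    split_ifs with h1
    · omega
    · rcases (hmem y).1 hy with h2 | h2
      · have := h.p_mem y h2; omega
      · exact absurd h2 h1
  · intro y hy
    by_cases hye : y = e
    · subst hye
      right
      rw [scanQ, if_neg (fun h => hee h.1), scanP, if_neg (fun h => hee h.1), hQe]
      omega
    · rcases (hmem y).1 hy with h2 | h2
      · have hp := h.p_mem y h2
        have hP : scanP P Q1 e (L + 1) (nbl e) y = P y := by
          rw [scanP, if_neg]; rintro ⟨_, _, h3⟩; omega
        rw [hP, scanQ, hQy y hye]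
        split_ifs with h3
        · right; omega
        · rcases h.q_mem y h2 with h4 | h4
          · exact Or.inl h4
          · right; omega
      · left
        rw [scanQ, if_neg (fun h => h.2.2.1 h2.2.2), hQy y hye]
        by_cases hyl : y ∈ l
        · have := h.p_mem y hyl; omega
        · exact (hz y h2.1 hyl).2

/-- Let `u` be the end of `e` that its first label stands for, and `v` the other end. No label
stands for `v` yet. By simplicity, the neighbours of `e` without the first label of `e` are exactly
the other edges at `v`. Each of these has a free slot: two labels in use would both stand for its
one end other than `v`, against injectivity. So giving `L + 1` to all of them extends `ψ` by `L + 1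
↦ v`. -/
theorem Lab.faithful_scan (h : Lab C L₀ P₀ Q₀ P Q l L) (hd : LineData n nbl inc) {e : ℕ}
    (h0 : ∀ y ∈ C, P₀ y = 0 ∧ Q₀ y = 0)
    (hCn : ∀ y ∈ C, y < n) (he : e ∈ l) (hQe : Q e = 0)
    (hf : Faithful inc C L₀ P Q L) :
    Faithful inc C L₀ (scanP P (Function.update Q e (L + 1)) e (L + 1) (nbl e))
      (scanQ P (Function.update Q e (L + 1)) e (L + 1) (nbl e)) (L + 1) := by
  obtain ⟨ψ, h1, h2⟩ := hf
  have hee : e ∉ nbl e := by rw [hd.mem_iff]; tauto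
  have hpe := h.p_mem e he
  have heC := h.sub e he
  have hen := hCn e heC
  set Q1 := Function.update Q e (L + 1) with hQ1
  have hQy : ∀ y, y ≠ e → Q1 y = Q y := fun y hy => Function.update_of_ne hy _ _
  have hQ1e : Q1 e = L + 1 := Function.update_self ..
  have hu : inc e (ψ (P e)) := (h1 _ hpe.1 hpe.2 e heC).1 (Or.inl rfl)
  obtain ⟨v, hvu, hw⟩ := hd.exists_other hen hu
  have hzero : ∀ y ∈ C, P y = 0 → Q y = 0 := by
    intro y hy hp
    by_cases hyl : y ∈ l
    · have := h.p_mem y hyl; omega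
    · rw [(h.out y hyl).2]; exact (h0 y hy).2
  -- A label for `v` would be a label of `e`: not the first, which stands for `u`, and not the
  -- second, which is still `0`.
  have hvnew : ∀ k, L₀ < k → k ≤ L → ψ k ≠ v := by
    rintro k hk1 hk2 rfl
    rcases (h1 k hk1 hk2 e heC).2 ((hw _).2 (Or.inr rfl)) with h3 | h3
    · subst h3; exact hvu rfl
    · omega
  have hbound : ∀ y ∈ C, P y ≤ L ∧ Q y ≤ L := by
    intro y hy
    by_cases hyl : y ∈ l
    · have := h.p_mem y hyl
      rcases h.q_mem y hyl with h3 | h3 <;> omega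
    · rw [(h.out y hyl).1, (h.out y hyl).2, (h0 y hy).1, (h0 y hy).2]; omega
  have hshare : ∀ y ∈ C, y ≠ e → (SharesP P Q1 e y ↔ inc y (ψ (P e))) := by
    intro y hy hye
    rw [SharesP, hQy y hye, h1 _ hpe.1 hpe.2 y hy]
  -- a neighbour through `v` still has a free label
  have hfree : ∀ y ∈ C, y ≠ e → inc y v → Q y = 0 := by
    intro y hy hye hyv
    by_contra hq
    have hyl : y ∈ l := by
      by_contra hyl
      exact hq (by rw [(h.out y hyl).2]; exact (h0 y hy).2)
    have hp := h.p_mem y hyl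
    have hq' := (h.q_mem y hyl).resolve_left hq
    obtain ⟨w, hwv, hw'⟩ := hd.exists_other (hCn y hy) hyv
    have e1 := (hw' _).1 ((h1 _ hp.1 hp.2 y hy).1 (Or.inl rfl))
    have e2 := (hw' _).1 ((h1 _ hq'.1 hq'.2.1 y hy).1 (Or.inr rfl))
    have e1' := e1.resolve_left (hvnew _ hp.1 hp.2)
    have e2' := e2.resolve_left (hvnew _ hq'.1 hq'.2.1)
    exact hq'.2.2 (h2 _ _ hq'.1 hq'.2.1 hp.1 hp.2 (e2'.trans e1'.symm))
  have hnbr : ∀ y ∈ C, y ≠ e → (inc y v ↔ y ∈ nbl e ∧ ¬ SharesP P Q1 e y) := by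
    intro y hy hye
    rw [hshare y hy hye, hd.mem_iff]
    constructor
    · intro hyv
      refine ⟨⟨hen, hCn y hy, hye.symm, v, (hw v).2 (Or.inr rfl), hyv⟩, fun hyu => hye ?_⟩
      exact hd.simple y (hCn y hy) e hen _ _ hvu hyv ((hw v).2 (Or.inr rfl)) hyu hu
    · rintro ⟨⟨_, _, _, w, hw1, hw2⟩, hyu⟩
      rcases (hw w).1 hw1 with rfl | rfl
      · exact absurd hw2 hyu
      · exact hw2
  refine ⟨Function.update ψ (L + 1) v, ?_, ?_⟩
  · intro k hk1 hk2 y hy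
    have hb := hbound y hy
    rcases Nat.lt_or_ge L k with hk | hk
    · obtain rfl : k = L + 1 := by omega
      rw [Function.update_self]
      by_cases hye : y = e
      · subst hye
        simp [scanQ, hee, hQ1e, hw]
      · rw [hnbr y hy hye, scanP, scanQ, hQy y hye]
        constructor
        · rintro (h3 | h3)
          · split_ifs at h3 with h4
            · exact ⟨h4.1, h4.2.1⟩
            · omega
          · split_ifs at h3 with h4
            · exact ⟨h4.1, h4.2.1⟩
            · omega
        · intro h3
          have h4 := hfree y hy hye ((hnbr y hy hye).2 h3)
          by_cases h5 : P y = 0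
          · left; rw [if_pos ⟨h3.1, h3.2, h5⟩]
          · right; rw [if_pos ⟨h3.1, h3.2, h5, h4⟩]
    · rw [Function.update_of_ne (by omega), ← h1 k hk1 hk y hy, scanP, scanQ]
      by_cases hye : y = e
      · subst hye
        simp only [hee, false_and, if_false, hQ1e, hQe]
        omega
      · rw [hQy y hye]
        split_ifs <;> omega
  · intro k j hk1 hk2 hj1 hj2 hkj
    rcases Nat.lt_or_ge L k with hk | hk <;> rcases Nat.lt_or_ge L j with hj | hj
    · omega
    · obtain rfl : k = L + 1 := by omega
      rw [Function.update_self, Function.update_of_ne (by omega)] at hkj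
      exact absurd hkj.symm (hvnew j hj1 hj)
    · obtain rfl : j = L + 1 := by omega
      rw [Function.update_self, Function.update_of_ne (by omega)] at hkj
      exact absurd hkj (hvnew k hk1 hk)
    · rw [Function.update_of_ne (by omega), Function.update_of_ne (by omega)] at hkj
      exact h2 k j hk1 hk hj1 hj hkj

/-- How often `k` occurs among the two labels of `y`. -/
def wt (P Q : ℕ → ℕ) (k y : ℕ) : ℕ := (if P y = k then 1 else 0) + (if Q y = k then 1 else 0)

/-- The number of coincidences between the labels of `e` and `y`. -/
def coin (P Q : ℕ → ℕ) (e y : ℕ) : ℕ := wt P Q (P e) y + wt P Q (Q e) y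

/-- The test by which a labelling of a component is accepted. -/
def Passes (nbl : ℕ → List ℕ) (P Q : ℕ → ℕ) (l : List ℕ) (e : ℕ) : Prop :=
  (l.map (wt P Q (P e))).sum + (l.map (wt P Q (Q e))).sum = (nbl e).length + 2 ∧
    ∀ y ∈ nbl e, P y = P e ∨ Q y = P e ∨ P y = Q e ∨ Q y = Q e

/-- For faithful labels the two counts are the sizes of the stars at the two ends of `e`. Their
union is the closed neighbourhood of `e` and their intersection is `{e}`, whence `deg e + 2`. -/
theorem Lab.passes_of_faithful (h : Lab C L₀ P₀ Q₀ P Q l L) (hd : LineData n nbl inc)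
    (hC : ∀ e ∈ C, ∀ y ∈ nbl e, y ∈ C) (h0 : ∀ y ∈ C, P₀ y = 0 ∧ Q₀ y = 0)
    (hCn : ∀ y ∈ C, y < n) (hf : Faithful inc C L₀ P Q L) (hQ : ∀ y ∈ l, Q y ≠ 0) {e : ℕ}
    (he : e ∈ l) : Passes nbl P Q l e := by
  classical
  obtain ⟨ψ, h1, h2⟩ := hf
  have hp := h.p_mem e he
  have hq := (h.q_mem e he).resolve_left (hQ e he)
  have heC := h.sub e he
  have hen := hCn e heC
  have hu : inc e (ψ (P e)) := (h1 _ hp.1 hp.2 e heC).1 (Or.inl rfl)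
  have hv : inc e (ψ (Q e)) := (h1 _ hq.1 hq.2.1 e heC).1 (Or.inr rfl)
  have huv : ψ (Q e) ≠ ψ (P e) := fun h3 => hq.2.2 (h2 _ _ hq.1 hq.2.1 hp.1 hp.2 h3)
  have hw : ∀ w, inc e w ↔ w = ψ (P e) ∨ w = ψ (Q e) := by
    obtain ⟨v, hvu, hw⟩ := hd.exists_other hen hu
    obtain rfl : ψ (Q e) = v := ((hw _).1 hv).resolve_left huv
    exact hw
  have hmeml : ∀ k, L₀ < k → k ≤ L → ∀ y ∈ C, inc y (ψ k) → y ∈ l := by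
    intro k hk1 hk2 y hy hi
    by_contra hyl
    have := (h1 k hk1 hk2 y hy).2 hi
    rw [(h.out y hyl).1, (h.out y hyl).2, (h0 y hy).1, (h0 y hy).2] at this
    omega
  have hcount : ∀ k, L₀ < k → k ≤ L →
      (l.map (wt P Q k)).sum = (l.toFinset.filter (fun y => inc y (ψ k))).card := by
    intro k hk1 hk2
    rw [← List.sum_toFinset _ h.nodup, Finset.card_filter]
    refine Finset.sum_congr rfl fun y hy => ?_
    rw [List.mem_toFinset] at hy
    rw [← h1 k hk1 hk2 y (h.sub y hy)]
    have := ((h.q_mem y hy).resolve_left (hQ y hy)).2.2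
    unfold wt
    split_ifs <;> omega
  refine ⟨?_, ?_⟩
  · rw [hcount _ hp.1 hp.2, hcount _ hq.1 hq.2.1, ← Finset.card_union_add_card_inter]
    have e1 : l.toFinset.filter (fun y => inc y (ψ (P e))) ∪
        l.toFinset.filter (fun y => inc y (ψ (Q e))) = insert e (nbl e).toFinset := by
      ext y
      simp only [Finset.mem_union, Finset.mem_filter, List.mem_toFinset, Finset.mem_insert,
        hd.mem_iff]
      constructor
      · rintro (⟨h3, h4⟩ | ⟨h3, h4⟩)
        · by_cases hye : y = e
          · exact Or.inl hye
          · exact Or.inr ⟨hen, hCn y (h.sub y h3), Ne.symm hye, _, hu, h4⟩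
        · by_cases hye : y = e
          · exact Or.inl hye
          · exact Or.inr ⟨hen, hCn y (h.sub y h3), Ne.symm hye, _, hv, h4⟩
      · rintro (rfl | h3)
        · exact Or.inl ⟨he, hu⟩
        · have hyC : y ∈ C := hC e heC y ((hd.mem_iff e y).2 h3)
          obtain ⟨_, _, _, w, h4, h5⟩ := h3
          rcases (hw w).1 h4 with rfl | rfl
          · exact Or.inl ⟨hmeml _ hp.1 hp.2 y hyC h5, h5⟩
          · exact Or.inr ⟨hmeml _ hq.1 hq.2.1 y hyC h5, h5⟩
    have e2 : l.toFinset.filter (fun y => inc y (ψ (P e))) ∩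
        l.toFinset.filter (fun y => inc y (ψ (Q e))) = {e} := by
      ext y
      simp only [Finset.mem_inter, Finset.mem_filter, List.mem_toFinset, Finset.mem_singleton]
      constructor
      · rintro ⟨⟨h3, h4⟩, _, h5⟩
        exact hd.simple y (hCn y (h.sub y h3)) e hen _ _ huv h5 hv h4 hu
      · rintro rfl
        exact ⟨⟨he, hu⟩, he, hv⟩
    have hee : e ∉ (nbl e).toFinset := by rw [List.mem_toFinset, hd.mem_iff]; tauto
    rw [e1, e2, Finset.card_insert_of_notMem hee, List.toFinset_card_of_nodup (hd.nodup e),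
      Finset.card_singleton]
  · intro y hy
    have hyC : y ∈ C := hC e heC y hy
    obtain ⟨_, _, _, w, h4, h5⟩ := (hd.mem_iff e y).1 hy
    rcases (hw w).1 h4 with rfl | rfl
    · rcases (h1 _ hp.1 hp.2 y hyC).2 h5 with h6 | h6 <;> simp [h6]
    · rcases (h1 _ hq.1 hq.2.1 y hyC).2 h5 with h6 | h6 <;> simp [h6]

/-- Double counting, without any reference to the underlying graph: every neighbour has at least one
coincidence with `e`, and the coincidences over `l` without `e` sum to the degree. So the inequality
is an equality in every term: neighbours have exactly one coincidence, all others none. -/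
theorem Lab.coin_of_passes (h : Lab C L₀ P₀ Q₀ P Q l L) (hd : LineData n nbl inc)
    (hC : ∀ e ∈ C, ∀ y ∈ nbl e, y ∈ C) (h0 : ∀ y ∈ C, P₀ y = 0 ∧ Q₀ y = 0)
    (hb : ∀ y, P₀ y ≤ L₀ ∧ Q₀ y ≤ L₀) (hQ : ∀ y ∈ l, Q y ≠ 0) {e : ℕ}
    (he : e ∈ l) (hpass : Passes nbl P Q l e) :
    (∀ y ∈ nbl e, y ∈ l) ∧ ∀ y, y ≠ e → coin P Q e y = if y ∈ nbl e then 1 else 0 := by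
  have hp := h.p_mem e he
  have hq := (h.q_mem e he).resolve_left (hQ e he)
  have heC := h.sub e he
  have hee : e ∉ nbl e := by rw [hd.mem_iff]; tauto
  have hsub : ∀ y ∈ nbl e, y ∈ l := by
    intro y hy
    by_contra hyl
    have h3 := hpass.2 y hy
    have hyC : y ∈ C := hC e heC y hy
    rw [(h.out y hyl).1, (h.out y hyl).2, (h0 y hyC).1, (h0 y hyC).2] at h3
    omega
  refine ⟨hsub, ?_⟩
  have hge : ∀ y ∈ l.toFinset.erase e, (if y ∈ nbl e then 1 else 0) ≤ coin P Q e y := by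
    intro y _
    split_ifs with h3
    · have := hpass.2 y h3
      unfold coin wt
      split_ifs <;> omega
    · exact Nat.zero_le _
  have hsum : ∑ y ∈ l.toFinset.erase e, coin P Q e y = (nbl e).length := by
    have h3 := hpass.1
    rw [← List.sum_toFinset _ h.nodup, ← List.sum_toFinset _ h.nodup, ← Finset.sum_add_distrib,
      ← Finset.add_sum_erase _ _ (List.mem_toFinset.2 he)] at h3
    -- The vertex `e` is counted once for each of its labels; this is the `+ 2` of the test.
    have h4 : wt P Q (P e) e + wt P Q (Q e) e = 2 := by
      unfold wt
      have := hq.2.2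
      rw [if_pos rfl, if_neg this, if_neg this.symm, if_pos rfl]
    rw [h4] at h3
    have h5 : ∑ y ∈ l.toFinset.erase e, (wt P Q (P e) y + wt P Q (Q e) y) =
      ∑ y ∈ l.toFinset.erase e, coin P Q e y := rfl
    omega
  have hsum' : ∑ y ∈ l.toFinset.erase e, (if y ∈ nbl e then 1 else 0) = (nbl e).length := by
    rw [← Finset.card_filter, ← List.toFinset_card_of_nodup (hd.nodup e)]
    congr 1
    ext y
    simp only [Finset.mem_filter, Finset.mem_erase, List.mem_toFinset]
    constructor
    · exact fun h => h.2
    · exact fun h => ⟨⟨fun h' => hee (h' ▸ h), hsub y h⟩, h⟩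
  have heq := (Finset.sum_eq_sum_iff_of_le hge).1 (hsum'.trans hsum.symm)
  intro y hy
  by_cases hyl : y ∈ l
  · exact (heq y (by simp [hy, hyl])).symm
  · rw [if_neg (fun h => hyl (hsub y h))]
    -- Labels outside `l` are at most `L₀`, and those of `e` exceed `L₀`.
    have := hb y
    have ho := h.out y hyl
    unfold coin wt
    rw [ho.1, ho.2]
    split_ifs <;> omega

end Labels

/-! ### Three candidates suffice for a correct first clique -/

section SeedCorrect

variable {U : Type*} {n : ℕ} {nbl : ℕ → List ℕ} {inc : ℕ → U → Prop}

open RAM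

theorem mem_seedList {k e y : ℕ} : y ∈ seedList n nbl k e ↔ y = e ∨ (y ∈ nbl e ∧
    (y = seedF n nbl e ∨ y = seedX n nbl k e ∨
      (y ∈ nbl (seedF n nbl e) ∧ y ∈ nbl (seedX n nbl k e)))) := by
  simp [seedList]

/-- One of the three candidates is the clique of all edges at an end vertex of `e`. -/
theorem LineData.exists_seed (hd : LineData n nbl inc) {e : ℕ} (he : e < n) :
    ∃ k < 3, ∃ u, ∀ y < n, (y ∈ seedList n nbl k e ↔ inc y u) := by
  classical
  have hout : nbl n = [] := List.eq_nil_iff_forall_not_mem.2 fun y hy => by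
    rw [hd.mem_iff] at hy; omega
  have hX0 : seedX n nbl 0 e = n := rfl
  obtain ⟨a₀, b₀, hab₀, hw₀⟩ := hd.two e he
  rcases seedF_mem (n := n) (nbl := nbl) e with hf | hf
  · -- there is a neighbour
    set f := seedF n nbl e with hfdef
    obtain ⟨_, hfn, hef, u, heu, hfu⟩ := (hd.mem_iff e f).1 hf
    obtain ⟨a, hau, hwa⟩ := hd.exists_other he heu
    obtain ⟨b, hbu, hwb⟩ := hd.exists_other hfn hfu
    have hab : a ≠ b := by
      rintro rfl
      exact hef (hd.simple e he f hfn u a hau.symm heu hfu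
        ((hwa a).2 (Or.inr rfl)) ((hwb a).2 (Or.inr rfl)))
    -- If `u` has no edges besides `e` and `f`, the candidate without third vertex is right: `seedX`
    -- is then `n`, which has no neighbours.
    by_cases hA : ∀ y < n, inc y u → y = e ∨ y = f
    · refine ⟨0, by omega, u, fun y hy => ?_⟩
      rw [mem_seedList, hX0, hout, ← hfdef]
      constructor
      · rintro (rfl | ⟨h1, rfl | h2 | h2⟩)
        · exact heu
        · exact hfu
        · omega
        · simp at h2
      · intro h
        rcases hA y hy h with rfl | rfl
        · exact Or.inl rfl
        · exact Or.inr ⟨hf, Or.inl rfl⟩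
    · push Not at hA
      obtain ⟨w, hwn, hwu, hwe, hwf⟩ := hA
      set D := (nbl f).filter (· ∈ nbl e) with hD
      have hDnd : D.Nodup := (hd.nodup f).filter _
      have hDmem : ∀ y, y ∈ D ↔ y ∈ nbl f ∧ y ∈ nbl e := by simp [hD]
      have hwD : w ∈ D := by
        rw [hDmem, hd.mem_iff, hd.mem_iff]
        exact ⟨⟨hfn, hwn, hwf.symm, u, hfu, hwu⟩, he, hwn, hwe.symm, u, heu, hwu⟩
      -- With `e = ua` and `f = ub`, a common neighbour that avoids `u` is the edge `ab`. There is
      -- at most one such edge, so one of the first two common neighbours ends at `u`.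
      have hout2 : ∀ y ∈ D, ¬ inc y u → inc y a ∧ inc y b := by
        intro y hy hyu
        rw [hDmem, hd.mem_iff, hd.mem_iff] at hy
        obtain ⟨⟨_, _, _, p, hp1, hp2⟩, _, _, _, q, hq1, hq2⟩ := hy
        rcases (hwa q).1 hq1 with rfl | rfl
        · exact absurd hq2 hyu
        rcases (hwb p).1 hp1 with rfl | rfl
        · exact absurd hp2 hyu
        exact ⟨hq2, hp2⟩
      have hone : ∀ y ∈ D, ∀ z ∈ D, ¬ inc y u → ¬ inc z u → y = z := by
        intro y hy z hz hyu hzu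
        have h1 := hout2 y hy hyu
        have h2 := hout2 z hz hzu
        have hy' := ((hd.mem_iff _ _).1 ((hDmem y).1 hy).1).2.1
        have hz' := ((hd.mem_iff _ _).1 ((hDmem z).1 hz).1).2.1
        exact hd.simple y hy' z hz' a b hab h1.1 h2.1 h1.2 h2.2
      -- the correct third vertex
      have hex : ∃ k < 3, seedX n nbl k e ∈ D ∧ inc (seedX n nbl k e) u := by
        have hpos : 0 < D.length := List.length_pos_of_mem hwD
        have hx1 : seedX n nbl 1 e = D[0] := by
          simp only [seedX, one_ne_zero, if_false]
          exact List.getD_eq_getElem _ _ hpos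
        by_cases h0 : inc D[0] u
        · exact ⟨1, by omega, by rw [hx1]; exact ⟨List.getElem_mem _, h0⟩⟩
        · obtain ⟨i, hi, hiw⟩ := List.getElem_of_mem hwD
          have hi0 : i ≠ 0 := by
            rintro rfl
            rw [hiw] at h0
            exact h0 hwu
          have hlen : 1 < D.length := by omega
          have hx2 : seedX n nbl 2 e = D[1] := by
            simp only [seedX, OfNat.ofNat_ne_zero, if_false]
            exact List.getD_eq_getElem _ _ hlen
          refine ⟨2, by omega, ?_⟩
          rw [hx2]
          refine ⟨List.getElem_mem _, ?_⟩
          by_contra h1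
          have := hone _ (List.getElem_mem hpos) _ (List.getElem_mem hlen) h0 h1
          have := (hDnd.getElem_inj_iff).1 this
          omega
      obtain ⟨k, hk, hxD, hxu⟩ := hex
      refine ⟨k, hk, u, fun y hy => ?_⟩
      rw [mem_seedList, ← hfdef]
      set x := seedX n nbl k e with hx
      obtain ⟨hxf, hxe⟩ := (hDmem x).1 hxD
      obtain ⟨_, hxn, hfx, _⟩ := (hd.mem_iff _ _).1 hxf
      obtain ⟨_, _, hex, _⟩ := (hd.mem_iff _ _).1 hxe
      obtain ⟨c, hcu, hwc⟩ := hd.exists_other hxn hxu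
      constructor
      · rintro (rfl | ⟨h1, rfl | rfl | ⟨h2, h3⟩⟩)
        · exact heu
        · exact hfu
        · exact hxu
        -- Otherwise `y = ab` meets `x = uc`, so that `c` is `a` or `b`, and `x` would be parallel
        -- to `e` or to `f`.
        · by_contra hyu
          have hyab := hout2 y ((hDmem y).2 ⟨h2, h1⟩) hyu
          obtain ⟨_, _, _, p, hp1, hp2⟩ := (hd.mem_iff _ _).1 h3
          rcases (hwc p).1 hp1 with rfl | rfl
          · exact hyu hp2
          have hca : p ≠ a := by
            rintro rfl
            exact hex (hd.simple e he x hxn u p hcu.symm heu hxu ((hwa p).2 (Or.inr rfl)) hp1)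
          have hcb : p ≠ b := by
            rintro rfl
            exact hfx (hd.simple _ hfn x hxn u p hcu.symm hfu hxu ((hwb p).2 (Or.inr rfl)) hp1)
          obtain ⟨r, hra, hwr⟩ := hd.exists_other hy hyab.1
          have e1 := ((hwr b).1 hyab.2).resolve_left hab.symm
          have e2 := ((hwr p).1 hp2).resolve_left hca
          exact hcb (e2.trans e1.symm)
      · intro hyu
        by_cases hye : y = e
        · exact Or.inl hye
        refine Or.inr ⟨(hd.mem_iff _ _).2 ⟨he, hy, Ne.symm hye, u, heu, hyu⟩, ?_⟩
        by_cases hyf : y = f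
        · exact Or.inl hyf
        by_cases hyx : y = x
        · exact Or.inr (Or.inl hyx)
        exact Or.inr (Or.inr ⟨(hd.mem_iff _ _).2 ⟨hfn, hy, Ne.symm hyf, u, hfu, hyu⟩,
          (hd.mem_iff _ _).2 ⟨hxn, hy, Ne.symm hyx, u, hxu, hyu⟩⟩)
  · -- no neighbour
    have hnil : nbl e = [] := by
      unfold seedF at hf
      rcases h : nbl e with _ | ⟨a, l⟩
      · rfl
      · exfalso
        have h2 : (nbl e).getLastD n ∈ nbl e := by
          rw [h]
          simp [List.getLastD_eq_getLast?, List.getLast?_eq_getLast_of_ne_nil]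
        rw [hf, hd.mem_iff] at h2
        omega
    refine ⟨0, by omega, a₀, fun y hy => ?_⟩
    rw [mem_seedList, hnil]
    simp only [List.not_mem_nil, false_and, or_false]
    constructor
    · rintro rfl
      exact (hw₀ a₀).2 (Or.inl rfl)
    · intro h
      by_contra hye
      have : y ∈ nbl e := (hd.mem_iff _ _).2
        ⟨he, hy, Ne.symm hye, a₀, (hw₀ a₀).2 (Or.inl rfl), h⟩
      rw [hnil] at this
      simp at this

end SeedCorrect

namespace RAM

/-! ### Growing the labelling of a component -/

section Grow

variable {n W : ℕ} {off nb : ℕ → ℕ} {nbl : ℕ → List ℕ}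

/-- Label the neighbour in register `15` of the vertex in register `20` by the new label in
register `6`, unless it has the first label (register `23`) of that vertex. -/
def scanBody : Prog :=
  block [.load 17 3 15, .load 18 4 15,
    .ite (.eq 17 23) .skip (.ite (.eq 18 23) .skip
      (.ite (.eq 17 1) (block [.store 3 15 6, .store 6 10 15, .add 10 10 2])
        (.ite (.eq 18 1) (.store 4 15 6) .skip)))]

theorem Input.length_le (hin : Input n W off nb nbl) (hnd : ∀ v, (nbl v).Nodup) (e : ℕ) :
    (nbl e).length ≤ n := by
  have := (hnd e).subperm (l₂ := List.range n)
    (fun y hy => List.mem_range.2 (hin.lt_of_mem e y hy))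
  simpa using this.length_le

/-- The outcome can be stated by the labels at the start of the scan, because every neighbour is
visited only once and a visit changes only the labels of the visited vertex. -/
theorem ok_scan (hin : Input n W off nb nbl) (hnd : ∀ v, (nbl v).Nodup) {s : Memory}
    {e k : ℕ} {l : List ℕ} (hB : Base n off nb s) (he : s.reg 20 = e) (hen : e < n)
    (hpe : s.reg 23 = s.arr 3 e) (hk : s.reg 6 = k) (hkW : k < W)
    (hP : ∀ y < n, s.arr 3 y < W) (hQ : ∀ y < n, s.arr 4 y < W)
    (hq : Queue (s.arr 6) l) (hqt : s.reg 10 = l.length) (hl : l.length ≤ n) :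
    Ok W (forNbr 20 scanBody) s (fun t s' =>
      (∀ y, s'.arr 3 y = scanP (s.arr 3) (s.arr 4) e k (nbl e) y) ∧
      (∀ y, s'.arr 4 y = scanQ (s.arr 3) (s.arr 4) e k (nbl e) y) ∧
      Queue (s'.arr 6) (scanL (s.arr 3) (s.arr 4) e l (nbl e)) ∧
      s'.reg 10 = (scanL (s.arr 3) (s.arr 4) e l (nbl e)).length ∧
      Base n off nb s' ∧ t ≤ 14 * (nbl e).length + 5) := by
  have hn := hin.n_lt
  refine (ok_forNbr hin (e := e) (s := s) hB he hen.le (by decide)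
    (fun pre s' => (∀ y, s'.arr 3 y = scanP (s.arr 3) (s.arr 4) e k pre y) ∧
      (∀ y, s'.arr 4 y = scanQ (s.arr 3) (s.arr 4) e k pre y) ∧
      Queue (s'.arr 6) (scanL (s.arr 3) (s.arr 4) e l pre) ∧
      s'.reg 10 = (scanL (s.arr 3) (s.arr 4) e l pre).length) 10
    (by decide) (by decide) (by decide) ?_ ?_ ?_).mono ?_
  · rintro l s s' ⟨hr, ha⟩ h
    simpa [hr, ha] using h
  · exact ⟨by simp [scanP], by simp [scanQ], by simpa [scanL] using hq, by simpa [scanL] using hqt⟩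
  · rintro pre x suf s' hs hx hB' hfr h15 ⟨h1, h2, h3, h4⟩
    have hxpre : x ∉ pre := by
      have := hnd e
      rw [hs, List.nodup_append] at this
      intro h
      exact this.2.2 x h x (by simp) rfl
    have hlen : (scanL (s.arr 3) (s.arr 4) e l pre).length + 1 < W := by
      have e1 := hin.length_le hnd e
      have e2 : (nbl e).length = pre.length + suf.length + 1 := by simp [hs]; omega
      have e3 := List.length_filter_le
        (fun y => decide (¬ SharesP (s.arr 3) (s.arr 4) e y ∧ s.arr 3 y = 0)) pre
      simp only [scanL, List.length_append]
      omega
    have hPx : s'.arr 3 x = s.arr 3 x := by rw [h1, scanP, if_neg (fun h => hxpre h.1)]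
    have hQx : s'.arr 4 x = s.arr 4 x := by rw [h2, scanQ, if_neg (fun h => hxpre h.1)]
    have h23 : s'.reg 23 = s.arr 3 e := by rw [hfr.1 23 (by decide), hpe]
    have h6 : s'.reg 6 = k := by rw [hfr.1 6 (by decide), hk]
    have hPW := hP x hx
    have hQW := hQ x hx
    have stepP : ¬ (¬ SharesP (s.arr 3) (s.arr 4) e x ∧ s.arr 3 x = 0) →
        ∀ y, s'.arr 3 y = scanP (s.arr 3) (s.arr 4) e k (pre ++ [x]) y := by
      intro h y
      rw [h1, scanP, scanP]
      by_cases hyx : y = x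
      · subst hyx; rw [if_neg (by tauto), if_neg (by tauto)]
      · simp [hyx]
    have stepQ : ¬ (¬ SharesP (s.arr 3) (s.arr 4) e x ∧ s.arr 3 x ≠ 0 ∧ s.arr 4 x = 0) →
        ∀ y, s'.arr 4 y = scanQ (s.arr 3) (s.arr 4) e k (pre ++ [x]) y := by
      intro h y
      rw [h2, scanQ, scanQ]
      by_cases hyx : y = x
      · subst hyx; rw [if_neg (by tauto), if_neg (by tauto)]
      · simp [hyx]
    have stepL : ¬ (¬ SharesP (s.arr 3) (s.arr 4) e x ∧ s.arr 3 x = 0) →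
        scanL (s.arr 3) (s.arr 4) e l (pre ++ [x]) = scanL (s.arr 3) (s.arr 4) e l pre := by
      intro h
      simp only [scanL, List.filter_append, List.filter_singleton]
      rw [decide_eq_false h]
      simp
    have stepL' : (¬ SharesP (s.arr 3) (s.arr 4) e x ∧ s.arr 3 x = 0) →
        scanL (s.arr 3) (s.arr 4) e l (pre ++ [x]) = scanL (s.arr 3) (s.arr 4) e l pre ++ [x] := by
      intro h
      simp only [scanL, List.filter_append, List.filter_singleton]
      rw [decide_eq_true h]
      simp
    simp only [scanBody, ok_block_cons, ok_store, ok_add, ok_block_nil, ok_load, ok_ite_eq, ok_skip,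
        hB'.reg_one, hB'.reg_zero, h15, hPx, hQx, h4, h6, h23, reg_setReg, arr_setReg,
        reg_setArr, arr_setArr, if_true, if_false, Nat.reduceEqDiff, OfNat.one_ne_ofNat,
        OfNat.ofNat_ne_one]
    refine ⟨hPW, hQW, fun c1 => ⟨⟨stepP ?_, stepQ ?_, ?_, ?_⟩, by omega⟩, fun c1 =>
      ⟨fun c2 => ⟨⟨stepP ?_, stepQ ?_, ?_, ?_⟩, by omega⟩, fun c2 => ⟨fun c3 =>
      ⟨by omega, by omega, by omega, by omega, by omega, ⟨?_, stepQ ?_, ?_, ?_⟩, by omega⟩,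
      fun c3 => ⟨fun c4 => ⟨by omega, by omega, ⟨stepP ?_, ?_, ?_, ?_⟩, by omega⟩,
      fun c4 => ⟨⟨stepP ?_, stepQ ?_, ?_, ?_⟩, by omega⟩⟩⟩⟩⟩
    · exact fun h => h.1 (Or.inl c1)
    · exact fun h => h.1 (Or.inl c1)
    · rwa [stepL fun h => h.1 (Or.inl c1)]
    · rw [stepL fun h => h.1 (Or.inl c1)]
    · exact fun h => h.1 (Or.inr c2)
    · exact fun h => h.1 (Or.inr c2)
    · rwa [stepL fun h => h.1 (Or.inr c2)]
    · rw [stepL fun h => h.1 (Or.inr c2)]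
    · intro y
      rw [Function.update_apply, scanP]
      by_cases hyx : y = x
      · subst hyx; rw [if_pos rfl, if_pos ⟨by simp, fun h => h.elim c1 c2, c3⟩]
      · rw [if_neg hyx, h1, scanP]; simp [hyx]
    · exact fun h => h.2.1 c3
    · rw [stepL' ⟨fun h => h.elim c1 c2, c3⟩]
      exact h3.concat x
    · rw [stepL' ⟨fun h => h.elim c1 c2, c3⟩, List.length_append, List.length_singleton]
    · exact fun h => c3 h.2
    · intro y
      rw [Function.update_apply, scanQ]
      by_cases hyx : y = x
      · subst hyx; rw [if_pos rfl, if_pos ⟨by simp, fun h => h.elim c1 c2, c3, c4⟩]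
      · rw [if_neg hyx, h2, scanQ]; simp [hyx]
    · rwa [stepL fun h => c3 h.2]
    · rw [stepL fun h => c3 h.2]
    · exact fun h => c3 h.2
    · exact fun h => c4 h.2.2
    · rwa [stepL fun h => c3 h.2]
    · rw [stepL fun h => c3 h.2]
  · rintro t s' ⟨⟨h1, h2, h3, h4⟩, h5, h6, h7⟩
    exact ⟨h1, h2, h3, h4, h5, h7⟩

/-- Process the queue: a vertex without second label gets a new one, together with its neighbours
that do not have its first label. -/
def grow : Prog :=
  block [.const 11 0, .while (.lt 11 10) (block [.load 20 6 11, .add 11 11 2, .load 23 3 20,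
    .load 24 4 20, .ite (.eq 24 1) (block [.add 6 6 2, .store 4 20 6, forNbr 20 scanBody]) .skip])]

variable {U : Type*} {inc : ℕ → U → Prop} {C : Finset ℕ} {L₀ : ℕ} {P₀ Q₀ : ℕ → ℕ}

/-- The set `C` of unlabelled vertices is closed under adjacency. -/
structure Comp (n : ℕ) (nbl : ℕ → List ℕ) (C : Finset ℕ) (P₀ Q₀ : ℕ → ℕ) (L₀ : ℕ) : Prop where
  closed : ∀ e ∈ C, ∀ y ∈ nbl e, y ∈ C
  zero : ∀ y ∈ C, P₀ y = 0 ∧ Q₀ y = 0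
  lt : ∀ y ∈ C, y < n
  le : ∀ y, P₀ y ≤ L₀ ∧ Q₀ y ≤ L₀

theorem Comp.card_le (hc : Comp n nbl C P₀ Q₀ L₀) : C.card ≤ n := by
  simpa using Finset.card_le_card (fun y hy => Finset.mem_range.2 (hc.lt y hy) : C ⊆ Finset.range n)

theorem _root_.Lab.length_le {P Q : ℕ → ℕ} {l : List ℕ} {L : ℕ} (h : Lab C L₀ P₀ Q₀ P Q l L) :
    l.length ≤ C.card := by
  rw [← List.toFinset_card_of_nodup h.nodup]
  exact Finset.card_le_card fun y hy => h.sub y (List.mem_toFinset.1 hy)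

theorem _root_.Lab.le_max {P Q : ℕ → ℕ} {l : List ℕ} {L : ℕ} (h : Lab C L₀ P₀ Q₀ P Q l L)
    (hc : Comp n nbl C P₀ Q₀ L₀) (hL : L₀ ≤ L) (y : ℕ) : P y ≤ L ∧ Q y ≤ L := by
  by_cases hy : y ∈ l
  · have := h.p_mem y hy
    rcases h.q_mem y hy with h1 | h1 <;> omega
  · have := hc.le y
    rw [(h.out y hy).1, (h.out y hy).2]
    omega

/-- The proposition `Right` separates what always holds from what needs a correct first clique, so
one run of the loop yields both. A processed vertex uses at most one new label, which gives the
bound on register `6`. -/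
theorem ok_grow (hin : Input n W off nb nbl) (hd : LineData n nbl inc)
    (hc : Comp n nbl C P₀ Q₀ L₀) (hLW : L₀ + n + 2 < W) (Right : Prop)
    {s : Memory} {l₀ : List ℕ} (hB : Base n off nb s)
    (hlab : Lab C L₀ P₀ Q₀ (s.arr 3) (s.arr 4) l₀ (L₀ + 1))
    (hf : Right → Faithful inc C L₀ (s.arr 3) (s.arr 4) (L₀ + 1))
    (hq : Queue (s.arr 6) l₀) (hqt : s.reg 10 = l₀.length) (hL : s.reg 6 = L₀ + 1) :
    Ok W grow s (fun t s' => ∃ l, l₀ <+: l ∧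
      Lab C L₀ P₀ Q₀ (s'.arr 3) (s'.arr 4) l (s'.reg 6) ∧
      (Right → Faithful inc C L₀ (s'.arr 3) (s'.arr 4) (s'.reg 6)) ∧
      (∀ y ∈ l, s'.arr 4 y ≠ 0) ∧
      Queue (s'.arr 6) l ∧ s'.reg 10 = l.length ∧ L₀ ≤ s'.reg 6 ∧
      s'.reg 6 ≤ L₀ + 1 + C.card ∧
      Base n off nb s' ∧ t ≤ ∑ y ∈ C, (30 + 14 * (nbl y).length) + 10) := by
  have hn := hin.n_lt
  have hCn := hc.card_le
  simp only [grow, ok_block_cons, ok_const]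
  refine ⟨by omega, ?_⟩
  set s1 := s.setReg 11 0 with hs1
  have hfr1 : Frame [11] [] s s1 := Frame.setReg _ _ (by simp)
  refine (Ok.while (γ := List ℕ × ℕ) (fun g s' => l₀ <+: g.1 ∧ g.2 ≤ g.1.length ∧
      Lab C L₀ P₀ Q₀ (s'.arr 3) (s'.arr 4) g.1 (s'.reg 6) ∧
      (Right → Faithful inc C L₀ (s'.arr 3) (s'.arr 4) (s'.reg 6)) ∧
      (∀ y ∈ g.1.take g.2, s'.arr 4 y ≠ 0) ∧
      Queue (s'.arr 6) g.1 ∧ s'.reg 10 = g.1.length ∧ s'.reg 11 = g.2 ∧ L₀ ≤ s'.reg 6 ∧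
      s'.reg 6 ≤ L₀ + 1 + g.2 ∧ Base n off nb s')
    (fun g => ∑ y ∈ C \ (g.1.take g.2).toFinset, (30 + 14 * (nbl y).length)) ?_ (l₀, 0) s1 ?_).mono ?_
  · rintro ⟨l, i⟩ s2 ⟨h0, h1, h2, h3, h4, h5, h6, h7, h8, h9, hB2⟩ hb
    dsimp only at h0 h1 h2 h3 h4 h5 h6 h7 h8 h9
    rw [holds_lt, h6, h7] at hb
    have hlC := h2.length_le
    set e := l[i] with hedef
    have hel : e ∈ l := List.getElem_mem _
    have heC := h2.sub e hel
    have hen := hc.lt e heC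
    have hqi := h5 i hb
    rw [← hedef] at hqi
    have hmax := h2.le_max hc h8
    have hPe := hmax e
    have htake : l.take (i + 1) = l.take i ++ [e] := List.take_succ_eq_append_getElem hb
    -- The potential charges the vertices of `C` not yet taken from the queue. Extending the queue
    -- leaves the processed part alone, so a step removes exactly the term of `e`.
    have hΦ : ∀ m, l <+: m → ∀ t, t ≤ 29 + 14 * (nbl e).length →
        t + 1 + ∑ y ∈ C \ (m.take (i + 1)).toFinset, (30 + 14 * (nbl y).length) ≤
        ∑ y ∈ C \ (l.take i).toFinset, (30 + 14 * (nbl y).length) := by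
      rintro m ⟨r, rfl⟩ t ht
      have hins : C \ ((l ++ r).take (i + 1)).toFinset = (C \ (l.take i).toFinset).erase e := by
        rw [List.take_append_of_le_length (by omega), htake]
        ext y
        simp only [Finset.mem_sdiff, List.mem_toFinset, Finset.mem_erase, List.mem_append,
          List.mem_singleton]
        tauto
      have hnot : e ∈ C \ (l.take i).toFinset := by
        simp only [Finset.mem_sdiff, List.mem_toFinset, heC, true_and]
        intro hmem
        have := h2.nodup
        rw [← List.take_append_drop i l, List.nodup_append] at this
        refine this.2.2 e hmem e ?_ rfl
        rw [List.drop_eq_getElem_cons hb]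
        exact List.mem_cons_self
      rw [hins, ← Finset.add_sum_erase _ _ hnot]
      omega
    simp only [ok_block_cons, ok_store, ok_add, ok_block_nil, ok_load, ok_ite_eq, ok_skip,
        hB2.reg_one, hB2.reg_zero, h7, hqi, reg_setReg, arr_setReg,
        reg_setArr, arr_setArr, if_true, if_false, Nat.reduceEqDiff, OfNat.one_ne_ofNat,
        OfNat.ofNat_ne_one]
    refine ⟨by omega, by omega, by omega, by omega, fun c1 => ⟨by omega, by omega, by omega, ?_⟩,
      fun c1 => ?_⟩
    · set s3 := ((((((s2.setReg 20 e).setReg 11 (i + 1)).setReg 23 (s2.arr 3 e)).setReg 24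
        (s2.arr 4 e)).setReg 6 (s2.reg 6 + 1)).setArr 4 e (s2.reg 6 + 1)) with hs3
      have hfr3 : Frame [20, 11, 23, 24, 6] [4] s2 s3 :=
        ⟨fun r hr => by simp_all, fun a ha => by simp_all⟩
      have hB3 := hB2.of_frame hfr3 (by decide) (by decide)
      have ha3 : s3.arr 3 = s2.arr 3 := by simp [hs3]
      have ha4 : s3.arr 4 = Function.update (s2.arr 4) e (s2.reg 6 + 1) := by simp [hs3]
      refine ((ok_scan hin hd.nodup (e := e) (k := s2.reg 6 + 1) (l := l) hB3 (by simp [hs3]) hen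
        (by simp [hs3]) (by simp [hs3]) (by omega) ?_ ?_ (by simpa [hs3] using h5)
        (by simpa [hs3] using h6) (by omega)).frame).mono ?_
      · intro y _
        rw [ha3]
        have := hmax y
        omega
      · intro y _
        rw [ha4, Function.update_apply]
        have := hmax y
        split_ifs <;> omega
      · rintro t s4 ⟨⟨g1, g2, g3, g4, g5, g6⟩, hfr4⟩
        rw [ha3, ha4] at g1 g2 g3 g4
        have e6 : s4.reg 6 = s2.reg 6 + 1 := by rw [hfr4.1 6 (by decide)]; simp [hs3]
        have e11 : s4.reg 11 = i + 1 := by rw [hfr4.1 11 (by decide)]; simp [hs3]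
        have hP4 : s4.arr 3 = scanP (s2.arr 3) (Function.update (s2.arr 4) e (s2.reg 6 + 1)) e
          (s2.reg 6 + 1) (nbl e) := funext g1
        have hQ4 : s4.arr 4 = scanQ (s2.arr 3) (Function.update (s2.arr 4) e (s2.reg 6 + 1)) e
          (s2.reg 6 + 1) (nbl e) := funext g2
        have hpre : l <+: scanL (s2.arr 3) (Function.update (s2.arr 4) e (s2.reg 6 + 1)) e l (nbl e) :=
          List.prefix_append _ _
        have hmono : ∀ y, s2.arr 4 y ≠ 0 → s4.arr 4 y ≠ 0 := by
          intro y hy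
          rw [hQ4, scanQ]
          split_ifs with hh
          · omega
          · rw [Function.update_apply]; split_ifs <;> omega
        refine ⟨(scanL (s2.arr 3) (Function.update (s2.arr 4) e (s2.reg 6 + 1)) e l (nbl e), i + 1),
          ⟨h0.trans hpre, ?_, ?_, ?_, ?_, g3, g4, e11, by omega, by omega, g5⟩, ?_⟩
        · have := hpre.length_le
          dsimp only
          omega
        · rw [hP4, hQ4, e6]
          exact h2.scan hd hc.closed hc.zero h8 hel
        · intro hR
          rw [hP4, hQ4, e6]
          exact h2.faithful_scan hd hc.zero hc.lt hel c1 (h3 hR)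
        · intro y hy
          obtain ⟨r, hr⟩ := hpre
          dsimp only at hy
          rw [← hr, List.take_append_of_le_length (by omega), htake, List.mem_append,
            List.mem_singleton] at hy
          rcases hy with hy | rfl
          · exact hmono y (h4 y hy)
          · rw [hQ4, scanQ]
            split_ifs with hh
            · omega
            · rw [Function.update_self]; omega
        · exact hΦ _ hpre _ (by omega)
    · have hfr3 : Frame [20, 11, 23, 24] [] s2 ((((s2.setReg 20 e).setReg 11 (i + 1)).setReg 23
        (s2.arr 3 e)).setReg 24 (s2.arr 4 e)) := ⟨fun r hr => by simp_all, fun a ha => by simp⟩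
      refine ⟨(l, i + 1), ⟨h0, by dsimp only; omega, h2, h3, ?_, h5, h6, rfl, h8, by dsimp only; omega,
        hB2.of_frame hfr3 (by decide) (by decide)⟩, hΦ _ (List.prefix_refl _) _ (by omega)⟩
      intro y hy
      dsimp only at hy
      rw [htake, List.mem_append, List.mem_singleton] at hy
      rcases hy with hy | rfl
      · exact h4 y hy
      · exact c1
  · refine ⟨List.prefix_refl _, Nat.zero_le _, ?_, ?_, by simp, ?_, ?_, by simp [hs1], ?_, ?_, ?_⟩
    · simpa [hs1, hL] using hlab
    · simpa [hs1, hL] using hf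
    · simpa [hs1] using hq
    · simpa [hs1] using hqt
    · simp [hs1, hL]
    · simp [hs1, hL]
    · exact hB.of_frame hfr1 (by decide) (by decide)
  · rintro t s' ⟨⟨l, i⟩, ⟨h0, h1, h2, h3, h4, h5, h6, h7, h8, h9, hB2⟩, hb, ht⟩
    dsimp only at h0 h1 h2 h3 h4 h5 h6 h7 h8 h9 ht
    rw [holds_lt, h6, h7] at hb
    obtain rfl : i = l.length := by omega
    have := h2.length_le
    simp only [List.take_length, List.take_zero, List.toFinset_nil, Finset.sdiff_empty] at h4 ht
    simp only [ok_block_nil]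
    exact ⟨l, h0, h2, h3, h4, h5, h6, h8, by omega, hB2, by omega⟩

end Grow

end RAM

namespace RAM

/-! ### Testing the labelling of a component -/

section Check

variable {n W : ℕ} {off nb : ℕ → ℕ} {nbl : ℕ → List ℕ}

/-- Count in array `7` how often every label occurs in the queue. -/
def count : Prog :=
  block [.const 21 0, forArr 6 21 10 20 (block [.load 23 3 20, .load 17 7 23, .add 17 17 2,
    .store 7 23 17, .load 24 4 20, .load 17 7 24, .add 17 17 2, .store 7 24 17])]

/-- Put into register `12` whether the labelling of the vertices in the queue passes the test. -/
def check : Prog :=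
  block [.const 12 1, .const 21 0, forArr 6 21 10 20 (block [.load 23 3 20, .load 24 4 20,
    .load 17 7 23, .load 18 7 24, .add 17 17 18, .load 18 0 20, .add 19 20 2, .load 19 0 19,
    .sub 19 19 18, .add 19 19 3, .ite (.eq 17 19) .skip (.const 12 0),
    forNbr 20 (block [.load 17 3 15, .load 18 4 15,
      .ite (.eq 17 23) .skip (.ite (.eq 18 23) .skip (.ite (.eq 17 24) .skip
        (.ite (.eq 18 24) .skip (.const 12 0))))])])]

/-- Remove the labels of the vertices in the queue if register `12` holds `0`. -/
def reset : Prog :=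
  .ite (.eq 12 1) (block [.const 21 0, forArr 6 21 10 20 (block [.store 3 20 1, .store 4 20 1])])
    .skip

theorem wt_le (P Q : ℕ → ℕ) (k y : ℕ) : wt P Q k y ≤ 2 := by
  unfold wt; split_ifs <;> omega

theorem sum_wt_le (P Q : ℕ → ℕ) (k : ℕ) (l : List ℕ) : (l.map (wt P Q k)).sum ≤ 2 * l.length := by
  induction l with
  | nil => simp
  | cons a l ih =>
    have := wt_le P Q k a
    simp only [List.map_cons, List.sum_cons, List.length_cons]
    omega

theorem ok_count (hin : Input n W off nb nbl) {s : Memory} {l : List ℕ} (hB : Base n off nb s)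
    (hq : Queue (s.arr 6) l) (hqt : s.reg 10 = l.length) (hl : l.length ≤ n)
    (hlt : ∀ y ∈ l, y < n) (hP : ∀ y ∈ l, s.arr 3 y < W ∧ s.arr 4 y < W)
    (h0 : ∀ y ∈ l, s.arr 7 (s.arr 3 y) = 0 ∧ s.arr 7 (s.arr 4 y) = 0) :
    Ok W count s (fun t s' =>
      (∀ k, s'.arr 7 k = s.arr 7 k + (l.map (wt (s.arr 3) (s.arr 4) k)).sum) ∧
      t ≤ 13 * l.length + 3) := by
  have hn := hin.n_lt
  simp only [count, ok_block_cons, ok_const]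
  refine ⟨by omega, ?_⟩
  set s1 := s.setReg 21 0 with hs1
  have hfr1 : Frame [21] [] s s1 := Frame.setReg _ _ (by simp)
  have hB1 := hB.of_frame hfr1 (by decide) (by decide)
  refine (ok_forArr l (fun pre s' => ∀ k, s'.arr 7 k = s.arr 7 k +
      (pre.map (wt (s.arr 3) (s.arr 4) k)).sum) (fun _ => 9) hB1.reg_one (by simp [hs1, hqt])
    (by simpa [hs1, Queue] using hq) (by simp [hs1]; omega) (fun x hx => by have := hlt x hx; omega)
    (by decide) ?_ (by simp [hs1]) ?_).mono ?_
  · rintro l s s' ⟨hr, ha⟩ h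
    simpa [hr, ha] using h
  · intro pre x suf s' hs hfr h20 h1
    have hx : x ∈ l := by simp [hs]
    have e3 : s'.arr 3 = s.arr 3 := by rw [hfr.2 3 (by decide)]; simp [hs1]
    have e4 : s'.arr 4 = s.arr 4 := by rw [hfr.2 4 (by decide)]; simp [hs1]
    have e2 : s'.reg 2 = 1 := by rw [hfr.1 2 (by decide), hB1.reg_one]
    obtain ⟨hPx, hQx⟩ := hP x hx
    obtain ⟨c1, c2⟩ := h0 x hx
    have b1 := sum_wt_le (s.arr 3) (s.arr 4) (s.arr 3 x) pre
    have b2 := sum_wt_le (s.arr 3) (s.arr 4) (s.arr 4 x) pre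
    have b3 : l.length = pre.length + suf.length + 1 := by simp [hs]; omega
    have f1 := h1 (s.arr 3 x)
    have f2 := h1 (s.arr 4 x)
    -- The two labels are not assumed distinct here, so the second read may see the first increment.
    have f3 : Function.update (s'.arr 7) (s.arr 3 x) (s'.arr 7 (s.arr 3 x) + 1) (s.arr 4 x) + 1 <
        W := by
      rw [Function.update_apply]; split_ifs <;> omega
    simp only [ok_block_cons, ok_store, ok_add, ok_block_nil, ok_load, ok_skip,
        h20, e2, e3, e4, reg_setReg, arr_setReg,
        reg_setArr, arr_setArr, if_true, if_false, Nat.reduceEqDiff, OfNat.one_ne_ofNat,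
        OfNat.ofNat_ne_one]
    refine ⟨by omega, by omega, by omega, by omega, by omega, by omega, by omega, by omega,
      by omega, by omega, ?_, by omega⟩
    intro k
    rw [List.map_append, List.sum_append, List.map_singleton, List.sum_singleton, ← Nat.add_assoc,
      ← h1 k, wt]
    simp only [Function.update_apply]
    clear hs h1
    split_ifs <;> grind
  · rintro t s' ⟨h1, h2, h3⟩
    simp only [ok_block_nil]
    simp only [List.map_const', List.sum_replicate, smul_eq_mul] at h3
    exact ⟨h1, by omega⟩

/-- Degrees are differences of consecutive offsets. Only the counters of labels that occur in the
queue have to be correct, which is what `h7` provides. -/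
theorem ok_check (hin : Input n W off nb nbl) (hnd : ∀ v, (nbl v).Nodup) {s : Memory} {l : List ℕ} (hB : Base n off nb s)
    (hq : Queue (s.arr 6) l) (hqt : s.reg 10 = l.length) (hl : l.length ≤ n)
    (hlt : ∀ y ∈ l, y < n) (hP : ∀ y < n, s.arr 3 y < W ∧ s.arr 4 y < W)
    (h7 : ∀ y ∈ l, s.arr 7 (s.arr 3 y) = (l.map (wt (s.arr 3) (s.arr 4) (s.arr 3 y))).sum ∧
      s.arr 7 (s.arr 4 y) = (l.map (wt (s.arr 3) (s.arr 4) (s.arr 4 y))).sum) :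
    Ok W check s (fun t s' => s'.reg 12 ≤ 1 ∧
      (s'.reg 12 = 1 ↔ ∀ y ∈ l, Passes nbl (s.arr 3) (s.arr 4) l y) ∧
      t ≤ (l.map (fun y => 25 + 12 * (nbl y).length)).sum + 4) := by
  have hn := hin.n_lt
  simp only [check, ok_block_cons, ok_const]
  refine ⟨by omega, by omega, ?_⟩
  set s1 := (s.setReg 12 1).setReg 21 0 with hs1
  have hfr1 : Frame [21, 12] [] s s1 :=
    (Frame.setReg _ _ (by simp)).trans (Frame.setReg _ _ (by simp))
  have hB1 := hB.of_frame hfr1 (by decide) (by decide)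
  refine (ok_forArr l (fun pre s' => s'.reg 12 ≤ 1 ∧
      (s'.reg 12 = 1 ↔ ∀ y ∈ pre, Passes nbl (s.arr 3) (s.arr 4) l y))
    (fun y => 21 + 12 * (nbl y).length) hB1.reg_one (by simp [hs1, hqt])
    (by simpa [hs1, Queue] using hq) (by simp [hs1]; omega) (fun x hx => by have := hlt x hx; omega)
    (by decide) ?_ (by simp [hs1]) ?_).mono ?_
  · rintro l s s' ⟨hr, ha⟩ h
    simpa [hr, ha] using h
  · intro pre x suf s' hs hfr h20 ⟨h1, h2⟩
    have hx : x ∈ l := by simp [hs]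
    have hxn := hlt x hx
    have hB' := hB1.of_frame hfr (by decide) (by decide)
    have e3 : s'.arr 3 = s.arr 3 := by rw [hfr.2 3 (by decide)]; simp [hs1]
    have e4 : s'.arr 4 = s.arr 4 := by rw [hfr.2 4 (by decide)]; simp [hs1]
    have e7 : s'.arr 7 = s.arr 7 := by rw [hfr.2 7 (by decide)]; simp [hs1]
    obtain ⟨hPx, hQx⟩ := hP x hxn
    obtain ⟨c1, c2⟩ := h7 x hx
    have b1 := sum_wt_le (s.arr 3) (s.arr 4) (s.arr 3 x) l
    have b2 := sum_wt_le (s.arr 3) (s.arr 4) (s.arr 4 x) l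
    have o1 := hin.off_lt x
    have o2 := hin.off_succ x hxn
    set A : Prop := (l.map (wt (s.arr 3) (s.arr 4) (s.arr 3 x))).sum +
      (l.map (wt (s.arr 3) (s.arr 4) (s.arr 4 x))).sum = (nbl x).length + 2 with hA
    rw [ok_block_cons]
    simp only [ok_load, h20, e3]
    refine ⟨hPx, ?_⟩
    -- The scan of the neighbours runs in the same way for either outcome `A` of the counting test;
    -- register `12` only remembers that outcome.
    have key : ∀ s2, Frame [12, 17, 18, 19, 23, 24] [] s' s2 → s2.reg 23 = s.arr 3 x →
        s2.reg 24 = s.arr 4 x → s2.reg 12 ≤ 1 →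
        (s2.reg 12 = 1 ↔ (∀ y ∈ pre, Passes nbl (s.arr 3) (s.arr 4) l y) ∧ A) →
        Ok W (forNbr 20 (block [.load 17 3 15, .load 18 4 15,
          .ite (.eq 17 23) .skip (.ite (.eq 18 23) .skip (.ite (.eq 17 24) .skip
          (.ite (.eq 18 24) .skip (.const 12 0))))])) s2
        (fun t s3 => (s3.reg 12 ≤ 1 ∧
          (s3.reg 12 = 1 ↔ ∀ y ∈ pre ++ [x], Passes nbl (s.arr 3) (s.arr 4) l y)) ∧
          t ≤ 12 * (nbl x).length + 5) := by
      intro s2 hfr2 g23 g24 g1 g2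
      have hB2 := hB'.of_frame hfr2 (by decide) (by decide)
      have a3 : s2.arr 3 = s.arr 3 := by rw [hfr2.2 3 (by decide), e3]
      have a4 : s2.arr 4 = s.arr 4 := by rw [hfr2.2 4 (by decide), e4]
      refine (ok_forNbr hin hB2 (e := x) (by rw [hfr2.1 20 (by decide), h20]) hxn.le (by decide)
        (fun m s3 => s3.reg 12 ≤ 1 ∧ (s3.reg 12 = 1 ↔
          ((∀ y ∈ pre, Passes nbl (s.arr 3) (s.arr 4) l y) ∧ A) ∧
          ∀ y ∈ m, s.arr 3 y = s.arr 3 x ∨ s.arr 4 y = s.arr 3 x ∨ s.arr 3 y = s.arr 4 x ∨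
            s.arr 4 y = s.arr 4 x)) 8 (by decide) (by decide) (by decide) ?_ ?_ ?_).mono ?_
      · rintro l s s' ⟨hr, ha⟩ h
        simpa [hr, ha] using h
      · simpa using ⟨g1, g2⟩
      · intro m y suf s3 _ hyn hB3 hfr3 h15 ⟨k1, k2⟩
        obtain ⟨hPy, hQy⟩ := hP y hyn
        have f3 : s3.arr 3 = s.arr 3 := by rw [hfr3.2 3 (by decide), a3]
        have f4 : s3.arr 4 = s.arr 4 := by rw [hfr3.2 4 (by decide), a4]
        have f23 : s3.reg 23 = s.arr 3 x := by rw [hfr3.1 23 (by decide), g23]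
        have f24 : s3.reg 24 = s.arr 4 x := by rw [hfr3.1 24 (by decide), g24]
        simp only [ok_block_cons, ok_block_nil, ok_load, ok_skip, ok_ite_eq, ok_const,
          h15, f3, f4, f23, f24, reg_setReg, arr_setReg, if_true, if_false, Nat.reduceEqDiff]
        have hmy : ∀ S : ℕ → Prop, (∀ z ∈ m ++ [y], S z) ↔ (∀ z ∈ m, S z) ∧ S y := by
          intro S
          simp [or_imp, forall_and]
        rw [hmy]
        refine ⟨hPy, hQy, fun d => ⟨⟨k1, ?_⟩, by omega⟩, fun d1 => ⟨fun d => ⟨⟨k1, ?_⟩, by omega⟩,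
          fun d2 => ⟨fun d => ⟨⟨k1, ?_⟩, by omega⟩, fun d3 => ⟨fun d => ⟨⟨k1, ?_⟩, by omega⟩,
          fun d4 => ⟨by omega, ⟨by omega, ?_⟩, by omega⟩⟩⟩⟩⟩
        · rw [k2]; exact ⟨fun h => ⟨h.1, h.2, Or.inl d⟩, fun h => ⟨h.1, h.2.1⟩⟩
        · rw [k2]; exact ⟨fun h => ⟨h.1, h.2, Or.inr (Or.inl d)⟩, fun h => ⟨h.1, h.2.1⟩⟩
        · rw [k2]; exact ⟨fun h => ⟨h.1, h.2, Or.inr (Or.inr (Or.inl d))⟩, fun h => ⟨h.1, h.2.1⟩⟩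
        · rw [k2]; exact ⟨fun h => ⟨h.1, h.2, Or.inr (Or.inr (Or.inr d))⟩, fun h => ⟨h.1, h.2.1⟩⟩
        · simp only [zero_ne_one, false_iff]
          rintro ⟨-, -, h | h | h | h⟩
          exacts [d1 h, d2 h, d3 h, d4 h]
      · rintro t s3 ⟨⟨k1, k2⟩, _, _, k3⟩
        refine ⟨⟨k1, ?_⟩, k3⟩
        rw [k2]
        simp only [List.mem_append, List.mem_singleton, or_imp, forall_and, forall_eq, Passes, hA]
        tauto
    simp only [ok_block_cons, ok_store, ok_add, ok_block_nil, ok_load, ok_skip, ok_sub, ok_ite_eq,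
        ok_const,
        h20, hB'.reg_one, hB'.reg_two, hB'.arr_off, e3, e4, e7, c1, c2, o2, Nat.add_sub_cancel_left,
        reg_setReg, arr_setReg,
        reg_setArr, arr_setArr, if_true, if_false, Nat.reduceEqDiff, OfNat.one_ne_ofNat,
        OfNat.ofNat_ne_one]
    have o3 : (nbl x).length + 2 < W := by
      have := hin.length_le hnd x
      omega
    refine ⟨by omega, by omega, by omega, by omega, by omega, by omega, by omega, by omega,
      o3, fun d => ?_, fun d => ⟨by omega, ?_⟩⟩
    · refine (key _ ⟨fun r hr => by simp_all, fun a _ => by simp⟩ (by simp) (by simp)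
        (by simpa using h1) ?_).mono ?_
      · simp only [reg_setReg, if_false, Nat.reduceEqDiff]
        rw [h2]
        tauto
      · rintro t s3 ⟨k1, k2⟩
        exact ⟨k1, by omega⟩
    · refine (key _ ⟨fun r hr => by simp_all, fun a _ => by simp⟩ (by simp) (by simp)
        (by simp) ?_).mono ?_
      · simp only [reg_setReg, if_true, if_false, Nat.reduceEqDiff, zero_ne_one, false_iff]
        tauto
      · rintro t s3 ⟨k1, k2⟩
        exact ⟨k1, by omega⟩
  · rintro t s' ⟨⟨h1, h2⟩, _, h3⟩
    simp only [ok_block_nil]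
    refine ⟨h1, h2, ?_⟩
    have : (fun y => 21 + 12 * (nbl y).length + 4) = (fun y => 25 + 12 * (nbl y).length) := by
      funext y; omega
    rw [this] at h3
    omega

theorem ok_reset (hin : Input n W off nb nbl) {s : Memory} {l : List ℕ} (hB : Base n off nb s)
    (hq : Queue (s.arr 6) l) (hqt : s.reg 10 = l.length) (hl : l.length ≤ n)
    (hlt : ∀ y ∈ l, y < n) :
    Ok W reset s (fun t s' =>
      (∀ y, s'.arr 3 y = if s.reg 12 = 0 ∧ y ∈ l then 0 else s.arr 3 y) ∧
      (∀ y, s'.arr 4 y = if s.reg 12 = 0 ∧ y ∈ l then 0 else s.arr 4 y) ∧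
      t ≤ 7 * l.length + 4) := by
  have hn := hin.n_lt
  simp only [reset, ok_ite_eq, hB.reg_zero, ok_block_cons, ok_const, ok_skip]
  refine ⟨fun h12 => ⟨by omega, ?_⟩, fun h12 => ?_⟩
  · set s1 := s.setReg 21 0 with hs1
    have hfr1 : Frame [21] [] s s1 := Frame.setReg _ _ (by simp)
    have hB1 := hB.of_frame hfr1 (by decide) (by decide)
    refine (ok_forArr l (fun pre s' => (∀ y, s'.arr 3 y = if y ∈ pre then 0 else s.arr 3 y) ∧
        (∀ y, s'.arr 4 y = if y ∈ pre then 0 else s.arr 4 y)) (fun _ => 3) hB1.reg_one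
      (by simp [hs1, hqt])
      (by simpa [hs1, Queue] using hq) (by simp [hs1]; omega) (fun x hx => by have := hlt x hx; omega)
      (by decide) ?_ (by simp [hs1]) ?_).mono ?_
    · rintro l s s' ⟨hr, ha⟩ h
      simpa [hr, ha] using h
    · intro pre x suf s' hs hfr h20 ⟨h1, h2⟩
      have hx : x ∈ l := by simp [hs]
      have hxn := hlt x hx
      have hB' := hB1.of_frame hfr (by decide) (by decide)
      simp only [ok_block_cons, ok_store, ok_block_nil, h20, hB'.reg_zero, reg_setArr, arr_setArr,
        if_true, if_false, Nat.reduceEqDiff]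
      refine ⟨by omega, by omega, by omega, by omega, ⟨fun y => ?_, fun y => ?_⟩, by omega⟩
      · by_cases hyx : y = x
        · simp [hyx]
        · simp [hyx, h1 y]
      · by_cases hyx : y = x
        · simp [hyx]
        · simp [hyx, h2 y]
    · rintro t s' ⟨⟨h1, h2⟩, _, h3⟩
      simp only [ok_block_nil]
      simp only [List.map_const', List.sum_replicate, smul_eq_mul] at h3
      refine ⟨?_, ?_, by omega⟩
      · simpa [h12] using h1
      · simpa [h12] using h2
  · exact ⟨by simp [h12], by simp [h12], by omega⟩

end Check

end RAM

namespace RAM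

/-! ### Labelling all vertices -/

section Phase

variable {n W : ℕ} {off nb : ℕ → ℕ} {nbl : ℕ → List ℕ} {U : Type*} {inc : ℕ → U → Prop}

/-- The labelled vertices form a union of components, which are labelled correctly by numbers up
to `L`. -/
structure Solved (n : ℕ) (nbl : ℕ → List ℕ) (P Q : ℕ → ℕ) (L : ℕ) : Prop where
  le : ∀ y, P y ≤ L ∧ Q y ≤ L
  q_zero : ∀ y, P y = 0 → Q y = 0
  closed : ∀ e, P e ≠ 0 → ∀ y ∈ nbl e, P y ≠ 0
  lt : ∀ e, P e ≠ 0 → e < n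
  good : ∀ e, P e ≠ 0 → Q e ≠ 0 ∧ P e ≠ Q e ∧
    ∀ y, y ≠ e → coin P Q e y = if y ∈ nbl e then 1 else 0

/-- `C` consists of the vertices reachable from `e`. Adjacency is symmetric and the labelled
vertices are closed under it, so no labelled vertex is reachable. The minimality of `C` will show
that an accepted labelling covers all of it. -/
theorem Solved.exists_comp {P Q : ℕ → ℕ} {L : ℕ} (h : Solved n nbl P Q L)
    (hd : LineData n nbl inc) {e : ℕ} (hen : e < n) (he : P e = 0) :
    ∃ C, Comp n nbl C P Q L ∧ e ∈ C ∧
      ∀ X : Set ℕ, e ∈ X → (∀ a ∈ X, ∀ b ∈ nbl a, b ∈ X) → ∀ y ∈ C, y ∈ X := by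
  classical
  have hz : ∀ y, Relation.ReflTransGen (fun a b => b ∈ nbl a) e y → P y = 0 := by
    intro y hy
    induction hy with
    | refl => exact he
    | tail _ hb ih =>
      by_contra hc
      exact h.closed _ hc _ (hd.symm hb) ih
  refine ⟨(Finset.range n).filter (Relation.ReflTransGen (fun a b => b ∈ nbl a) e), ⟨?_, ?_, ?_, h.le⟩,
    ?_, ?_⟩
  · intro a ha b hb
    rw [Finset.mem_filter] at ha ⊢
    exact ⟨Finset.mem_range.2 ((hd.mem_iff a b).1 hb).2.1, ha.2.tail hb⟩
  · intro y hy
    have := hz y (Finset.mem_filter.1 hy).2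
    exact ⟨this, h.q_zero y this⟩
  · intro y hy
    exact Finset.mem_range.1 (Finset.mem_filter.1 hy).1
  · exact Finset.mem_filter.2 ⟨Finset.mem_range.2 hen, .refl⟩
  · intro X heX hX y hy
    have := (Finset.mem_filter.1 hy).2
    induction this with
    | refl => exact heX
    | tail h1 hb ih =>
      refine hX _ (ih (Finset.mem_filter.2 ⟨Finset.mem_range.2 ?_, h1⟩)) _ hb
      exact ((hd.mem_iff _ _).1 hb).1

/-- Try to label the component of the vertex in register `5`, starting from the `k`-th candidate
for a first clique. -/
def attempt (k : ℕ) : Prog := block [seed k, grow, count, check, reset]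

/-- The `k`-th candidate for a first clique at `e` is correct. -/
def RightSeed (n : ℕ) (nbl : ℕ → List ℕ) (inc : ℕ → U → Prop) (e k : ℕ) : Prop :=
  ∃ u, ∀ y < n, (y ∈ seedList n nbl k e ↔ inc y u)

/-- The two halves of the test meet here. Acceptance yields correct coincidences even for a wrong
first clique; rejection proves the clique wrong, as a right one gives faithful labels, and these
pass. -/
theorem ok_attempt (hin : Input n W off nb nbl) (hd : LineData n nbl inc) {s : Memory}
    {e L k : ℕ} {C : Finset ℕ} (hB : Base n off nb s) (he : s.reg 5 = e) (hk : k < 3)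
    (hsol : Solved n nbl (s.arr 3) (s.arr 4) L) (hL : s.reg 6 = L) (hLW : L + n + 2 < W)
    (hc : Comp n nbl C (s.arr 3) (s.arr 4) L) (heC : e ∈ C)
    (hmin : ∀ X : Set ℕ, e ∈ X → (∀ a ∈ X, ∀ b ∈ nbl a, b ∈ X) → ∀ y ∈ C, y ∈ X)
    (hS : ∀ y < n, s.arr 5 y = 0) (hcnt : ∀ k, L < k → s.arr 7 k = 0) :
    Ok W (attempt k) s (fun t s' =>
      Solved n nbl (s'.arr 3) (s'.arr 4) (s'.reg 6) ∧ L ≤ s'.reg 6 ∧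
      s'.reg 6 ≤ L + 1 + C.card ∧ (∀ y < n, s'.arr 5 y = 0) ∧
      (∀ k, s'.reg 6 < k → s'.arr 7 k = 0) ∧ Base n off nb s' ∧
      ((s'.arr 3 = s.arr 3 ∧ s'.arr 4 = s.arr 4 ∧ ¬ RightSeed n nbl inc e k) ∨
        ∀ y, s'.arr 3 y ≠ 0 ↔ s.arr 3 y ≠ 0 ∨ y ∈ C) ∧
      t ≤ 140 * C.card + 70 * ∑ y ∈ C, (nbl y).length) := by
  have hn := hin.n_lt
  have hCn := hc.card_le
  have hen := hc.lt e heC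
  have hee : e ∉ nbl e := by rw [hd.mem_iff]; tauto
  have hCpos : 1 ≤ C.card := Finset.card_pos.2 ⟨e, heC⟩
  set D := ∑ y ∈ C, (nbl y).length with hD
  have hDle : ∀ y, y ∈ C ∨ y = n → (nbl y).length ≤ D := by
    rintro y (hy | rfl)
    · exact Finset.single_le_sum (f := fun y => (nbl y).length) (fun _ _ => Nat.zero_le _) hy
    · rw [hin.nbl_out _ le_rfl]; simp
  have hsum : ∀ a b, ∑ y ∈ C, (a + b * (nbl y).length) = a * C.card + b * D := by
    intro a b
    rw [Finset.sum_add_distrib, ← Finset.mul_sum, Finset.sum_const, smul_eq_mul, mul_comm]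
  have hseedC : ∀ y ∈ seedList n nbl k e, y ∈ C := by
    intro y hy
    rcases mem_seedList.1 hy with rfl | h
    · exact heC
    · exact hc.closed e heC y h.1
  simp only [attempt, ok_block_cons]
  refine (ok_seed hin hd.nodup (k := k) hB he hen hk hL (by omega) hS).mono ?_
  rintro t1 s1 ⟨p1, p2, p3, p4, p5, hB1, hf1, ht1⟩
  have hQ1 : s1.arr 4 = s.arr 4 := hf1.2 4 (by decide)
  have hlab : Lab C L (s.arr 3) (s.arr 4) (s1.arr 3) (s1.arr 4) (seedList n nbl k e) (L + 1) := by
    refine ⟨?_, hseedC, ?_, ?_, ?_⟩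
    · rw [seedList, List.nodup_cons]
      exact ⟨fun h => hee (List.mem_filter.1 h).1, (hd.nodup e).filter _⟩
    · intro y hy
      rw [p1, if_neg hy, hQ1]
      exact ⟨rfl, rfl⟩
    · intro y hy
      rw [p1, if_pos hy]
      omega
    · intro y hy
      left
      rw [hQ1]
      exact (hc.zero y (hseedC y hy)).2
  -- After seeding only the label `L + 1` is in use, and it stands for the common end `u` of the
  -- clique.
  have hfaith : RightSeed n nbl inc e k → Faithful inc C L (s1.arr 3) (s1.arr 4) (L + 1) := by
    rintro ⟨u, hu⟩
    refine ⟨fun _ => u, ?_, by omega⟩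
    intro j hj1 hj2 y hy
    obtain rfl : j = L + 1 := by omega
    have hz := hc.zero y hy
    rw [← hu y (hc.lt y hy), p1, hQ1, hz.1, hz.2]
    split_ifs with h <;> simp [h]
  refine (ok_grow hin hd hc (by omega) (RightSeed n nbl inc e k) hB1 hlab hfaith p2 p3 p4).frame.mono ?_
  rintro t2 s2 ⟨⟨l, hpre, hlab2, hfaith2, hQ2, q1, q2, q3, q4, hB2, ht2⟩, hf2⟩
  rw [hsum] at ht2
  have hll := hlab2.length_le
  have hlC := hlab2.sub
  have hmax := hlab2.le_max hc q3
  have hln : ∀ y ∈ l, y < n := fun y hy => hc.lt y (hlC y hy)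
  have hcnt2 : ∀ k, L < k → s2.arr 7 k = 0 := by
    intro k hk
    rw [hf2.2 7 (by decide), hf1.2 7 (by decide)]
    exact hcnt k hk
  have hlabs : ∀ y ∈ l, L < s2.arr 3 y ∧ L < s2.arr 4 y := fun y hy =>
    ⟨(hlab2.p_mem y hy).1, ((hlab2.q_mem y hy).resolve_left (hQ2 y hy)).1⟩
  refine (ok_count hin hB2 q1 q2 (by omega) hln ?_ ?_).frame.mono ?_
  · intro y hy
    have := hmax y
    omega
  · intro y hy
    have := hlabs y hy
    exact ⟨hcnt2 _ this.1, hcnt2 _ this.2⟩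
  rintro t3 s3 ⟨⟨r1, ht3⟩, hf3⟩
  have hB3 := hB2.of_frame hf3 (by decide) (by decide)
  have a33 : s3.arr 3 = s2.arr 3 := hf3.2 3 (by decide)
  have a34 : s3.arr 4 = s2.arr 4 := hf3.2 4 (by decide)
  refine (ok_check hin hd.nodup (l := l) hB3 (by rw [hf3.2 6 (by decide)]; exact q1)
    (by rw [hf3.1 10 (by decide)]; exact q2) (by omega) hln ?_ ?_).frame.mono ?_
  · intro y _
    have := hmax y
    rw [a33, a34]
    omega
  · intro y hy
    have := hlabs y hy
    rw [a33, a34, r1, r1, hcnt2 _ this.1, hcnt2 _ this.2, zero_add, zero_add]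
    exact ⟨rfl, rfl⟩
  rintro t4 s4 ⟨⟨u1, u2, ht4⟩, hf4⟩
  rw [a33, a34] at u2
  have ht4' : t4 ≤ 25 * C.card + 12 * D + 4 := by
    rw [← List.sum_toFinset _ hlab2.nodup] at ht4
    have : ∑ y ∈ l.toFinset, (25 + 12 * (nbl y).length) ≤ ∑ y ∈ C, (25 + 12 * (nbl y).length) :=
      Finset.sum_le_sum_of_subset (fun y hy => hlC y (List.mem_toFinset.1 hy))
    rw [hsum] at this
    omega
  have hB4 := hB3.of_frame hf4 (by decide) (by decide)
  refine (ok_reset hin (l := l) hB4 (by rw [hf4.2 6 (by decide), hf3.2 6 (by decide)]; exact q1)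
    (by rw [hf4.1 10 (by decide), hf3.1 10 (by decide)]; exact q2) (by omega) hln).frame.mono ?_
  rintro t5 s5 ⟨⟨v1, v2, ht5⟩, hf5⟩
  rw [hf4.2 3 (by decide), a33] at v1
  rw [hf4.2 4 (by decide), a34] at v2
  have e6 : s5.reg 6 = s2.reg 6 := by
    rw [hf5.1 6 (by decide), hf4.1 6 (by decide), hf3.1 6 (by decide)]
  have e7 : s5.arr 7 = s3.arr 7 := by
    rw [hf5.2 7 (by decide), hf4.2 7 (by decide)]
  have e5 : s5.arr 5 = s1.arr 5 := by
    rw [hf5.2 5 (by decide), hf4.2 5 (by decide), hf3.2 5 (by decide), hf2.2 5 (by decide)]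
  have hB5 := hB4.of_frame hf5 (by decide) (by decide)
  simp only [ok_block_nil]
  have htime : t1 + (t2 + (t3 + (t4 + (t5 + 1)))) ≤ 140 * C.card + 70 * D := by
    have h1 := hDle e (Or.inl heC)
    have h2 := hDle (seedF n nbl e) (by
      rcases seedF_mem (n := n) (nbl := nbl) e with h | h
      · exact Or.inl (hc.closed e heC _ h)
      · exact Or.inr h)
    have h3 := hDle (seedX n nbl k e) (by
      rcases seedX_mem (n := n) (nbl := nbl) k e with h | h
      · exact Or.inl (hc.closed e heC _ h.1)
      · exact Or.inr h)
    omega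
  -- The counters need not be cleared: later attempts use only labels above register `6`, whose
  -- counters are still `0`.
  have hcntEnd : ∀ k, s5.reg 6 < k → s5.arr 7 k = 0 := by
    intro j hj
    rw [e6] at hj
    rw [e7, r1, hcnt2 j (by omega), zero_add]
    refine List.sum_eq_zero fun x hx => ?_
    obtain ⟨y, _, rfl⟩ := List.mem_map.1 hx
    have := hmax y
    unfold wt
    rw [if_neg (by omega), if_neg (by omega), Nat.add_zero]
  rcases Nat.eq_zero_or_pos (s4.reg 12) with h12 | h12
  · -- the test failed
    have hP : s5.arr 3 = s.arr 3 := by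
      funext y
      rw [v1 y]
      by_cases hy : y ∈ l
      · rw [if_pos ⟨h12, hy⟩, (hc.zero y (hlC y hy)).1]
      · rw [if_neg (fun h => hy h.2), (hlab2.out y hy).1]
    have hQ : s5.arr 4 = s.arr 4 := by
      funext y
      rw [v2 y]
      by_cases hy : y ∈ l
      · rw [if_pos ⟨h12, hy⟩, (hc.zero y (hlC y hy)).2]
      · rw [if_neg (fun h => hy h.2), (hlab2.out y hy).2]
    refine ⟨?_, by omega, by omega, by rwa [e5], hcntEnd, hB5, Or.inl ⟨hP, hQ, ?_⟩, htime⟩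
    · rw [hP, hQ, e6]
      exact ⟨fun y => by have := hsol.le y; omega, hsol.q_zero, hsol.closed, hsol.lt, hsol.good⟩
    · intro hR
      have := u2.2 fun y hy => hlab2.passes_of_faithful hd hc.closed hc.zero hc.lt (hfaith2 hR) hQ2 hy
      omega
  · have hpass := u2.1 (by omega)
    have hP : s5.arr 3 = s2.arr 3 := by
      funext y; rw [v1 y, if_neg (by omega)]
    have hQ : s5.arr 4 = s2.arr 4 := by
      funext y; rw [v2 y, if_neg (by omega)]
    have hcoin := fun y hy => hlab2.coin_of_passes hd hc.closed hc.zero hc.le hQ2 hy (hpass y hy)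
    -- An accepted list contains `e` and is closed under adjacency, so by minimality it contains the
    -- whole component.
    have hCl : ∀ y ∈ C, y ∈ l := hmin {y | y ∈ l}
      (hpre.subset (mem_seedList.2 (Or.inl rfl))) (fun a ha b hb => (hcoin a ha).1 b hb)
    have hlabelled : ∀ y, s2.arr 3 y ≠ 0 ↔ s.arr 3 y ≠ 0 ∨ y ∈ C := by
      intro y
      by_cases hy : y ∈ l
      · have := (hlab2.p_mem y hy).1
        have := hlC y hy
        simp only [this, or_true, iff_true]
        omega
      · rw [(hlab2.out y hy).1]
        have : y ∉ C := fun h => hy (hCl y h)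
        simp [this]
    refine ⟨?_, by omega, by omega, by rwa [e5], hcntEnd, hB5, Or.inr (by rwa [hP]), htime⟩
    rw [hP, hQ, e6]
    refine ⟨hmax, ?_, ?_, ?_, ?_⟩
    · intro y hy
      by_cases hyl : y ∈ l
      · have := (hlab2.p_mem y hyl).1; omega
      · rw [(hlab2.out y hyl).1] at hy
        rw [(hlab2.out y hyl).2]
        exact hsol.q_zero y hy
    · intro a ha b hb
      rw [hlabelled] at ha ⊢
      rcases ha with ha | ha
      · exact Or.inl (hsol.closed a ha b hb)
      · exact Or.inr (hc.closed a ha b hb)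
    · intro y hy
      rcases (hlabelled y).1 hy with h | h
      · exact hsol.lt y h
      · exact hc.lt y h
    · intro a ha
      by_cases hal : a ∈ l
      · refine ⟨hQ2 a hal, ?_, (hcoin a hal).2⟩
        exact ((hlab2.q_mem a hal).resolve_left (hQ2 a hal)).2.2.symm
      · have ho := hlab2.out a hal
        rw [ho.1] at ha
        obtain ⟨g1, g2, g3⟩ := hsol.good a ha
        refine ⟨by rwa [ho.2], by rwa [ho.1, ho.2], fun y hya => ?_⟩
        by_cases hyl : y ∈ l
        -- `a` was labelled earlier and `y` just now. They lie in different components, and their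
        -- labels lie on different sides of `L`.
        · have hnot : y ∉ nbl a := by
            intro h
            exact hal (hCl a (hc.closed y (hlC y hyl) a (hd.symm h)))
          have b1 := hlabs y hyl
          have b2 := hsol.le a
          rw [if_neg hnot, coin, wt, wt, ho.1, ho.2]
          split_ifs <;> omega
        · rw [← g3 y hya, coin, coin, wt, wt, wt, wt, ho.1, ho.2, (hlab2.out y hyl).1,
            (hlab2.out y hyl).2]

/-- An attempt, unless the vertex in register `5` already has labels. -/
def tryAttempt (k : ℕ) : Prog := block [.load 16 3 5, .ite (.eq 16 1) (attempt k) .skip]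

/-- Label all vertices. -/
def labelAll : Prog :=
  block [.const 2 1, .const 3 2, .const 4 3, .const 5 0,
    .while (.lt 5 0) (block [tryAttempt 0, tryAttempt 1, tryAttempt 2, .add 5 5 2])]

/-- The state after the attempts before the `k`-th one at the vertex `e` with component `C`. -/
structure Tried (n : ℕ) (off nb : ℕ → ℕ) (nbl : ℕ → List ℕ) (inc : ℕ → U → Prop) (P₀ Q₀ : ℕ → ℕ)
    (L₀ e : ℕ) (C : Finset ℕ) (k : ℕ) (s : Memory) : Prop where
  base : Base n off nb s
  reg : s.reg 5 = e
  solved : Solved n nbl (s.arr 3) (s.arr 4) (s.reg 6)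
  le : s.reg 6 ≤ L₀ + k * (1 + C.card)
  ge : L₀ ≤ s.reg 6
  marks : ∀ y < n, s.arr 5 y = 0
  cnt : ∀ j, s.reg 6 < j → s.arr 7 j = 0
  result : (s.arr 3 = P₀ ∧ s.arr 4 = Q₀ ∧ ∀ j < k, ¬ RightSeed n nbl inc e j) ∨
    ∀ y, s.arr 3 y ≠ 0 ↔ P₀ y ≠ 0 ∨ y ∈ C

/-- A failed attempt restores the labels but not the level in register `6`, so every attempt works
with fresh labels. The bound `hLW` leaves room for three attempts. -/
theorem ok_tryAttempt (hin : Input n W off nb nbl) (hd : LineData n nbl inc) {s : Memory}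
    {P₀ Q₀ : ℕ → ℕ} {e L₀ k : ℕ} {C : Finset ℕ} (hk : k < 3)
    (h : Tried n off nb nbl inc P₀ Q₀ L₀ e C k s)
    (hLW : L₀ + 4 * n + 6 < W) (hc : Comp n nbl C P₀ Q₀ L₀) (heC : e ∈ C)
    (hmin : ∀ X : Set ℕ, e ∈ X → (∀ a ∈ X, ∀ b ∈ nbl a, b ∈ X) → ∀ y ∈ C, y ∈ X) :
    Ok W (tryAttempt k) s (fun t s' => Tried n off nb nbl inc P₀ Q₀ L₀ e C (k + 1) s' ∧
      t ≤ 140 * C.card + 70 * ∑ y ∈ C, (nbl y).length + 5) := by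
  have hn := hin.n_lt
  have hCn := hc.card_le
  have hen := hc.lt e heC
  have hle := h.solved.le
  have hL := h.le
  have hL' : s.reg 6 ≤ L₀ + 2 * (1 + C.card) :=
    hL.trans (Nat.add_le_add_left (Nat.mul_le_mul_right _ (by omega)) _)
  have hz := h.base.reg_zero
  have hstep : k * (1 + C.card) + 1 + C.card = (k + 1) * (1 + C.card) := by ring
  simp only [tryAttempt, ok_block_cons, ok_load, ok_ite_eq, ok_skip, h.reg, reg_setReg, if_true,
    if_false, Nat.reduceEqDiff, OfNat.one_ne_ofNat, hz, ok_block_nil]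
  have hfr1 : Frame [16] [] s (s.setReg 16 (s.arr 3 e)) := Frame.setReg _ _ (by simp)
  refine ⟨by have := hle e; omega, fun hP => ?_, fun hP => ?_⟩
  · have hres : s.arr 3 = P₀ ∧ s.arr 4 = Q₀ ∧ ∀ j < k, ¬ RightSeed n nbl inc e j := by
      rcases h.result with h1 | h1
      · exact h1
      · exact absurd hP ((h1 e).2 (Or.inr heC))
    obtain ⟨h1, h2, h3⟩ := hres
    have hc' : Comp n nbl C (s.arr 3) (s.arr 4) (s.reg 6) := by
      rw [h1, h2]
      exact ⟨hc.closed, hc.zero, hc.lt, fun y => by have := hle y; rwa [h1, h2] at this⟩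
    have hwr : (attempt k).wr = (attempt 0).wr := rfl
    refine ((ok_attempt hin hd (s := s.setReg 16 (s.arr 3 e)) (k := k)
      (h.base.of_frame hfr1 (by decide) (by decide)) (by simpa using h.reg) hk h.solved
      (by simp) (by omega) hc' heC hmin h.marks h.cnt).frame).mono ?_
    rintro t s' ⟨⟨g1, g2, g3, g4, g5, g6, g7, g8⟩, hfr⟩
    rw [hwr] at hfr
    refine ⟨⟨g6, ?_, g1, by omega, by have := h.ge; omega, g4, g5, ?_⟩, by omega⟩
    · rw [hfr.1 5 (by decide)]
      simpa using h.reg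
    · simp only [arr_setReg] at g7
      rcases g7 with ⟨k1, k2, k3⟩ | k1
      · refine Or.inl ⟨k1.trans h1, k2.trans h2, fun j hj => ?_⟩
        rcases Nat.lt_succ_iff_lt_or_eq.1 hj with h4 | rfl
        · exact h3 j h4
        · exact k3
      · right
        intro y
        rw [k1 y, h1]
  · refine ⟨⟨h.base.of_frame hfr1 (by decide) (by decide), by simpa using h.reg, h.solved, ?_,
      h.ge, h.marks, h.cnt, ?_⟩, by omega⟩
    · simp only [reg_setReg, if_false, Nat.reduceEqDiff]
      omega
    · rcases h.result with h1 | h1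
      · exact absurd (by rw [h1.1]; exact (hc.zero e heC).1) hP
      · exact Or.inr h1

/-- Amortization over components: the attempts at the first unlabelled vertex of a component are
paid by that whole component, after which all its vertices are skipped in constant time. -/
theorem ok_labelAll (hin : Input n W off nb nbl) (hd : LineData n nbl inc) {s : Memory}
    (h0 : s.reg 0 = n) (h0' : ∀ r, r ≠ 0 → s.reg r = 0) (ha0 : s.arr 0 = off) (ha1 : s.arr 1 = nb)
    (ha : ∀ a, 1 < a → ∀ i, s.arr a i = 0) :
    Ok W labelAll s (fun t s' => Base n off nb s' ∧
      Solved n nbl (s'.arr 3) (s'.arr 4) (s'.reg 6) ∧ (∀ y < n, s'.arr 3 y ≠ 0) ∧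
      s'.reg 6 ≤ 6 * n ∧ t ≤ ∑ y ∈ Finset.range n, (480 + 210 * (nbl y).length) + 10) := by
  have hn := hin.n_lt
  simp only [labelAll, ok_block_cons, ok_const]
  refine ⟨by omega, by omega, by omega, by omega, ?_⟩
  set s1 := (((s.setReg 2 1).setReg 3 2).setReg 4 3).setReg 5 0 with hs1
  have hsum : ∀ (C : Finset ℕ) (a b : ℕ), ∑ y ∈ C, (a + b * (nbl y).length) =
      a * C.card + b * ∑ y ∈ C, (nbl y).length := by
    intro C a b
    rw [Finset.sum_add_distrib, ← Finset.mul_sum, Finset.sum_const, smul_eq_mul, mul_comm]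
  refine (Ok.while (γ := ℕ × Finset ℕ) (fun g s' => s'.reg 5 = g.1 ∧ g.1 ≤ n ∧
      Base n off nb s' ∧ Solved n nbl (s'.arr 3) (s'.arr 4) (s'.reg 6) ∧
      (∀ y, y ∈ g.2 ↔ s'.arr 3 y ≠ 0) ∧ (∀ y < g.1, y ∈ g.2) ∧ s'.reg 6 ≤ 6 * g.2.card ∧
      (∀ y < n, s'.arr 5 y = 0) ∧ (∀ k, s'.reg 6 < k → s'.arr 7 k = 0))
    -- `g.1` is the current vertex and `g.2` the set of labelled vertices. Three attempts cost `3 *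
    -- (140 * |C| + 70 * D + 5)`, with `D` the sum of the degrees in `C`; the term with `30` pays
    -- for the outer loop.
    (fun g => ∑ y ∈ Finset.range n \ g.2, (450 + 210 * (nbl y).length) + 30 * (n - g.1))
    ?_ (0, ∅) s1 ?_).mono ?_
  · rintro ⟨e, Dn⟩ s2 ⟨g1, g2, hB2, hsol, g3, g4, g5, g6, g7⟩ hb
    dsimp only at g1 g2 g3 g4 g5
    rw [holds_lt, g1, hB2.reg_n] at hb
    have hDn : Dn ⊆ Finset.range n := fun y hy => Finset.mem_range.2 (hsol.lt y ((g3 y).1 hy))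
    have hDc : Dn.card ≤ n := by simpa using Finset.card_le_card hDn
    by_cases he : s2.arr 3 e = 0
    · obtain ⟨C, hc, heC, hmin⟩ := hsol.exists_comp hd hb he
      have hdisj : Disjoint Dn C := Finset.disjoint_left.2 fun y hy hy' =>
        (g3 y).1 hy (hc.zero y hy').1
      have hCR : C ⊆ Finset.range n \ Dn := fun y hy => by
        rw [Finset.mem_sdiff]
        exact ⟨Finset.mem_range.2 (hc.lt y hy), fun h => Finset.disjoint_left.1 hdisj h hy⟩
      have hCpos : 1 ≤ C.card := Finset.card_pos.2 ⟨e, heC⟩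
      have T0 : Tried n off nb nbl inc (s2.arr 3) (s2.arr 4) (s2.reg 6) e C 0 s2 :=
        ⟨hB2, g1, hsol, by omega, le_rfl, g6, g7, Or.inl ⟨rfl, rfl, by omega⟩⟩
      have hLW : s2.reg 6 + 4 * n + 6 < W := by omega
      simp only [ok_block_cons]
      refine (ok_tryAttempt hin hd (by omega) T0 hLW hc heC hmin).mono ?_
      rintro t3 s3 ⟨T1, ht3⟩
      refine (ok_tryAttempt hin hd (by omega) T1 hLW hc heC hmin).mono ?_
      rintro t4 s4 ⟨T2, ht4⟩
      refine (ok_tryAttempt hin hd (by omega) T2 hLW hc heC hmin).mono ?_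
      rintro t5 s5 ⟨T3, ht5⟩
      -- Failure of all three candidates would contradict `exists_seed`.
      have hres : ∀ y, s5.arr 3 y ≠ 0 ↔ s2.arr 3 y ≠ 0 ∨ y ∈ C := by
        rcases T3.result with ⟨_, _, h3⟩ | h3
        · obtain ⟨k, hk, hR⟩ := hd.exists_seed hb
          exact absurd hR (h3 k hk)
        · exact h3
      simp only [ok_add, ok_block_nil, T3.reg, T3.base.reg_one]
      refine ⟨by omega, (e + 1, Dn ∪ C), ⟨by simp, hb, ?_, ?_, ?_, ?_, ?_, ?_, ?_⟩, ?_⟩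
      · exact T3.base.of_frame (R := [5]) (A := []) (Frame.setReg _ _ (by simp)) (by decide)
          (by decide)
      · simpa using T3.solved
      · intro y
        simp only [arr_setReg, hres, Finset.mem_union, g3]
      · intro y hy
        dsimp only at hy
        rw [Finset.mem_union]
        rcases Nat.lt_succ_iff_lt_or_eq.1 hy with h4 | rfl
        · exact Or.inl (g4 y h4)
        · exact Or.inr heC
      -- Three attempts use at most `3 * (1 + |C|)` labels, which is at most `6 * |C|` as `C` is not
      -- empty.
      · have := T3.le
        simp only [reg_setReg, if_false, Nat.reduceEqDiff]
        rw [Finset.card_union_of_disjoint hdisj]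
        omega
      · simpa using T3.marks
      · simpa using T3.cnt
      · have hsplit : Finset.range n \ (Dn ∪ C) = (Finset.range n \ Dn) \ C := by
          rw [Finset.sdiff_union_distrib, Finset.sdiff_sdiff_left']
        dsimp only
        rw [hsplit, ← Finset.sum_sdiff hCR, hsum C]
        omega
    · have hB2z := hB2.reg_zero
      have hle := hsol.le e
      simp only [tryAttempt, ok_block_cons, ok_load, ok_ite_eq, ok_skip, ok_add, g1, reg_setReg,
        arr_setReg, if_true, if_false, Nat.reduceEqDiff, OfNat.one_ne_ofNat,
        hB2z, ok_block_nil, he, false_imp_iff, true_and, not_false_iff, forall_const, hB2.reg_one]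
      refine ⟨by omega, by omega, by omega, by omega, (e + 1, Dn), ⟨rfl, hb, ?_, hsol, g3, ?_, g5,
        g6, g7⟩, by dsimp only; omega⟩
      · refine hB2.of_frame (R := [16, 5]) (A := []) ?_ (by decide) (by decide)
        exact ⟨fun r hr => by simp_all, fun a _ => rfl⟩
      · intro y hy
        dsimp only at hy
        rcases Nat.lt_succ_iff_lt_or_eq.1 hy with h4 | rfl
        · exact g4 y h4
        · exact (g3 y).2 he
  · have e3 : s.arr 3 = fun _ => 0 := funext fun i => ha 3 (by omega) i
    have e4 : s.arr 4 = fun _ => 0 := funext fun i => ha 4 (by omega) i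
    refine ⟨by simp [hs1], Nat.zero_le _, ?_, ?_, ?_, ?_, ?_, ?_, ?_⟩
    · exact ⟨by simp [hs1, ha0], by simp [hs1, ha1], by simp [hs1, h0],
        by simp [hs1, h0' 1], by simp [hs1], by simp [hs1], by simp [hs1]⟩
    · simp only [hs1, arr_setReg, e3, e4]
      exact ⟨by simp, by simp, by simp, by simp, by simp⟩
    · simp [hs1, e3]
    · simp
    · simp [hs1, h0' 6]
    · intro y _; simp [hs1, ha 5 (by omega)]
    · intro y _; simp [hs1, ha 7 (by omega)]
  · rintro t s' ⟨⟨e, Dn⟩, ⟨g1, g2, hB2, hsol, g3, g4, g5, g6, g7⟩, hb, ht⟩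
    dsimp only at g1 g2 g3 g4 g5 ht
    rw [holds_lt, g1, hB2.reg_n] at hb
    obtain rfl : e = n := by omega
    have hDn : Dn ⊆ Finset.range e := fun y hy => Finset.mem_range.2 (hsol.lt y ((g3 y).1 hy))
    have hDc : Dn.card ≤ e := by simpa using Finset.card_le_card hDn
    simp only [ok_block_nil]
    refine ⟨hB2, hsol, fun y hy => (g3 y).1 (g4 y hy), by omega, ?_⟩
    rw [Finset.sdiff_empty, hsum, hsum, Finset.card_range] at ht
    rw [hsum, Finset.card_range]
    omega

end Phase

end RAM

/-! ### Alternating colourings along Euler tours -/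

section Euler

variable {n M L : ℕ} {P Q : ℕ → ℕ}

theorem wt_pos_iff {v e : ℕ} : wt P Q v e ≠ 0 ↔ P e = v ∨ Q e = v := by
  unfold wt
  split_ifs <;> simp_all

/-- The number of edges of `S` at `v`. -/
def degIn (P Q : ℕ → ℕ) (S : Finset ℕ) (v : ℕ) : ℕ := ∑ e ∈ S, wt P Q v e

/-- The number of edges of `S` at `v` that are not among the first `n`. -/
def extra (n : ℕ) (P Q : ℕ → ℕ) (S : Finset ℕ) (v : ℕ) : ℕ :=
  ∑ e ∈ S.filter (fun e => ¬ e < n), wt P Q v e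

/-- The imbalance at `v` of the signs `y` on the edges of `S` among the first `n`. -/
def imb (n : ℕ) (P Q : ℕ → ℕ) (y : ℕ → ℤ) (S : Finset ℕ) (v : ℕ) : ℤ :=
  ∑ e ∈ S.filter (· < n), y e * (wt P Q v e : ℤ)

/-- The sign of a colour `0` or `1`. -/
def sgn (x : ℕ → ℕ) (e : ℕ) : ℤ := 1 - 2 * (x e : ℤ)

/-- The sum of the squared imbalances at the vertices `1, …, L`. -/
def energy (n L : ℕ) (P Q : ℕ → ℕ) (y : ℕ → ℤ) (S : Finset ℕ) : ℤ :=
  ∑ v ∈ Finset.Icc 1 L, imb n P Q y S v ^ 2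

theorem degIn_eq_zero {S : Finset ℕ} {v : ℕ} :
    degIn P Q S v = 0 ↔ ∀ e ∈ S, wt P Q v e = 0 := by
  unfold degIn
  rw [Finset.sum_eq_zero_iff]

theorem degIn_erase {S : Finset ℕ} {v e : ℕ} (he : e ∈ S) :
    degIn P Q (S.erase e) v + wt P Q v e = degIn P Q S v :=
  Finset.sum_erase_add _ _ he

theorem imb_congr {y z : ℕ → ℤ} {S : Finset ℕ} (h : ∀ e ∈ S, y e = z e) (v : ℕ) :
    imb n P Q y S v = imb n P Q z S v :=
  Finset.sum_congr rfl fun e he => by rw [h e (Finset.mem_filter.1 he).1]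

theorem imb_union {y : ℕ → ℤ} {S T : Finset ℕ} (h : Disjoint S T) (v : ℕ) :
    imb n P Q y (S ∪ T) v = imb n P Q y S v + imb n P Q y T v := by
  unfold imb
  rw [Finset.filter_union, Finset.sum_union]
  exact Finset.disjoint_filter_filter h

theorem imb_eq_zero {y : ℕ → ℤ} {S : Finset ℕ} {v : ℕ} (h : ∀ e ∈ S, wt P Q v e = 0) :
    imb n P Q y S v = 0 :=
  Finset.sum_eq_zero fun e he => by rw [h e (Finset.mem_filter.1 he).1]; simp

/-- Two signs of an edge differ by `0` or `±2`. This is the source of every lower bound on the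
energy. -/
theorem imb_parity {y z : ℕ → ℤ} (hy : ∀ e, y e = 1 ∨ y e = -1) (hz : ∀ e, z e = 1 ∨ z e = -1)
    (S : Finset ℕ) (v : ℕ) : ∃ k, imb n P Q y S v = imb n P Q z S v + 2 * k := by
  have : (2 : ℤ) ∣ imb n P Q y S v - imb n P Q z S v := by
    unfold imb
    rw [← Finset.sum_sub_distrib]
    refine Finset.dvd_sum fun e _ => ?_
    rw [← sub_mul]
    refine Dvd.dvd.mul_right ?_ _
    rcases hy e with h1 | h1 <;> rcases hz e with h2 | h2 <;> rw [h1, h2] <;> norm_num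
  obtain ⟨k, hk⟩ := this
  exact ⟨k, by linarith⟩

theorem sum_imb {y : ℕ → ℤ} {S : Finset ℕ}
    (hL : ∀ e ∈ S, e < n → 1 ≤ P e ∧ P e ≤ L ∧ 1 ≤ Q e ∧ Q e ≤ L) :
    ∑ v ∈ Finset.Icc 1 L, imb n P Q y S v = 2 * ∑ e ∈ S.filter (· < n), y e := by
  unfold imb
  rw [Finset.sum_comm, Finset.mul_sum]
  refine Finset.sum_congr rfl fun e he => ?_
  rw [Finset.mem_filter] at he
  obtain ⟨h1, h2, h3, h4⟩ := hL e he.1 he.2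
  rw [← Finset.mul_sum]
  have : ∑ v ∈ Finset.Icc 1 L, (wt P Q v e : ℤ) = 2 := by
    unfold wt
    push_cast
    rw [Finset.sum_add_distrib, Finset.sum_ite_eq, Finset.sum_ite_eq,
      if_pos (Finset.mem_Icc.2 ⟨h1, h2⟩), if_pos (Finset.mem_Icc.2 ⟨h3, h4⟩)]
    norm_num
  rw [this]
  ring

/-- An alternating colouring of closed or open trails minimizes the energy. -/
theorem energy_le_of_alternating {x y : ℕ → ℤ} (hx : ∀ e, x e = 1 ∨ x e = -1)
    (hy : ∀ e, y e = 1 ∨ y e = -1) {S : Finset ℕ} {s : ℕ} {c : ℤ}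
    (hL : ∀ e ∈ S, e < n → 1 ≤ P e ∧ P e ≤ L ∧ 1 ≤ Q e ∧ Q e ≤ L)
    (hc : c = 0 ∨ c = 2 ∨ c = -2)
    (hb : ∀ v, 1 ≤ v → |imb n P Q x S v + (if v = s then c else 0)| ≤ extra n P Q S v)
    (h1 : ∀ v, 1 ≤ v → extra n P Q S v ≤ 1)
    (h2 : s = 0 ∨ ∀ v, extra n P Q S v = 0) :
    energy n L P Q x S ≤ energy n L P Q y S := by
  unfold energy
  rcases h2 with rfl | h2
  -- For the tour from `0` each vertex is optimal by itself: `0`, `1` and `-1` have the least square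
  -- among the integers of their parity.
  · refine Finset.sum_le_sum fun v hv => ?_
    have hv1 := (Finset.mem_Icc.1 hv).1
    have h3 := hb v hv1
    have h4 := h1 v hv1
    rw [if_neg (by omega), add_zero, abs_le] at h3
    obtain ⟨k, hk⟩ := imb_parity (n := n) (P := P) (Q := Q) hy hx S v
    rw [hk]
    have h5 : imb n P Q x S v = 0 ∨ imb n P Q x S v = 1 ∨ imb n P Q x S v = -1 := by omega
    rcases h5 with h5 | h5 | h5 <;> rw [h5]
    · nlinarith [sq_nonneg k]
    · have : 0 ≤ k * (k + 1) := by
        rcases le_or_gt 0 k with h | h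
        · positivity
        · exact mul_nonneg_of_nonpos_of_nonpos (by omega) (by omega)
      nlinarith
    · have : 0 ≤ k * (k - 1) := by
        rcases le_or_gt k 0 with h | h
        · exact mul_nonneg_of_nonpos_of_nonpos (by omega) (by omega)
        · exact mul_nonneg (by omega) (by omega)
      nlinarith
  -- Without auxiliary edges all vertices are balanced, except that the start has imbalance `-c`.
  · have hxv : ∀ v, 1 ≤ v → imb n P Q x S v = if v = s then -c else 0 := by
      intro v hv
      have h3 := hb v hv
      rw [h2 v] at h3
      have := abs_nonpos_iff.1 (h3.trans (by simp))
      split_ifs at this ⊢ <;> omega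
    have hsumx : ∑ v ∈ Finset.Icc 1 L, imb n P Q x S v ^ 2 =
        if s ∈ Finset.Icc 1 L then c ^ 2 else 0 := by
      rw [← Finset.sum_ite_eq' (Finset.Icc 1 L) s (fun _ => c ^ 2)]
      refine Finset.sum_congr rfl fun v hv => ?_
      rw [hxv v (Finset.mem_Icc.1 hv).1]
      split_ifs <;> ring
    have hnn : 0 ≤ ∑ v ∈ Finset.Icc 1 L, imb n P Q y S v ^ 2 :=
      Finset.sum_nonneg fun v _ => sq_nonneg _
    rw [hsumx]
    split_ifs with hs
    · rcases eq_or_ne c 0 with rfl | hc0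
      · simpa using hnn
      · have hc4 : c ^ 2 = 4 := by
          rcases hc with h | h | h
          · exact absurd h hc0
          · rw [h]; norm_num
          · rw [h]; norm_num
        rw [hc4]
        have hsx : 2 * ∑ e ∈ S.filter (· < n), x e = -c := by
          rw [← sum_imb (L := L) (P := P) (Q := Q) hL, ← Finset.sum_ite_eq' (Finset.Icc 1 L) s
            (fun _ => -c) |>.trans (if_pos hs)]
          exact Finset.sum_congr rfl fun v hv => hxv v (Finset.mem_Icc.1 hv).1
        have hpar : (2 : ℤ) ∣ ∑ e ∈ S.filter (· < n), y e - ∑ e ∈ S.filter (· < n), x e := by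
          rw [← Finset.sum_sub_distrib]
          refine Finset.dvd_sum fun e _ => ?_
          rcases hy e with h1 | h1 <;> rcases hx e with h2 | h2 <;> rw [h1, h2] <;> norm_num
        -- For `c = ±2` the signs `x` sum to `±1`, so any signs `y` have an odd sum and some vertex
        -- is unbalanced. Its imbalance is even like that of `x`, so it contributes at least `4`.
        have hne : ∑ v ∈ Finset.Icc 1 L, imb n P Q y S v ≠ 0 := by
          rw [sum_imb (L := L) (P := P) (Q := Q) hL]
          intro h
          rcases hc with h | h | h <;> omega
        obtain ⟨v, hv, hv0⟩ := Finset.exists_ne_zero_of_sum_ne_zero hne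
        have hle : imb n P Q y S v ^ 2 ≤ ∑ v ∈ Finset.Icc 1 L, imb n P Q y S v ^ 2 :=
          Finset.single_le_sum (f := fun v => imb n P Q y S v ^ 2) (fun v _ => sq_nonneg _) hv
        refine le_trans ?_ hle
        obtain ⟨k, hk⟩ := imb_parity (n := n) (P := P) (Q := Q) hy hx S v
        obtain ⟨j, hj⟩ : ∃ j, imb n P Q y S v = 2 * j := by
          rw [hk, hxv v (Finset.mem_Icc.1 hv).1]
          split_ifs
          · rcases hc with h | h | h
            · exact absurd h hc0
            · exact ⟨-1 + k, by omega⟩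
            · exact ⟨1 + k, by omega⟩
          · exact ⟨k, by omega⟩
        rw [hj] at hv0 ⊢
        have hj0 : j ≠ 0 := by rintro rfl; simp at hv0
        have : 1 ≤ j ^ 2 := by
          have := sq_pos_of_ne_zero hj0
          omega
        nlinarith
    · exact hnn

/-- The edges on the stack of Hierholzer's algorithm (the bottom entry carries no edge). -/
def stackEdges (stk : List (ℕ × ℕ)) : List ℕ := stk.dropLast.map Prod.snd

/-- The edge `e` joins `v` and `w`. -/
def Joins (P Q : ℕ → ℕ) (e v w : ℕ) : Prop := (P e = v ∧ Q e = w) ∨ (P e = w ∧ Q e = v)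

/-- The stack is a trail that starts at `s`; the bottom entry has a number that is not below `n`
in place of an edge. -/
def Linked (n : ℕ) (P Q : ℕ → ℕ) (s : ℕ) : List (ℕ × ℕ) → Prop
  | [] => True
  | [a] => a.1 = s ∧ n ≤ a.2
  | a :: b :: r => Joins P Q a.2 a.1 b.1 ∧ Linked n P Q s (b :: r)

/-- The top vertex of the stack, or `c` if the stack is empty. -/
def topOr (c : ℕ) : List (ℕ × ℕ) → ℕ
  | [] => c
  | a :: _ => a.1

theorem Joins.wt_eq {e v w : ℕ} (h : Joins P Q e v w) (u : ℕ) :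
    wt P Q u e = (if u = v then 1 else 0) + (if u = w then 1 else 0) := by
  unfold wt
  rcases h with ⟨rfl, rfl⟩ | ⟨rfl, rfl⟩
  · simp only [eq_comm]
  · rw [add_comm]; simp only [eq_comm]

/-- Invariant of Hierholzer's algorithm, started at `s` with the unused edges `U₀`: the unused
edges are `U`, the edges in `S` were output and coloured alternately along a walk from `s` to `c`,
with next colour `b`. -/
structure Tour (n : ℕ) (P Q : ℕ → ℕ) (U₀ : Finset ℕ) (s : ℕ) (x₀ : ℕ → ℕ) (b₀ : ℕ)
    (U S : Finset ℕ) (stk : List (ℕ × ℕ)) (c : ℕ) (x : ℕ → ℕ) (b : ℕ) : Prop where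
  subU : U ⊆ U₀
  subS : S ⊆ U₀
  disj : Disjoint U S
  nodup : (stackEdges stk).Nodup
  mem_stack : ∀ e, e ∈ stackEdges stk ↔ e ∈ U₀ ∧ e ∉ U ∧ e ∉ S
  linked : Linked n P Q s stk
  parity : ∀ v, Even (degIn P Q U v + (if v = topOr c stk then 1 else 0) + (if v = c then 1 else 0))
  imb_le : ∀ v, 1 ≤ v → |imb n P Q (sgn x) S v + (if v = c then 1 - 2 * (b : ℤ) else 0) -
    (if v = s then 1 - 2 * (b₀ : ℤ) else 0)| ≤ extra n P Q S v
  closed : ∀ e ∈ U₀, e ∉ U → ∀ v, wt P Q v e ≠ 0 → v ∈ stk.map Prod.fst ∨ degIn P Q U v = 0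
  start : s ∈ stk.map Prod.fst ∨ degIn P Q U s = 0
  final : stk = [] → c = s
  b_le : b ≤ 1
  x_out : ∀ e, e ∉ S → x e = x₀ e
  x_le : ∀ e, x e ≤ 1
  bal : ∑ e ∈ S.filter (· < n), sgn x e = (b : ℤ) - b₀

/-! ### The moves of Hierholzer's algorithm preserve its invariant -/

variable {U₀ U S : Finset ℕ} {s c b b₀ : ℕ} {x x₀ : ℕ → ℕ} {stk : List (ℕ × ℕ)}

theorem Tour.init (hev : ∀ v, Even (degIn P Q U₀ v)) (hb : b₀ ≤ 1) (hx : ∀ e, x₀ e ≤ 1)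
    {k : ℕ} (hk : n ≤ k) :
    Tour n P Q U₀ s x₀ b₀ U₀ ∅ [(s, k)] s x₀ b₀ where
  subU := subset_rfl
  subS := Finset.empty_subset _
  disj := Finset.disjoint_empty_right _
  nodup := by simp [stackEdges]
  mem_stack e := by simp [stackEdges]
  linked := ⟨rfl, hk⟩
  parity v := by
    have := hev v
    rw [show topOr s [(s, k)] = s from rfl]
    rw [Nat.even_iff] at this ⊢
    split_ifs <;> omega
  imb_le v _ := by simp [imb, extra]
  closed e he he' := absurd he he'
  start := by simp
  final := by simp
  b_le := hb
  x_out _ _ := rfl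
  x_le := hx
  bal := by simp

theorem degIn_mono {S T : Finset ℕ} (h : S ⊆ T) {v : ℕ} (hv : degIn P Q T v = 0) :
    degIn P Q S v = 0 := by
  rw [degIn_eq_zero] at hv ⊢
  exact fun e he => hv e (h he)

/-- Taking `e` out of the unused edges changes the parities at `v` and `w`, and so does the move of
the top from `v` to `w`; the parity condition is therefore kept. -/
theorem Tour.push {v k : ℕ} {r : List (ℕ × ℕ)} {e w : ℕ}
    (h : Tour n P Q U₀ s x₀ b₀ U S ((v, k) :: r) c x b) (he : e ∈ U) (hj : Joins P Q e w v) :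
    Tour n P Q U₀ s x₀ b₀ (U.erase e) S ((w, e) :: (v, k) :: r) c x b where
  subU := (Finset.erase_subset _ _).trans h.subU
  subS := h.subS
  disj := h.disj.mono_left (Finset.erase_subset _ _)
  nodup := by
    have h1 : stackEdges ((w, e) :: (v, k) :: r) = e :: stackEdges ((v, k) :: r) := by
      simp [stackEdges]
    rw [h1, List.nodup_cons, h.mem_stack]
    exact ⟨fun h => h.2.1 he, h.nodup⟩
  mem_stack a := by
    have h1 : stackEdges ((w, e) :: (v, k) :: r) = e :: stackEdges ((v, k) :: r) := by
      simp [stackEdges]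
    have h2 : e ∉ S := Finset.disjoint_left.1 h.disj he
    have h3 := h.subU he
    rw [h1, List.mem_cons, h.mem_stack, Finset.mem_erase]
    by_cases hae : a = e
    · subst hae; simp [h2, h3]
    · simp [hae]
  linked := ⟨hj, h.linked⟩
  parity u := by
    have h1 := h.parity u
    rw [← degIn_erase he, hj.wt_eq] at h1
    rw [show topOr c ((v, k) :: r) = v from rfl] at h1
    rw [show topOr c ((w, e) :: (v, k) :: r) = w from rfl]
    rw [Nat.even_iff] at h1 ⊢
    split_ifs at h1 ⊢ <;> omega
  imb_le := h.imb_le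
  closed a ha haU u hu := by
    by_cases hae : a = e
    · subst hae
      left
      rw [hj.wt_eq] at hu
      simp only [List.map_cons, List.mem_cons]
      by_contra hcon
      push Not at hcon
      rw [if_neg hcon.1, if_neg hcon.2.1] at hu
      exact hu rfl
    · have haU' : a ∉ U := fun h => haU (Finset.mem_erase.2 ⟨hae, h⟩)
      rcases h.closed a ha haU' u hu with h1 | h1
      · left
        rw [List.map_cons]
        exact List.mem_cons_of_mem _ h1
      · exact Or.inr (degIn_mono (Finset.erase_subset _ _) h1)
  start := by
    rcases h.start with h1 | h1
    · left
      rw [List.map_cons]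
      exact List.mem_cons_of_mem _ h1
    · exact Or.inr (degIn_mono (Finset.erase_subset _ _) h1)
  final := by simp
  b_le := h.b_le
  x_out := h.x_out
  x_le := h.x_le
  bal := h.bal

/-- The heart of Hierholzer's algorithm: the unused degrees are odd only at the top of the stack and
at the end `c` of the walk output so far, if these differ. A top without unused edges has even
degree `0`, so it equals `c`, and the edge popped next continues the walk. -/
theorem Tour.top_eq {v k : ℕ} {r : List (ℕ × ℕ)}
    (h : Tour n P Q U₀ s x₀ b₀ U S ((v, k) :: r) c x b) (hv : degIn P Q U v = 0) : c = v := by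
  have h1 := h.parity v
  rw [hv] at h1
  by_contra hcv
  simp only [topOr, if_true, if_neg (Ne.symm hcv)] at h1
  exact absurd h1 (by decide)

theorem Tour.popped {v k : ℕ} {r : List (ℕ × ℕ)}
    (h : Tour n P Q U₀ s x₀ b₀ U S ((v, k) :: r) c x b) (hv : degIn P Q U v = 0) (u : ℕ)
    (hu : u ∈ List.map Prod.fst ((v, k) :: r) ∨ degIn P Q U u = 0) :
    u ∈ List.map Prod.fst r ∨ degIn P Q U u = 0 := by
  rcases hu with hu | hu
  · rw [List.map_cons, List.mem_cons] at hu
    rcases hu with rfl | hu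
    · exact Or.inr hv
    · exact Or.inl hu
  · exact Or.inr hu

/-- The bottom entry sits at the start `s`, so by `top_eq` the output walk is closed. -/
theorem Tour.pop_last {v k : ℕ} (h : Tour n P Q U₀ s x₀ b₀ U S [(v, k)] c x b)
    (hv : degIn P Q U v = 0) : Tour n P Q U₀ s x₀ b₀ U S [] c x b := by
  have hcv := h.top_eq hv
  exact
  { subU := h.subU
    subS := h.subS
    disj := h.disj
    nodup := by simp [stackEdges]
    mem_stack := h.mem_stack
    linked := trivial
    parity := fun u => by
      have := h.parity u
      rw [hcv] at this ⊢
      exact this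
    imb_le := h.imb_le
    closed := fun e he heU u hu => h.popped hv u (h.closed e he heU u hu)
    start := h.popped hv s h.start
    final := fun _ => hcv.trans h.linked.1
    b_le := h.b_le
    x_out := h.x_out
    x_le := h.x_le
    bal := h.bal }

/-- The term `1 - 2b` at `c` in the invariant is the sign that the next edge will have. A coloured
edge makes it actual and flips `b`; an auxiliary edge passes it on unchanged, at the expense of
`extra`. -/
theorem Tour.pop {v e : ℕ} {a : ℕ × ℕ} {r : List (ℕ × ℕ)}
    (h : Tour n P Q U₀ s x₀ b₀ U S ((v, e) :: a :: r) c x b) (hv : degIn P Q U v = 0) :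
    Tour n P Q U₀ s x₀ b₀ U (insert e S) (a :: r) a.1
      (if e < n then Function.update x e b else x) (if e < n then 1 - b else b) := by
  have hcv := h.top_eq hv
  subst hcv
  have hst : stackEdges ((c, e) :: a :: r) = e :: stackEdges (a :: r) := by simp [stackEdges]
  have hmem := (h.mem_stack e).1 (by rw [hst]; simp)
  have hnd := h.nodup
  rw [hst, List.nodup_cons] at hnd
  obtain ⟨hj, hl⟩ := h.linked
  dsimp only at hj
  have hb := h.b_le
  have hxe : ∀ f, f ∈ S → (if e < n then Function.update x e b else x) f = x f := by
    intro f hf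
    have : f ≠ e := by rintro rfl; exact hmem.2.2 hf
    split_ifs
    · rw [Function.update_of_ne this]
    · rfl
  refine
  { subU := h.subU
    subS := Finset.insert_subset hmem.1 h.subS
    disj := by
      rw [Finset.disjoint_insert_right]
      exact ⟨hmem.2.1, h.disj⟩
    nodup := hnd.2
    mem_stack := fun f => ?_
    linked := hl
    parity := fun u => ?_
    imb_le := fun u hu => ?_
    closed := fun f hf hfU u hu => h.popped hv u (h.closed f hf hfU u hu)
    start := h.popped hv s h.start
    final := by simp
    b_le := by split_ifs <;> omega
    x_out := fun f hf => ?_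
    x_le := fun f => ?_
    bal := ?_ }
  · have h1 := h.mem_stack f
    rw [hst, List.mem_cons] at h1
    rw [Finset.mem_insert]
    by_cases hfe : f = e
    · subst hfe; simp [hnd.1]
    · simp only [hfe, false_or] at h1 ⊢
      exact h1
  · have h1 := h.parity u
    rw [show topOr c ((c, e) :: a :: r) = c from rfl] at h1
    rw [show topOr a.1 (a :: r) = a.1 from rfl]
    rw [Nat.even_iff] at h1 ⊢
    split_ifs at h1 ⊢ <;> omega
  · have h1 := h.imb_le u hu
    have hw := hj.wt_eq u
    by_cases hen : e < n
    · simp only [if_pos hen] at hxe ⊢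
      have e1 : imb n P Q (sgn (Function.update x e b)) (insert e S) u =
          (1 - 2 * (b : ℤ)) * (wt P Q u e : ℤ) + imb n P Q (sgn x) S u := by
        unfold imb
        rw [Finset.filter_insert, if_pos hen, Finset.sum_insert
          (fun hm => hmem.2.2 (Finset.mem_filter.1 hm).1)]
        congr 1
        · simp [sgn]
        · refine Finset.sum_congr rfl fun f hf => ?_
          rw [sgn, sgn, hxe f (Finset.mem_filter.1 hf).1]
      have e2 : extra n P Q (insert e S) u = extra n P Q S u := by
        unfold extra
        rw [Finset.filter_insert, if_neg (by simpa using hen)]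
      rw [e1, e2, hw]
      -- At the old end the sign of `e` replaces the pending sign; at the new end it cancels against
      -- the flipped pending sign.
      convert h1 using 2
      have : ((1 - b : ℕ) : ℤ) = 1 - (b : ℤ) := by omega
      rw [this]
      push_cast
      split_ifs <;> ring
    · simp only [if_neg hen] at hxe ⊢
      have e1 : imb n P Q (sgn x) (insert e S) u = imb n P Q (sgn x) S u := by
        unfold imb
        rw [Finset.filter_insert, if_neg hen]
      have e2 : extra n P Q (insert e S) u = wt P Q u e + extra n P Q S u := by
        unfold extra
        rw [Finset.filter_insert, if_pos (by simpa using hen), Finset.sum_insert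
          (fun hm => hmem.2.2 (Finset.mem_filter.1 hm).1)]
      rw [e1, e2, hw]
      push_cast
      -- Moving the pending sign along an auxiliary edge changes the sum by at most `1` at each of
      -- its ends, no more than `extra` gains there.
      rw [abs_le] at h1 ⊢
      split_ifs at h1 ⊢ <;> omega
  · rw [Finset.mem_insert, not_or] at hf
    rw [← h.x_out f hf.2]
    split_ifs
    · rw [Function.update_of_ne hf.1]
    · rfl
  · have h1 := h.x_le f
    split_ifs
    · rw [Function.update_apply]; split_ifs <;> omega
    · exact h1
  · have h1 := h.bal
    by_cases hen : e < n
    · simp only [if_pos hen] at hxe ⊢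
      rw [Finset.filter_insert, if_pos hen, Finset.sum_insert
          (fun hm => hmem.2.2 (Finset.mem_filter.1 hm).1)]
      have e3 : ∑ f ∈ S.filter (· < n), sgn (Function.update x e b) f =
          ∑ f ∈ S.filter (· < n), sgn x f :=
        Finset.sum_congr rfl fun f hf => by rw [sgn, sgn, hxe f (Finset.mem_filter.1 hf).1]
      rw [e3, h1]
      have : ((1 - b : ℕ) : ℤ) = 1 - (b : ℤ) := by omega
      rw [this]
      simp only [sgn, Function.update_self]
      ring
    · simp only [if_neg hen] at hxe ⊢
      rw [Finset.filter_insert, if_neg hen, h1]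

end Euler

/-! ### Successive tours: optimality and balance -/

section Tours

/-- The edges `0, …, n - 1` join vertices in `[1, L]`, and each of the edges `n, …, M - 1` joins a
vertex in `[1, L]` to the vertex `0`, at most one for every vertex; all degrees are even. -/
structure EdgeData (n M L : ℕ) (P Q : ℕ → ℕ) : Prop where
  le : n ≤ M
  ends : ∀ e < n, 1 ≤ P e ∧ P e ≤ L ∧ 1 ≤ Q e ∧ Q e ≤ L
  dummy : ∀ e, n ≤ e → e < M → Q e = 0 ∧ 1 ≤ P e ∧ P e ≤ L
  ne : ∀ e < M, P e ≠ Q e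
  extra_le : ∀ v, 1 ≤ v → extra n P Q (Finset.range M) v ≤ 1
  even : ∀ v, Even (degIn P Q (Finset.range M) v)

/-- The state after tours were started at all vertices below `l`: the unused edges are `U`. -/
structure Toured (n M L : ℕ) (P Q : ℕ → ℕ) (l : ℕ) (U : Finset ℕ) (x : ℕ → ℕ) (b : ℕ) : Prop where
  subU : U ⊆ Finset.range M
  even : ∀ v, Even (degIn P Q U v)
  closed : ∀ e < M, e ∉ U → ∀ v, wt P Q v e ≠ 0 → degIn P Q U v = 0
  done : ∀ v < l, degIn P Q U v = 0
  b_le : b ≤ 1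
  x_le : ∀ e, x e ≤ 1
  bal : ∑ e ∈ (Finset.range M \ U).filter (· < n), sgn x e = b
  opt : ∀ y : ℕ → ℤ, (∀ e, y e = 1 ∨ y e = -1) →
    energy n L P Q (sgn x) (Finset.range M \ U) ≤ energy n L P Q y (Finset.range M \ U)

variable {n M L : ℕ} {P Q : ℕ → ℕ} {U₀ U S : Finset ℕ} {s l c b b₀ : ℕ} {x x₀ : ℕ → ℕ}

theorem sgn_eq {x : ℕ → ℕ} (hx : ∀ e, x e ≤ 1) (e : ℕ) : sgn x e = 1 ∨ sgn x e = -1 := by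
  have := hx e
  unfold sgn
  omega

theorem Toured.init (hd : EdgeData n M L P Q) (hx : ∀ e, x e ≤ 1) :
    Toured n M L P Q 0 (Finset.range M) x 0 where
  subU := subset_rfl
  even := hd.even
  closed e he he' := absurd (Finset.mem_range.2 he) he'
  done := by simp
  b_le := by simp
  x_le := hx
  bal := by simp
  opt y _ := by simp [energy, imb]

/-- The energy is additive because no vertex meets both sets, so the squares have no cross terms.
This lets the tours be optimized separately. -/
theorem energy_union {y : ℕ → ℤ} {S T : Finset ℕ} (h : Disjoint S T)
    (hv : ∀ v, (∀ e ∈ S, wt P Q v e = 0) ∨ ∀ e ∈ T, wt P Q v e = 0) :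
    energy n L P Q y (S ∪ T) = energy n L P Q y S + energy n L P Q y T := by
  unfold energy
  rw [← Finset.sum_add_distrib]
  refine Finset.sum_congr rfl fun v _ => ?_
  rw [imb_union h]
  rcases hv v with h1 | h1 <;> rw [imb_eq_zero h1] <;> ring

/-- When the stack is empty, `S` is exactly the set of newly used edges. A vertex met by an edge
used earlier had no unused edges left, so `S` shares no vertex with earlier tours and the energies
add. The sums of signs telescope, because the colour `b` is handed on. -/
theorem Toured.step (hd : EdgeData n M L P Q) (h : Toured n M L P Q s U₀ x₀ b₀)
    (ht : Tour n P Q U₀ s x₀ b₀ U S [] c x b) : Toured n M L P Q (s + 1) U x b := by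
  have hcs := ht.final rfl
  subst hcs
  have hS : ∀ e, e ∈ S ↔ e ∈ U₀ ∧ e ∉ U := by
    intro e
    have h1 := ht.mem_stack e
    simp only [stackEdges, List.dropLast_nil, List.map_nil, List.not_mem_nil, false_iff] at h1
    constructor
    · intro he
      exact ⟨ht.subS he, fun h => Finset.disjoint_left.1 ht.disj h he⟩
    · rintro ⟨h2, h3⟩
      by_contra h4
      exact h1 ⟨h2, h3, h4⟩
  have hunion : Finset.range M \ U = (Finset.range M \ U₀) ∪ S := by
    ext e
    simp only [Finset.mem_sdiff, Finset.mem_union, hS]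
    constructor
    · rintro ⟨h1, h2⟩
      by_cases h3 : e ∈ U₀ <;> simp [h1, h2, h3]
    · rintro (⟨h1, h2⟩ | ⟨h1, h2⟩)
      · exact ⟨h1, fun h3 => h2 (ht.subU h3)⟩
      · exact ⟨h.subU h1, h2⟩
  have hdisj : Disjoint (Finset.range M \ U₀) S := by
    rw [Finset.disjoint_left]
    intro e h1 h2
    exact (Finset.mem_sdiff.1 h1).2 (ht.subS h2)
  have hvd : ∀ v, (∀ e ∈ Finset.range M \ U₀, wt P Q v e = 0) ∨ ∀ e ∈ S, wt P Q v e = 0 := by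
    intro v
    by_contra hcon
    push Not at hcon
    obtain ⟨⟨e, he, hew⟩, f, hf, hfw⟩ := hcon
    rw [Finset.mem_sdiff, Finset.mem_range] at he
    exact hfw (degIn_eq_zero.1 (h.closed e he.1 he.2 v hew) f (ht.subS hf))
  have hxs : ∀ e ∈ Finset.range M \ U₀, sgn x e = sgn x₀ e := by
    intro e he
    rw [sgn, sgn, ht.x_out e (fun h2 => Finset.disjoint_left.1 hdisj he h2)]
  have hclosed : ∀ e ∈ U₀, e ∉ U → ∀ v, wt P Q v e ≠ 0 → degIn P Q U v = 0 := by
    intro e he heU v hv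
    simpa using ht.closed e he heU v hv
  refine ⟨ht.subU.trans h.subU, ?_, ?_, ?_, ht.b_le, ht.x_le, ?_, ?_⟩
  · intro v
    have := ht.parity v
    rw [show topOr c [] = c from rfl] at this
    rw [Nat.even_iff] at this ⊢
    split_ifs at this <;> omega
  · intro e he heU v hv
    by_cases heU₀ : e ∈ U₀
    · exact hclosed e heU₀ heU v hv
    · exact degIn_mono ht.subU (h.closed e he heU₀ v hv)
  · intro v hv
    rcases Nat.lt_succ_iff_lt_or_eq.1 hv with h1 | rfl
    · exact degIn_mono ht.subU (h.done v h1)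
    · simpa using ht.start
  · rw [hunion, Finset.filter_union, Finset.sum_union (Finset.disjoint_filter_filter hdisj),
      ht.bal, Finset.sum_congr rfl fun e he => hxs e (Finset.mem_filter.1 he).1, h.bal]
    ring
  · intro y hy
    rw [hunion, energy_union hdisj hvd, energy_union hdisj hvd]
    refine add_le_add ?_ ?_
    · refine le_trans (le_of_eq ?_) (h.opt y hy)
      unfold energy
      exact Finset.sum_congr rfl fun v _ => by rw [imb_congr hxs]
    · have hb := ht.b_le
      have hb₀ := h.b_le
      have hSM : ∀ e ∈ S, e < M := fun e he => Finset.mem_range.1 (h.subU (ht.subS he))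
      refine energy_le_of_alternating (s := c) (c := (1 - 2 * (b : ℤ)) - (1 - 2 * (b₀ : ℤ)))
        (sgn_eq ht.x_le) hy (fun e he hen => hd.ends e hen) (by omega) ?_ ?_ ?_
      · intro v hv
        have := ht.imb_le v hv
        convert this using 2
        split_ifs <;> ring
      · intro v hv
        refine le_trans ?_ (hd.extra_le v hv)
        exact Finset.sum_le_sum_of_subset (Finset.filter_subset_filter _
          (ht.subS.trans h.subU))
      -- The tour from `0` exhausts the edges at `0`, hence all auxiliary edges, and later tours
      -- contain none.
      · rcases Nat.eq_zero_or_pos c with h0 | h0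
        · exact Or.inl h0
        · right
          intro v
          have : S.filter (fun e => ¬ e < n) = ∅ := by
            rw [Finset.filter_eq_empty_iff]
            intro e he hen
            have h1 := hd.dummy e (by omega) (hSM e he)
            have h2 := degIn_eq_zero.1 (h.done 0 h0) e (ht.subS he)
            exact wt_pos_iff.2 (Or.inr h1.1) h2
          rw [extra, this, Finset.sum_empty]

theorem Toured.end (hd : EdgeData n M L P Q) (h : Toured n M L P Q (L + 1) U x b) : U = ∅ := by
  rw [Finset.eq_empty_iff_forall_notMem]
  intro e he
  have heM := Finset.mem_range.1 (h.subU he)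
  have hP : P e ≤ L := by
    rcases Nat.lt_or_ge e n with h1 | h1
    · exact (hd.ends e h1).2.1
    · exact (hd.dummy e h1 heM).2.2
  exact wt_pos_iff.2 (Or.inl rfl) (degIn_eq_zero.1 (h.done (P e) (by omega)) e he)

theorem sum_degIn (hends : ∀ e < M, P e ≤ L ∧ Q e ≤ L) :
    ∑ v ∈ Finset.range (L + 1), degIn P Q (Finset.range M) v = 2 * M := by
  unfold degIn
  rw [Finset.sum_comm]
  have : ∀ e ∈ Finset.range M, ∑ v ∈ Finset.range (L + 1), wt P Q v e = 2 := by
    intro e he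
    have := hends e (Finset.mem_range.1 he)
    unfold wt
    rw [Finset.sum_add_distrib, Finset.sum_ite_eq, Finset.sum_ite_eq,
      if_pos (Finset.mem_range.2 (by omega)), if_pos (Finset.mem_range.2 (by omega))]
  rw [Finset.sum_congr rfl this]
  simp [mul_comm]

/-- The number of vertices of odd degree is even. -/
theorem even_degIn_zero (hends : ∀ e < M, P e ≤ L ∧ Q e ≤ L)
    (hev : ∀ v, 1 ≤ v → Even (degIn P Q (Finset.range M) v)) :
    Even (degIn P Q (Finset.range M) 0) := by
  have h1 := sum_degIn hends
  rw [Finset.sum_range_succ'] at h1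
  have h2 : Even (∑ v ∈ Finset.range L, degIn P Q (Finset.range M) (v + 1)) :=
    Finset.even_sum _ fun v _ => hev (v + 1) (by omega)
  have h3 : Even (∑ v ∈ Finset.range L, degIn P Q (Finset.range M) (v + 1) +
      degIn P Q (Finset.range M) 0) := by rw [h1]; exact even_two_mul M
  exact (Nat.even_add.1 h3).1 h2

end Tours

namespace RAM

/-! ### Incidence lists -/

section Link

variable {n W : ℕ} {off nb : ℕ → ℕ}

/-- Starting at node `h`, the linked list with nodes in `[1, K]` holds the entries of the list. -/
def Chain (K : ℕ) (nxt ed : ℕ → ℕ) : ℕ → List ℕ → Prop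
  | h, [] => h = 0
  | h, e :: r => h ≠ 0 ∧ h ≤ K ∧ ed h = e ∧ Chain K nxt ed (nxt h) r

theorem Chain.le {K : ℕ} {nxt ed : ℕ → ℕ} {h : ℕ} {r : List ℕ} (hc : Chain K nxt ed h r) :
    h ≤ K := by
  cases r with
  | nil => rw [show h = 0 from hc]; exact Nat.zero_le _
  | cons e r => exact hc.2.1

/-- Nodes of an old list are at most `K`, so writing to the fresh node `K + 1` disturbs none of
them. -/
theorem Chain.extend {K : ℕ} {nxt ed : ℕ → ℕ} (a b : ℕ) {r : List ℕ} :
    ∀ {h : ℕ}, Chain K nxt ed h r →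
      Chain (K + 1) (Function.update nxt (K + 1) a) (Function.update ed (K + 1) b) h r := by
  induction r with
  | nil => exact fun hc => hc
  | cons e r ih =>
    rintro h ⟨h1, h2, h3, h4⟩
    refine ⟨h1, by omega, ?_, ?_⟩
    · rw [Function.update_of_ne (by omega), h3]
    · rw [Function.update_of_ne (by omega)]
      exact ih h4

/-- The linked lists in memory: heads in array `8`, links in array `9`, entries in array `10`, and
the parities of the lengths in array `14`; there are `K` nodes in use. -/
structure Nodes (s : Memory) (lst : ℕ → List ℕ) (K : ℕ) : Prop where
  reg : s.reg 25 = K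
  chain : ∀ v, Chain K (s.arr 9) (s.arr 10) (s.arr 8 v) (lst v)
  par : ∀ v, s.arr 14 v = (lst v).length % 2

/-- Prepend the content of register `e` to the list of the vertex in register `v`. -/
def addNode (v e : ℕ) : Prog :=
  block [.add 25 25 2, .store 10 25 e, .load 17 8 v, .store 9 25 17, .store 8 v 25, .load 17 14 v,
    .sub 17 2 17, .store 14 v 17]

theorem ok_addNode {s : Memory} {rv re v e K : ℕ} {lst : ℕ → List ℕ} (hB : Base n off nb s)
    (hv : s.reg rv = v) (he : s.reg re = e) (hrv : rv ≠ 25 ∧ rv ≠ 17) (hre : re ≠ 25 ∧ re ≠ 17)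
    (hN : Nodes s lst K) (hvW : v < W) (heW : e < W) (hKW : K + 2 < W) :
    Ok W (addNode rv re) s (fun t s' =>
      Nodes s' (Function.update lst v (e :: lst v)) (K + 1) ∧ t ≤ 9) := by
  have h8 := (hN.chain v).le
  have h14 := hN.par v
  have h14' : s.arr 14 v < 2 := by omega
  simp only [addNode, ok_block_cons, ok_add, ok_store, ok_load, ok_sub, ok_block_nil, reg_setReg,
    reg_setArr, arr_setReg, arr_setArr, hB.reg_one, hN.reg, hv, he, hrv.1, hrv.2, hre.1, hre.2,
    if_true, if_false, Nat.reduceEqDiff, OfNat.ofNat_ne_one, OfNat.one_ne_ofNat]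
  refine ⟨by omega, by omega, by omega, by omega, by omega, by omega, by omega, by omega, by omega,
    by omega, by omega, by omega, ⟨by simp, ?_, ?_⟩, by omega⟩
  · intro w
    simp only [arr_setArr, arr_setReg, if_true, if_false, Nat.reduceEqDiff]
    by_cases hw : w = v
    · subst hw
      rw [Function.update_self, Function.update_self]
      refine ⟨by omega, le_rfl, by simp, ?_⟩
      rw [Function.update_self]
      exact (hN.chain w).extend _ _
    · rw [Function.update_of_ne hw, Function.update_of_ne hw]
      exact (hN.chain w).extend _ _
  · intro w
    simp only [arr_setArr, arr_setReg, if_true, if_false, Nat.reduceEqDiff]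
    by_cases hw : w = v
    · subst hw
      rw [Function.update_self, Function.update_self, List.length_cons]
      omega
    · rw [Function.update_of_ne hw, Function.update_of_ne hw, hN.par w]

/-- The lists contain the incidences of the edges `0, …, M - 1`. -/
structure Incid (P Q : ℕ → ℕ) (M : ℕ) (lst : ℕ → List ℕ) : Prop where
  mem : ∀ v e, e ∈ lst v ↔ e < M ∧ wt P Q v e ≠ 0
  len : ∀ v, (lst v).length = degIn P Q (Finset.range M) v

theorem Incid.congr {P Q P' Q' : ℕ → ℕ} {M : ℕ} {lst : ℕ → List ℕ} (h : Incid P Q M lst)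
    (hP : ∀ e < M, P' e = P e) (hQ : ∀ e < M, Q' e = Q e) : Incid P' Q' M lst := by
  have hw : ∀ v, ∀ e < M, wt P' Q' v e = wt P Q v e := by
    intro v e he
    rw [wt, wt, hP e he, hQ e he]
  refine ⟨fun v e => ?_, fun v => ?_⟩
  · rw [h.mem]
    refine and_congr_right fun he => ?_
    rw [hw v e he]
  · rw [h.len]
    exact Finset.sum_congr rfl fun e he => (hw v e (Finset.mem_range.1 he)).symm

/-- Enter an edge into the lists of both ends. -/
def addEdge (v w e : ℕ) : Prog := block [addNode v e, addNode w e]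

/-- As the ends differ, the edge enters two different lists, once each; so the lengths stay equal to
the degrees. -/
theorem ok_addEdge {s : Memory} {rv rw re M : ℕ} {lst : ℕ → List ℕ} {P Q : ℕ → ℕ}
    (hB : Base n off nb s)
    (hv : s.reg rv = P M) (hw : s.reg rw = Q M) (he : s.reg re = M) (hrv : rv ≠ 25 ∧ rv ≠ 17)
    (hrw : rw ≠ 25 ∧ rw ≠ 17)
    (hre : re ≠ 25 ∧ re ≠ 17) (hne : P M ≠ Q M)
    (hN : Nodes s lst (2 * M)) (hI : Incid P Q M lst) (hvW : P M < W) (hwW : Q M < W)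
    (hKW : 2 * M + 3 < W) :
    Ok W (addEdge rv rw re) s (fun t s' => ∃ lst',
      Nodes s' lst' (2 * (M + 1)) ∧ Incid P Q (M + 1) lst' ∧ t ≤ 19) := by
  simp only [addEdge, ok_block_cons, ok_block_nil]
  refine (ok_addNode hB hv he hrv hre hN hvW (by omega) (by omega)).frame.mono ?_
  rintro t1 s1 ⟨⟨hN1, ht1⟩, hf1⟩
  have hwr : (addNode rv re).wr = (addNode 0 0).wr := rfl
  have hwa : (addNode rv re).wa = (addNode 0 0).wa := rfl
  rw [hwr, hwa] at hf1
  have hB1 := hB.of_frame hf1 (by decide) (by decide)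
  have hkeep : ∀ r, r ≠ 25 ∧ r ≠ 17 → s1.reg r = s.reg r := fun r hr => by
    refine hf1.1 r ?_
    simp [addNode, block, Prog.wr, hr.1, hr.2]
  refine (ok_addNode hB1 ((hkeep _ hrw).trans hw) ((hkeep _ hre).trans he) hrw hre hN1 hwW
    (by omega) (by omega)).mono ?_
  rintro t2 s2 ⟨hN2, ht2⟩
  refine ⟨_, hN2, ?_, by omega⟩
  have hwt : ∀ v, wt P Q v M = (if v = P M then 1 else 0) + (if v = Q M then 1 else 0) := by
    intro v
    unfold wt
    simp only [eq_comm]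
  rw [Function.update_of_ne hne.symm]
  refine ⟨fun v f => ?_, fun v => ?_⟩
  · have h1 := hI.mem v f
    simp only [Function.update_apply]
    by_cases hfM : f = M
    · subst hfM
      have h2 : f ∉ lst v := by rw [h1]; omega
      rw [hwt]
      split_ifs with h3 h4 h4 <;> simp_all
    · have h3 : f < M + 1 ↔ f < M := by omega
      rw [h3, ← h1]
      split_ifs with h4 h5 <;> simp_all
  · have h1 := hI.len v
    rw [degIn, Finset.sum_range_succ, ← degIn, hwt, ← h1]
    simp only [Function.update_apply]
    split_ifs with h3 h4 h4
    · exact absurd (h4.symm.trans h3) hne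
    · rw [h3]; simp
    · rw [h4]; simp
    · simp

/-- Build the incidence lists of the labels. -/
def linkAll : Prog :=
  block [.const 5 0, .const 25 0, .while (.lt 5 0)
    (block [.load 23 3 5, .load 24 4 5, addEdge 23 24 5, .add 5 5 2])]

theorem ok_linkAll {s : Memory} (hB : Base n off nb s) (hn : 2 * n + 10 < W)
    (hPW : ∀ e < n, s.arr 3 e < W ∧ s.arr 4 e < W) (hne : ∀ e < n, s.arr 3 e ≠ s.arr 4 e)
    (h8 : ∀ v, s.arr 8 v = 0) (h14 : ∀ v, s.arr 14 v = 0) :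
    Ok W linkAll s (fun t s' => ∃ lst, Nodes s' lst (2 * n) ∧
      Incid (s.arr 3) (s.arr 4) n lst ∧ t ≤ 30 * n + 5) := by
  simp only [linkAll, ok_block_cons, ok_const, ok_block_nil]
  refine ⟨by omega, by omega, ?_⟩
  set s1 := (s.setReg 5 0).setReg 25 0 with hs1
  have hfr1 : Frame [5, 25] [] s s1 :=
    (Frame.setReg _ _ (by simp)).trans (Frame.setReg _ _ (by simp))
  refine (Ok.while (γ := ℕ) (fun i s' => i ≤ n ∧ s'.reg 5 = i ∧ Base n off nb s' ∧
      s'.arr 3 = s.arr 3 ∧ s'.arr 4 = s.arr 4 ∧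
      ∃ lst, Nodes s' lst (2 * i) ∧ Incid (s.arr 3) (s.arr 4) i lst)
    (fun i => 30 * (n - i)) ?_ 0 s1 ?_).mono ?_
  · rintro i s2 ⟨h1, h2, hB2, h3, h4, lst, hN, hI⟩ hb
    rw [holds_lt, h2, hB2.reg_n] at hb
    have hW := hPW i hb
    simp only [ok_block_cons, ok_load, ok_block_nil, reg_setReg, arr_setReg, h2, h3, h4, if_true,
      if_false, Nat.reduceEqDiff]
    refine ⟨hW.1, hW.2, ?_⟩
    set s3 := (s2.setReg 23 (s.arr 3 i)).setReg 24 (s.arr 4 i) with hs3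
    have hfr3 : Frame [23, 24] [] s2 s3 :=
      (Frame.setReg _ _ (by simp)).trans (Frame.setReg _ _ (by simp))
    have hB3 := hB2.of_frame hfr3 (by decide) (by decide)
    refine (ok_addEdge (P := s.arr 3) (Q := s.arr 4) (M := i) (lst := lst) hB3 (by simp [hs3])
      (by simp [hs3]) (by simp [hs3, h2])
      (by decide) (by decide) (by decide) (hne i hb) ⟨by simp [hs3, hN.reg], hN.chain, hN.par⟩ hI hW.1 hW.2
      (by omega)).frame.mono ?_
    rintro t s4 ⟨⟨lst', hN', hI', ht⟩, hf4⟩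
    have hB4 := hB3.of_frame hf4 (by decide) (by decide)
    have e5 : s4.reg 5 = i := by rw [hf4.1 5 (by decide)]; simp [hs3, h2]
    simp only [ok_add, ok_block_nil, e5, hB4.reg_one]
    refine ⟨by omega, i + 1, ⟨by omega, by simp, ?_, ?_, ?_, lst', ⟨?_, hN'.chain, hN'.par⟩, hI'⟩,
      by omega⟩
    · exact hB4.of_frame (R := [5]) (A := []) (Frame.setReg _ _ (by simp)) (by decide) (by decide)
    · rw [arr_setReg, hf4.2 3 (by decide)]; simp [hs3, h3]
    · rw [arr_setReg, hf4.2 4 (by decide)]; simp [hs3, h4]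
    · simp [hN'.reg]
  · refine ⟨Nat.zero_le _, by simp [hs1], hB.of_frame hfr1 (by decide) (by decide), by simp [hs1],
      by simp [hs1], fun _ => [], ⟨by simp [hs1], fun v => ?_, fun v => ?_⟩, ?_⟩
    · simp [hs1, Chain, h8]
    · simp [hs1, h14]
    · exact ⟨by simp, by simp [degIn]⟩
  · rintro t s' ⟨i, ⟨h1, h2, hB2, h3, h4, lst, hN, hI⟩, hb, ht⟩
    rw [holds_lt, h2, hB2.reg_n] at hb
    obtain rfl : i = n := by omega
    exact ⟨lst, hN, hI, by omega⟩

/-- Add an edge to the vertex `0` at every vertex of odd degree. -/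
def pairOdd : Prog :=
  block [.add 27 6 2, .add 26 0 1, .const 5 1, .while (.lt 5 27)
    (block [.load 17 14 5, .ite (.eq 17 2) (block [.store 3 26 5, addEdge 5 1 26, .add 26 26 2])
      .skip, .add 5 5 2])]

/-- An auxiliary edge at `i` changes degrees only at `i` and at `0`, so the parity seen when `i` is
visited is final up to the edge added there. The second ends are never written: by `hQ0` they are
`0` already, which is the auxiliary vertex. -/
theorem ok_pairOdd {s : Memory} {L : ℕ} {lst : ℕ → List ℕ} (hB : Base n off nb s)
    (hW : 2 * n + 2 * L + 10 < W) (hL : s.reg 6 = L)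
    (hP : ∀ e < n, 1 ≤ s.arr 3 e ∧ s.arr 3 e ≤ L ∧ 1 ≤ s.arr 4 e ∧ s.arr 4 e ≤ L)
    (hne : ∀ e < n, s.arr 3 e ≠ s.arr 4 e) (hQ0 : ∀ e, n ≤ e → s.arr 4 e = 0)
    (hN : Nodes s lst (2 * n)) (hI : Incid (s.arr 3) (s.arr 4) n lst) :
    Ok W pairOdd s (fun t s' => ∃ M lst', M ≤ n + L ∧
      EdgeData n M L (s'.arr 3) (s'.arr 4) ∧ (∀ e < n, s'.arr 3 e = s.arr 3 e) ∧
      Nodes s' lst' (2 * M) ∧ Incid (s'.arr 3) (s'.arr 4) M lst' ∧ s'.reg 27 = L + 1 ∧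
      t ≤ 40 * L + 10) := by
  simp only [pairOdd, ok_block_cons, ok_const, ok_block_nil, ok_add, reg_setReg, hL, hB.reg_one,
    hB.reg_n, hB.reg_zero, if_true, if_false, Nat.reduceEqDiff, OfNat.one_ne_ofNat,
    OfNat.zero_ne_ofNat, Nat.add_zero]
  refine ⟨by omega, by omega, by omega, ?_⟩
  set s1 := ((s.setReg 27 (L + 1)).setReg 26 n).setReg 5 1 with hs1
  have hfr1 : Frame [27, 26, 5] [] s s1 :=
    ((Frame.setReg _ _ (by simp)).trans (Frame.setReg _ _ (by simp))).trans
      (Frame.setReg _ _ (by simp))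
  refine (Ok.while (γ := ℕ) (fun i s' => 1 ≤ i ∧ i ≤ L + 1 ∧ s'.reg 5 = i ∧ Base n off nb s' ∧
      s'.arr 4 = s.arr 4 ∧ s'.reg 27 = L + 1 ∧ (∀ e < n, s'.arr 3 e = s.arr 3 e) ∧
      ∃ M lst, n ≤ M ∧ M + 1 ≤ n + i ∧ s'.reg 26 = M ∧ Nodes s' lst (2 * M) ∧
        Incid (s'.arr 3) (s.arr 4) M lst ∧
        (∀ e, n ≤ e → e < M → 1 ≤ s'.arr 3 e ∧ s'.arr 3 e < i) ∧
        (∀ v, 1 ≤ v → extra n (s'.arr 3) (s.arr 4) (Finset.range M) v ≤ 1) ∧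
        (∀ v, 1 ≤ v → v < i → Even (degIn (s'.arr 3) (s.arr 4) (Finset.range M) v)))
    (fun i => 40 * (L + 1 - i)) ?_ 1 s1 ?_).mono ?_
  · rintro i s2 ⟨h0, h1, h2, hB2, h4, h27, h3, M, lst, hnM, hM, h26, hN, hI, hdum, hex, hev⟩ hb
    rw [holds_lt, h2, h27] at hb
    have hpar := hN.par i
    simp only [ok_block_cons, ok_load, ok_block_nil, reg_setReg, arr_setReg, h2, if_true,
      if_false, Nat.reduceEqDiff, ok_ite_eq, hB2.reg_one, ok_store, ok_skip,
      ok_add, OfNat.ofNat_ne_one, OfNat.one_ne_ofNat, h26]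
    refine ⟨by omega, fun hodd => ⟨by omega, by omega, ?_⟩, fun hodd => ⟨by omega, ?_⟩⟩
    · set s3 := (s2.setReg 17 (s2.arr 14 i)).setArr 3 M i with hs3
      have hfr3 : Frame [17] [3] s2 s3 :=
        (Frame.setReg _ _ (by simp)).trans (Frame.setArr _ _ _ (by simp))
      have hB3 := hB2.of_frame hfr3 (by decide) (by decide)
      have ha3 : s3.arr 3 = Function.update (s2.arr 3) M i := by simp [hs3]
      have hlow : ∀ e < M, s3.arr 3 e = s2.arr 3 e := fun e he => by
        rw [ha3, Function.update_of_ne (by omega)]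
      have hM3 : s3.arr 3 M = i := by rw [ha3, Function.update_self]
      have hQM := hQ0 M hnM
      refine (ok_addEdge (P := s3.arr 3) (Q := s.arr 4) (M := M) (lst := lst) hB3
        (by rw [hM3]; simp [hs3, h2])
        (by rw [hQM, hB3.reg_zero]) (by simp [hs3, h26])
        (by decide) (by decide) (by decide) (by omega)
        ⟨by simp [hs3, hN.reg], by simpa [hs3] using hN.chain, by simpa [hs3] using hN.par⟩
        (hI.congr hlow (fun _ _ => rfl)) (by omega) (by omega) (by omega)).frame.mono ?_
      rintro t s4 ⟨⟨lst', hN', hI', ht⟩, hf4⟩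
      have hB4 := hB3.of_frame hf4 (by decide) (by decide)
      have e5 : s4.reg 5 = i := by rw [hf4.1 5 (by decide)]; simp [hs3, h2]
      have e26 : s4.reg 26 = M := by rw [hf4.1 26 (by decide)]; simp [hs3, h26]
      have e27 : s4.reg 27 = L + 1 := by rw [hf4.1 27 (by decide)]; simp [hs3, h27]
      have e4 : s4.arr 4 = s.arr 4 := by rw [hf4.2 4 (by decide)]; simp [hs3, h4]
      have e3 : s4.arr 3 = s3.arr 3 := hf4.2 3 (by decide)
      have hwM : ∀ v, 1 ≤ v → wt (s3.arr 3) (s.arr 4) v M = if v = i then 1 else 0 := by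
        intro v hv
        unfold wt
        rw [hM3, hQM, if_neg (by omega : ¬ 0 = v)]
        simp only [eq_comm, Nat.add_zero]
      have hwlow : ∀ v, ∀ e < M, wt (s3.arr 3) (s.arr 4) v e = wt (s2.arr 3) (s.arr 4) v e := by
        intro v e he
        rw [wt, wt, hlow e he]
      have hdeg : ∀ v, 1 ≤ v → degIn (s3.arr 3) (s.arr 4) (Finset.range (M + 1)) v =
          degIn (s2.arr 3) (s.arr 4) (Finset.range M) v + if v = i then 1 else 0 := by
        intro v hv
        rw [degIn, Finset.sum_range_succ, hwM v hv, degIn]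
        congr 1
        exact Finset.sum_congr rfl fun e he => hwlow v e (Finset.mem_range.1 he)
      have hext : ∀ v, 1 ≤ v → extra n (s3.arr 3) (s.arr 4) (Finset.range (M + 1)) v =
          extra n (s2.arr 3) (s.arr 4) (Finset.range M) v + if v = i then 1 else 0 := by
        intro v hv
        rw [extra, Finset.range_add_one, Finset.filter_insert, if_pos (by omega),
          Finset.sum_insert (by simp), hwM v hv, extra, add_comm]
        congr 1
        exact Finset.sum_congr rfl fun e he =>
          hwlow v e (Finset.mem_range.1 (Finset.mem_filter.1 he).1)
      simp only [ok_add, ok_block_nil, e26, hB4.reg_one, reg_setReg, e5, if_true, if_false,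
        Nat.reduceEqDiff, OfNat.ofNat_ne_one]
      refine ⟨by omega, by omega, i + 1, ⟨by omega, by omega, by simp, ?_, ?_, ?_, ?_, M + 1,
        lst', by omega, by omega, by simp, ⟨?_, hN'.chain, hN'.par⟩, ?_, ?_, ?_, ?_⟩, by omega⟩
      · exact hB4.of_frame (R := [26, 5]) (A := [])
          ((Frame.setReg _ _ (by simp)).trans (Frame.setReg _ _ (by simp))) (by decide) (by decide)
      · simpa using e4
      · simpa using e27
      · intro e he
        simp only [arr_setReg, e3]
        rw [hlow e (by omega), h3 e he]
      · simp [hN'.reg]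
      · simpa [e3] using hI'
      · intro e he1 he2
        simp only [arr_setReg, e3]
        rcases Nat.lt_succ_iff_lt_or_eq.1 he2 with h5 | rfl
        · rw [hlow e h5]
          have := hdum e he1 h5
          omega
        · rw [hM3]; omega
      · intro v hv
        simp only [arr_setReg, e3]
        rw [hext v hv]
        have := hex v hv
        split_ifs with hvi
        -- Earlier auxiliary edges end below `i`, so `i` has none so far.
        · have hz : extra n (s2.arr 3) (s.arr 4) (Finset.range M) v = 0 := by
            refine Finset.sum_eq_zero fun e he => ?_
            rw [Finset.mem_filter, Finset.mem_range] at he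
            have h5 := hdum e (by omega) he.1
            unfold wt
            rw [if_neg (by omega), hQ0 e (by omega), if_neg (by omega), Nat.add_zero]
          omega
        · omega
      · intro v hv hvi
        simp only [arr_setReg, e3]
        rw [hdeg v hv]
        rcases Nat.lt_succ_iff_lt_or_eq.1 hvi with h5 | rfl
        · rw [if_neg (by omega)]
          exact hev v hv h5
        · rw [if_pos rfl, ← hI.len, Nat.even_iff]
          omega
    · refine ⟨i + 1, ⟨by omega, by omega, by simp, ?_, h4, by simpa using h27, h3, M,
        lst, hnM, by omega, by simp [h26], ⟨?_, hN.chain, hN.par⟩, hI, ?_, hex, ?_⟩, by omega⟩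
      · exact hB2.of_frame (R := [17, 5]) (A := [])
          ((Frame.setReg _ _ (by simp)).trans (Frame.setReg _ _ (by simp))) (by decide) (by decide)
      · simp [hN.reg]
      · intro e he1 he2
        have := hdum e he1 he2
        change 1 ≤ s2.arr 3 e ∧ s2.arr 3 e < i + 1
        omega
      · intro v hv hvi
        rcases Nat.lt_succ_iff_lt_or_eq.1 hvi with h5 | rfl
        · exact hev v hv h5
        · rw [← hI.len, Nat.even_iff]
          omega
  · refine ⟨le_rfl, by omega, by simp [hs1], hB.of_frame hfr1 (by decide) (by decide),
      by simp [hs1], by simp [hs1], by simp [hs1], n, lst, le_rfl, le_rfl, by simp [hs1],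
      ⟨by simp [hs1, hN.reg], by simpa [hs1] using hN.chain, by simpa [hs1] using hN.par⟩,
      by simpa [hs1] using hI, by omega, ?_, by omega⟩
    intro v _
    have : (Finset.range n).filter (fun e => ¬ e < n) = ∅ := by
      rw [Finset.filter_eq_empty_iff]
      intro e he
      simpa using he
    rw [extra, this]
    simp
  · rintro t s' ⟨i, ⟨h0, h1, h2, hB2, h4, h27, h3, M, lst, hnM, hM, h26, hN, hI, hdum, hex, hev⟩,
      hb, ht⟩
    rw [holds_lt, h2, h27] at hb
    obtain rfl : i = L + 1 := by omega
    have hends : ∀ e < M, s'.arr 3 e ≤ L ∧ s.arr 4 e ≤ L := by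
      intro e he
      rcases Nat.lt_or_ge e n with h5 | h5
      · rw [h3 e h5]
        have := hP e h5
        omega
      · have := hdum e h5 he
        rw [hQ0 e h5]
        omega
    have hev' : ∀ v, 1 ≤ v → Even (degIn (s'.arr 3) (s.arr 4) (Finset.range M) v) := by
      intro v hv
      rcases Nat.lt_or_ge v (L + 1) with h5 | h5
      · exact hev v hv h5
      · have : degIn (s'.arr 3) (s.arr 4) (Finset.range M) v = 0 := by
          refine degIn_eq_zero.2 fun e he => ?_
          have := hends e (Finset.mem_range.1 he)
          unfold wt
          rw [if_neg (by omega), if_neg (by omega)]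
        rw [this]
        exact Even.zero
    refine ⟨M, lst, by omega, ⟨hnM, ?_, ?_, ?_, ?_, ?_⟩, h3, hN, ?_, h27, by omega⟩
    · intro e he
      rw [h3 e he, h4]
      exact hP e he
    · intro e he1 he2
      rw [h4, hQ0 e he1]
      have := hdum e he1 he2
      omega
    · intro e he
      rw [h4]
      rcases Nat.lt_or_ge e n with h5 | h5
      · rw [h3 e h5]; exact hne e h5
      · rw [hQ0 e h5]
        have := hdum e h5 he
        omega
    · rw [h4]; exact hex
    · rw [h4]
      intro v
      rcases Nat.eq_zero_or_pos v with rfl | hv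
      -- At the vertex `0` evenness comes for free from the handshake lemma.
      · exact even_degIn_zero hends hev'
      · exact hev' v hv
    · rw [h4]; exact hI

end Link

end RAM

namespace RAM

/-! ### Hierholzer's algorithm -/

section Hierholzer

variable {n M L W : ℕ} {off nb P Q : ℕ → ℕ} {U₀ U S : Finset ℕ} {v₀ b₀ c : ℕ} {x₀ : ℕ → ℕ}
  {stk : List (ℕ × ℕ)} {lst : ℕ → List ℕ}

/-- The stack is stored in two arrays, from the bottom to the top, starting at index `1`. -/
def StackIn (V E : ℕ → ℕ) : List (ℕ × ℕ) → Prop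
  | [] => True
  | a :: r => V (r.length + 1) = a.1 ∧ E (r.length + 1) = a.2 ∧ StackIn V E r

theorem StackIn.update {V E : ℕ → ℕ} (a b : ℕ) {r : List (ℕ × ℕ)} :
    ∀ {k : ℕ}, r.length < k → StackIn V E r →
      StackIn (Function.update V k a) (Function.update E k b) r := by
  induction r with
  | nil => exact fun _ _ => trivial
  | cons p r ih =>
    rintro k hk ⟨h1, h2, h3⟩
    rw [List.length_cons] at hk
    refine ⟨?_, ?_, ih (by omega) h3⟩
    · rw [Function.update_of_ne (by omega), h1]
    · rw [Function.update_of_ne (by omega), h2]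

/-- The linked lists `lst v` contain the edges at `v` in `U`, and array `11` marks the edges that
are not in `U`. -/
structure Lists (P Q : ℕ → ℕ) (M : ℕ) (lst : ℕ → List ℕ) (U : Finset ℕ) (s : Memory) : Prop where
  chain : ∀ v, Chain (2 * M) (s.arr 9) (s.arr 10) (s.arr 8 v) (lst v)
  mem : ∀ v, ∀ e ∈ lst v, e < M ∧ wt P Q v e ≠ 0
  unused : ∀ v, ∀ e ∈ U, wt P Q v e ≠ 0 → e ∈ lst v
  mark : ∀ e < M, s.arr 11 e = if e ∈ U then 0 else 1

/-- Invariant of the inner loop of Hierholzer's algorithm. -/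
structure Hier (n M L : ℕ) (off nb P Q : ℕ → ℕ) (U₀ : Finset ℕ) (v₀ : ℕ) (x₀ : ℕ → ℕ) (b₀ : ℕ)
    (U S : Finset ℕ) (stk : List (ℕ × ℕ)) (c : ℕ) (lst : ℕ → List ℕ) (s : Memory) : Prop where
  base : Base n off nb s
  p_eq : s.arr 3 = P
  q_eq : s.arr 4 = Q
  tour : Tour n P Q U₀ v₀ x₀ b₀ U S stk c (s.arr 2) (s.reg 28)
  lists : Lists P Q M lst U s
  stack : StackIn (s.arr 12) (s.arr 13) stk
  len : s.reg 10 = stk.length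
  le : ∀ a ∈ stk, a.1 ≤ L ∧ a.2 ≤ M

/-- The potential of the inner loop. -/
def hierPot (L : ℕ) (stk : List (ℕ × ℕ)) (lst : ℕ → List ℕ) : ℕ :=
  60 * ∑ v ∈ Finset.range (L + 1), (lst v).length + 20 * stk.length

/-- The stack is empty or the top vertex is in register `20`, and it has no unused edge: remove it,
and colour its edge. -/
def hierPop : Prog :=
  block [.load 18 13 10, .sub 10 10 2,
    .ite (.lt 18 0) (block [.store 2 18 28, .sub 28 2 28]) .skip]

/-- Remove the node in register `17` from the list of the vertex in register `20`, and follow its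
edge if it is unused. -/
def hierPush : Prog :=
  block [.load 18 9 17, .store 8 20 18, .load 18 10 17, .load 19 11 18,
    .ite (.eq 19 1) (block [.store 11 18 2, .load 16 3 18, .load 19 4 18, .add 16 16 19,
      .sub 16 16 20, .add 10 10 2, .store 12 10 16, .store 13 10 18]) .skip]

/-- One step of Hierholzer's algorithm. -/
def hier : Prog :=
  block [.load 20 12 10, .load 17 8 20, .ite (.eq 17 1) hierPop hierPush]

theorem _root_.Tour.length_le {U₀ U S : Finset ℕ} {x : ℕ → ℕ} {b : ℕ}
    (h : Tour n P Q U₀ v₀ x₀ b₀ U S stk c x b) (hU : U₀ ⊆ Finset.range M) :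
    stk.length ≤ M + 1 := by
  have h1 : (stackEdges stk).length ≤ M := by
    have := h.nodup.subperm (l₂ := List.range M) (fun e he =>
      List.mem_range.2 (Finset.mem_range.1 (hU ((h.mem_stack e).1 he).1)))
    simpa using this.length_le
  simp only [stackEdges, List.length_map, List.length_dropLast] at h1
  omega

theorem sum_length_tail {v : ℕ} (hv : v ≤ L) {e : ℕ} {r : List ℕ} (h : lst v = e :: r) :
    ∑ u ∈ Finset.range (L + 1), (Function.update lst v r u).length + 1 =
      ∑ u ∈ Finset.range (L + 1), (lst u).length := by
  have hv' : v ∈ Finset.range (L + 1) := Finset.mem_range.2 (by omega)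
  rw [← Finset.sum_erase_add _ _ hv', ← Finset.sum_erase_add _ (fun u => (lst u).length) hv',
    Function.update_self, h, List.length_cons, add_assoc]
  congr 1
  exact Finset.sum_congr rfl fun u hu => by
    rw [Function.update_of_ne (Finset.ne_of_mem_erase hu)]

theorem ok_hierPop {s : Memory} {v k : ℕ} {r : List (ℕ × ℕ)}
    (h : Hier n M L off nb P Q U₀ v₀ x₀ b₀ U S ((v, k) :: r) c lst s) (hn : n ≤ M)
    (hW : 2 * M + 2 * L + 10 < W) (hlen : r.length ≤ M) (hv : lst v = []) :
    Ok W hierPop s (fun t s' => ∃ S' c',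
      Hier n M L off nb P Q U₀ v₀ x₀ b₀ U S' r c' lst s' ∧ t ≤ 9) := by
  have h0 : degIn P Q U v = 0 := by
    rw [degIn_eq_zero]
    intro e he
    by_contra hne
    have := h.lists.unused v e he hne
    rw [hv] at this
    simp at this
  have hb := h.tour.b_le
  have hl := h.len
  obtain ⟨hs1, hs2, hs3⟩ := h.stack
  rw [List.length_cons] at hl
  have hle := h.le (v, k) (by simp)
  dsimp only at hle hs1 hs2
  have hle' : ∀ a ∈ r, a.1 ≤ L ∧ a.2 ≤ M := fun a ha => h.le a (List.mem_cons_of_mem _ ha)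
  simp only [hierPop, ok_block_cons, ok_load, ok_sub, ok_ite_lt, ok_store, ok_skip, ok_block_nil,
    reg_setReg, arr_setReg, reg_setArr, arr_setArr, hl, hs2, h.base.reg_one, h.base.reg_n, if_true,
    if_false, Nat.reduceEqDiff, OfNat.zero_ne_ofNat, OfNat.ofNat_ne_one, OfNat.one_ne_ofNat]
  refine ⟨by omega, by omega, fun hk => ⟨by omega, by omega, by omega, ?_⟩, fun hk => ?_⟩
  · cases r with
    -- The bottom entry carries a number that is at least `n`, so it is never coloured.
    | nil => exact absurd h.tour.linked.2 (by simpa using hk)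
    | cons a r =>
      have ht := h.tour.pop h0
      rw [if_pos hk, if_pos hk] at ht
      refine ⟨insert k S, a.1, ⟨?_, ?_, ?_, ?_, ?_, ?_, ?_, hle'⟩, by omega⟩
      · refine h.base.of_frame (R := [18, 10, 28]) (A := [2]) ?_ (by decide) (by decide)
        exact ⟨fun r hr => by simp_all, fun a ha => by simp_all⟩
      · simpa using h.p_eq
      · simpa using h.q_eq
      · simpa using ht
      · exact ⟨by simpa using h.lists.chain, h.lists.mem, h.lists.unused,
          by simpa using h.lists.mark⟩
      · simpa using hs3
      · simp
  · have hfr : Base n off nb ((s.setReg 18 k).setReg 10 (r.length + 1 - 1)) := by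
      refine h.base.of_frame (R := [18, 10]) (A := []) ?_ (by decide) (by decide)
      exact ⟨fun r hr => by simp_all, fun a ha => by simp_all⟩
    cases r with
    | nil =>
      refine ⟨S, c, ⟨hfr, h.p_eq, h.q_eq, ?_, ⟨h.lists.chain, h.lists.mem, h.lists.unused,
        h.lists.mark⟩, trivial, by simp, hle'⟩, by omega⟩
      simpa using h.tour.pop_last h0
    | cons a r =>
      have ht := h.tour.pop h0
      rw [if_neg hk, if_neg hk] at ht
      refine ⟨insert k S, a.1, ⟨hfr, h.p_eq, h.q_eq, ?_, ⟨h.lists.chain, h.lists.mem,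
        h.lists.unused, h.lists.mark⟩, hs3, by simp, hle'⟩, by omega⟩
      simpa using ht

/-- Deletion is lazy: an edge is listed at both ends, and after its use from one end the entry at
the other end stays until it is met and discarded because of its mark. A list node is dropped in
either case, which pays for the step. -/
theorem ok_hierPush {s : Memory} {v k e : ℕ} {r : List (ℕ × ℕ)} {l : List ℕ}
    (h : Hier n M L off nb P Q U₀ v₀ x₀ b₀ U S ((v, k) :: r) c lst s)
    (hends : ∀ e < M, P e ≤ L ∧ Q e ≤ L)
    (hW : 2 * M + 2 * L + 10 < W) (hlen : r.length ≤ M) (hv : lst v = e :: l)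
    (h20 : s.reg 20 = v) (h17 : s.reg 17 = s.arr 8 v) :
    Ok W hierPush s (fun t s' => ∃ U' stk',
      Hier n M L off nb P Q U₀ v₀ x₀ b₀ U' S stk' c (Function.update lst v l) s' ∧
      stk'.length ≤ r.length + 2 ∧ t ≤ 20) := by
  have hch := h.lists.chain v
  rw [hv] at hch
  obtain ⟨hc1, hc2, hc3, hc4⟩ := hch
  have hc5 := hc4.le
  obtain ⟨heM, hew⟩ := h.lists.mem v e (by rw [hv]; simp)
  have hmk := h.lists.mark e heM
  have hl := h.len
  rw [List.length_cons] at hl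
  have hle := h.le (v, k) (by simp)
  dsimp only at hle
  have hends' := hends e heM
  have hmem : ∀ u, ∀ f ∈ Function.update lst v l u, f < M ∧ wt P Q u f ≠ 0 := by
    intro u f hf
    by_cases huv : u = v
    · subst huv
      rw [Function.update_self] at hf
      exact h.lists.mem u f (by rw [hv]; exact List.mem_cons_of_mem _ hf)
    · rw [Function.update_of_ne huv] at hf
      exact h.lists.mem u f hf
  have hchain : ∀ u, Chain (2 * M) (s.arr 9) (s.arr 10)
      (Function.update (s.arr 8) v (s.arr 9 (s.arr 8 v)) u) (Function.update lst v l u) := by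
    intro u
    by_cases huv : u = v
    · subst huv
      rw [Function.update_self, Function.update_self]
      exact hc4
    · rw [Function.update_of_ne huv, Function.update_of_ne huv]
      exact h.lists.chain u
  have hun : ∀ u, ∀ f ∈ U, f ≠ e → wt P Q u f ≠ 0 → f ∈ Function.update lst v l u := by
    intro u f hf hfe hw
    have h1 := h.lists.unused u f hf hw
    by_cases huv : u = v
    · subst huv
      rw [hv, List.mem_cons] at h1
      rw [Function.update_self]
      tauto
    · rw [Function.update_of_ne huv]
      exact h1
  simp only [hierPush, ok_block_cons, ok_load, ok_sub, ok_add, ok_ite_eq, ok_store, ok_skip,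
    ok_block_nil, reg_setReg, arr_setReg, reg_setArr, arr_setArr, hl, h20, h17, hc3, hmk,
    h.base.reg_one, h.base.reg_zero, h.p_eq, h.q_eq, if_true, if_false, Nat.reduceEqDiff,
    OfNat.ofNat_ne_one, OfNat.one_ne_ofNat]
  refine ⟨by omega, by omega, by omega, by omega, by split_ifs <;> omega, fun hU => ?_,
    fun hU => ?_⟩
  · have heU : e ∈ U := by by_contra hne; simp [hne] at hU
    refine ⟨by omega, by omega, by omega, by omega, by omega, by omega, by omega, by omega, by omega,
      by omega, by omega, U.erase e, (P e + Q e - v, e) :: (v, k) :: r,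
      ⟨?_, ?_, ?_, ?_, ⟨?_, hmem, ?_, ?_⟩, ?_, ?_, ?_⟩, by simp, by omega⟩
    · refine h.base.of_frame (R := [18, 19, 16, 10]) (A := [8, 11, 12, 13]) ?_ (by decide)
        (by decide)
      exact ⟨fun r hr => by simp_all, fun a ha => by simp_all⟩
    · simpa using h.p_eq
    · simpa using h.q_eq
    -- `P e + Q e - v` is the end of `e` other than `v`, found without a branch.
    · have hj : Joins P Q e (P e + Q e - v) v := by
        rcases wt_pos_iff.1 hew with h1 | h1
        · right; constructor <;> omega
        · left; constructor <;> omega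
      simpa using h.tour.push heU hj
    · simpa using hchain
    · intro u f hf hw
      rw [Finset.mem_erase] at hf
      exact hun u f hf.2 hf.1 hw
    · intro f hf
      have := h.lists.mark f hf
      simp only [arr_setArr, arr_setReg, if_true, if_false, Nat.reduceEqDiff, Finset.mem_erase]
      by_cases hfe : f = e
      · simp [hfe]
      · simp [hfe, this]
    · simp only [arr_setArr, arr_setReg, if_true, if_false, Nat.reduceEqDiff]
      exact ⟨by simp, by simp, h.stack.update _ _ (by simp)⟩
    · simp
    · intro a ha
      rcases List.mem_cons.1 ha with rfl | ha
      · dsimp only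
        rcases wt_pos_iff.1 hew with h1 | h1 <;> omega
      · exact h.le a ha
  · have heU : e ∉ U := by intro hne; simp [hne] at hU
    refine ⟨U, (v, k) :: r, ⟨?_, ?_, ?_, ?_, ⟨?_, hmem, ?_, ?_⟩, ?_, ?_, h.le⟩, by simp, by omega⟩
    · refine h.base.of_frame (R := [18, 19]) (A := [8]) ?_ (by decide) (by decide)
      exact ⟨fun r hr => by simp_all, fun a ha => by simp_all⟩
    · simpa using h.p_eq
    · simpa using h.q_eq
    · simpa using h.tour
    · simpa using hchain
    · intro u f hf hw
      exact hun u f hf (by rintro rfl; exact heU hf) hw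
    · simpa using h.lists.mark
    · simpa using h.stack
    · simpa using hl

/-- A pop releases the `20` of its stack entry. Handling a list node releases `60`, of which `20` go
to a possible new stack entry and the rest covers the time. -/
theorem ok_hier {s : Memory} {a : ℕ × ℕ} {r : List (ℕ × ℕ)}
    (h : Hier n M L off nb P Q U₀ v₀ x₀ b₀ U S (a :: r) c lst s) (hn : n ≤ M)
    (hU : U₀ ⊆ Finset.range M)
    (hends : ∀ e < M, P e ≤ L ∧ Q e ≤ L) (hW : 2 * M + 2 * L + 10 < W) :
    Ok W hier s (fun t s' => ∃ U' S' stk' c' lst',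
      Hier n M L off nb P Q U₀ v₀ x₀ b₀ U' S' stk' c' lst' s' ∧
      t + 1 + hierPot L stk' lst' ≤ hierPot L (a :: r) lst) := by
  obtain ⟨v, k⟩ := a
  have hlen := h.tour.length_le hU
  rw [List.length_cons] at hlen
  have hs1 := h.stack.1
  have hl := h.len
  have hle := h.le (v, k) (by simp)
  dsimp only at hs1 hle
  rw [List.length_cons] at hl
  have hch := (h.lists.chain v).le
  simp only [hier, ok_block_cons, ok_load, ok_ite_eq, ok_block_nil, reg_setReg, arr_setReg, hl, hs1,
    h.base.reg_zero, if_true, if_false, Nat.reduceEqDiff, OfNat.one_ne_ofNat]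
  refine ⟨by omega, by omega, ?_⟩
  have h1 : Hier n M L off nb P Q U₀ v₀ x₀ b₀ U S ((v, k) :: r) c lst
      ((s.setReg 20 v).setReg 17 (s.arr 8 v)) := by
    refine ⟨?_, h.p_eq, h.q_eq, ?_, ⟨h.lists.chain, h.lists.mem, h.lists.unused, h.lists.mark⟩,
      h.stack, ?_, h.le⟩
    · refine h.base.of_frame (R := [20, 17]) (A := []) ?_ (by decide) (by decide)
      exact ⟨fun r hr => by simp_all, fun a ha => by simp_all⟩
    · simpa using h.tour
    · simpa using hl
  rcases hlv : lst v with _ | ⟨e, l⟩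
  · have h0 : s.arr 8 v = 0 := by
      have := h.lists.chain v
      rwa [hlv] at this
    refine ⟨fun _ => ?_, fun hne => absurd h0 hne⟩
    refine (ok_hierPop h1 hn hW (by omega) hlv).mono ?_
    rintro t s' ⟨S', c', h2, ht⟩
    refine ⟨U, S', r, c', lst, h2, ?_⟩
    simp only [hierPot, List.length_cons]
    omega
  · have h0 : s.arr 8 v ≠ 0 := by
      have := h.lists.chain v
      rw [hlv] at this
      exact this.1
    refine ⟨fun heq => absurd heq h0, fun _ => ?_⟩
    refine (ok_hierPush h1 hends hW (by omega) hlv (by simp) (by simp)).mono ?_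
    rintro t s' ⟨U', stk', h2, h3, ht⟩
    refine ⟨U', S, stk', c, _, h2, ?_⟩
    have := sum_length_tail hle.1 hlv
    simp only [hierPot, List.length_cons]
    omega

/-- Run Hierholzer's algorithm from all vertices `0, …, L`; `L + 1` is in register `27`. -/
def tours : Prog :=
  block [.const 5 0, .const 28 0, .while (.lt 5 27)
    (block [.store 12 2 5, .store 13 2 0, .add 10 2 1, .while (.lt 1 10) hier, .add 5 5 2])]

/-- The start `0` comes first, so that the auxiliary edges are gone before any other tour begins.
All tours consume the same `2M` list nodes, which gives `60 * 2M` in total. -/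
theorem ok_tours {s : Memory} (hB : Base n off nb s) (hd : EdgeData n M L (s.arr 3) (s.arr 4))
    (hW : 2 * M + 2 * L + 10 < W) (h27 : s.reg 27 = L + 1) (hN : Nodes s lst (2 * M))
    (hI : Incid (s.arr 3) (s.arr 4) M lst) (h2 : ∀ e, s.arr 2 e = 0) (h11 : ∀ e, s.arr 11 e = 0) :
    Ok W tours s (fun t s' =>
      (∃ x b, Toured n M L (s.arr 3) (s.arr 4) (L + 1) ∅ x b ∧ s'.arr 2 = x) ∧
      t ≤ 120 * M + 40 * (L + 1) + 5) := by
  have hends : ∀ e < M, s.arr 3 e ≤ L ∧ s.arr 4 e ≤ L := by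
    intro e he
    rcases Nat.lt_or_ge e n with h5 | h5
    · have := hd.ends e h5; omega
    · have := hd.dummy e h5 he; omega
  have hnM := hd.le
  simp only [tours, ok_block_cons, ok_const, ok_block_nil]
  refine ⟨by omega, by omega, ?_⟩
  set s1 := (s.setReg 5 0).setReg 28 0 with hs1
  refine (Ok.while (γ := ℕ × Finset ℕ × (ℕ → List ℕ)) (fun g s' => g.1 ≤ L + 1 ∧
      s'.reg 5 = g.1 ∧ s'.reg 27 = L + 1 ∧ Base n off nb s' ∧ s'.arr 3 = s.arr 3 ∧
      s'.arr 4 = s.arr 4 ∧ Lists (s.arr 3) (s.arr 4) M g.2.2 g.2.1 s' ∧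
      Toured n M L (s.arr 3) (s.arr 4) g.1 g.2.1 (s'.arr 2) (s'.reg 28))
    -- The `40` for each start covers the outer loop and the potential `20` of the bottom stack
    -- entry.
    (fun g => hierPot L [] g.2.2 + 40 * (L + 1 - g.1)) ?_ (0, Finset.range M, lst) s1 ?_).mono ?_
  · rintro ⟨i, U₀, lst₀⟩ s2 ⟨g1, g2, g3, hB2, g4, g5, g6, g7⟩ hb
    dsimp only at g1 g2 g6 g7
    rw [holds_lt, g2, g3] at hb
    simp only [ok_block_cons, ok_store, ok_add, reg_setReg, reg_setArr, hB2.reg_one, hB2.reg_n,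
      hB2.reg_zero, g2]
    refine ⟨by omega, by omega, by omega, by omega, by omega, ?_⟩
    set s3 := ((s2.setArr 12 1 i).setArr 13 1 n).setReg 10 (1 + 0) with hs3
    have H0 : Hier n M L off nb (s.arr 3) (s.arr 4) U₀ i (s2.arr 2) (s2.reg 28) U₀ ∅ [(i, n)] i
        lst₀ s3 := by
      refine ⟨?_, by simpa [hs3] using g4, by simpa [hs3] using g5, ?_, ⟨?_, g6.mem, g6.unused, ?_⟩,
        ?_, by simp [hs3], ?_⟩
      · refine hB2.of_frame (R := [10]) (A := [12, 13]) ?_ (by decide) (by decide)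
        exact ⟨fun r hr => by simp_all, fun a ha => by simp_all⟩
      · simpa [hs3] using Tour.init g7.even g7.b_le g7.x_le le_rfl
      · simpa [hs3] using g6.chain
      · simpa [hs3] using g6.mark
      · exact ⟨by simp [hs3], by simp [hs3], trivial⟩
      · simp only [List.mem_singleton, forall_eq]
        omega
    refine (Ok.while (γ := Finset ℕ × Finset ℕ × List (ℕ × ℕ) × ℕ × (ℕ → List ℕ)) (fun g s' =>
      Hier n M L off nb (s.arr 3) (s.arr 4) U₀ i (s2.arr 2) (s2.reg 28) g.1 g.2.1 g.2.2.1 g.2.2.2.1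
        g.2.2.2.2 s') (fun g => hierPot L g.2.2.1 g.2.2.2.2) ?_ (U₀, ∅, [(i, n)], i, lst₀) s3
      H0).frame.mono ?_
    · rintro ⟨U, S, stk, c, lst'⟩ s4 h hb4
      dsimp only at h
      rw [holds_lt, h.base.reg_zero, h.len] at hb4
      rcases stk with _ | ⟨a, r⟩
      · simp at hb4
      · refine (ok_hier h hnM g7.subU hends hW).mono ?_
        rintro t s5 ⟨U', S', stk', c', lst'', h5, ht⟩
        exact ⟨(U', S', stk', c', lst''), h5, ht⟩
    · rintro t s4 ⟨⟨⟨U, S, stk, c, lst'⟩, h, hb4, ht⟩, hf⟩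
      dsimp only at h ht
      rw [holds_lt, h.base.reg_zero, h.len] at hb4
      have hnil : stk = [] := List.length_eq_zero_iff.1 (by omega)
      subst hnil
      have e5 : s4.reg 5 = i := by rw [hf.1 5 (by decide)]; simpa [hs3] using g2
      have e27 : s4.reg 27 = L + 1 := by rw [hf.1 27 (by decide)]; simpa [hs3] using g3
      simp only [ok_add, ok_block_nil, e5, h.base.reg_one]
      refine ⟨by omega, (i + 1, U, lst'), ⟨by dsimp only; omega, by simp, by simpa using e27, ?_,
        h.p_eq, h.q_eq, ⟨h.lists.chain, h.lists.mem, h.lists.unused, h.lists.mark⟩, ?_⟩, ?_⟩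
      · exact h.base.of_frame (R := [5]) (A := []) (Frame.setReg _ _ (by simp)) (by decide)
          (by decide)
      · simpa using g7.step hd h.tour
      · simp only [hierPot, List.length_cons, List.length_nil] at ht ⊢
        omega
  · refine ⟨Nat.zero_le _, by simp [hs1], by simpa [hs1] using h27, ?_, by simp [hs1],
      by simp [hs1], ⟨hN.chain, fun v e he => (hI.mem v e).1 he, ?_, ?_⟩, ?_⟩
    · refine hB.of_frame (R := [5, 28]) (A := []) ?_ (by decide) (by decide)
      exact ⟨fun r hr => by simp_all, fun a ha => by simp_all⟩
    · intro v e he hw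
      exact (hI.mem v e).2 ⟨Finset.mem_range.1 he, hw⟩
    · intro e he
      simp [hs1, h11, he]
    · have := Toured.init (x := s.arr 2) hd (fun e => by rw [h2]; omega)
      simpa [hs1] using this
  · rintro t s' ⟨⟨i, U, lst'⟩, ⟨g1, g2, g3, hB2, g4, g5, g6, g7⟩, hb, ht⟩
    dsimp only at g1 g2 g6 g7 ht
    rw [holds_lt, g2, g3] at hb
    obtain rfl : i = L + 1 := by omega
    obtain rfl := g7.end hd
    refine ⟨⟨_, _, g7, rfl⟩, ?_⟩
    have hsum : ∑ v ∈ Finset.range (L + 1), (lst v).length = 2 * M := by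
      rw [Finset.sum_congr rfl fun v _ => hI.len v]
      exact sum_degIn hends
    simp only [hierPot, List.length_nil, hsum] at ht
    omega

end Hierholzer

end RAM

/-! ### Cut sizes and energies -/

section Cuts

variable {n : ℕ}

open Classical in
theorem cutSize_eq_sum (G : SimpleGraph (Fin n)) (A B : Finset (Fin n)) :
    (cutSize G A B : ℤ) =
      ∑ e, ∑ f, if G.Adj e f then (if e ∈ A then 1 else 0) * (if f ∈ B then 1 else 0) else 0 := by
  have h : G.interedges A B =
      (Finset.univ ×ˢ Finset.univ).filter fun p => G.Adj p.1 p.2 ∧ p.1 ∈ A ∧ p.2 ∈ B := by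
    ext p
    simp only [SimpleGraph.interedges, Rel.mem_interedges_iff, Finset.mem_filter,
      Finset.mem_product, Finset.mem_univ, true_and]
    tauto
  rw [cutSize, h, Finset.card_filter, Finset.sum_product]
  push_cast
  refine Finset.sum_congr rfl fun e _ => Finset.sum_congr rfl fun f _ => ?_
  by_cases h1 : G.Adj e f <;> by_cases h2 : e ∈ A <;> by_cases h3 : f ∈ B <;> simp [h1, h2, h3]

open Classical in
/-- The signs of a cut determine its size. -/
theorem sum_adj_sign (G : SimpleGraph (Fin n)) {A B : Finset (Fin n)} (h : IsCut A B)
    {y : ℕ → ℤ} (hy : ∀ e : Fin n, y e = if e ∈ A then 1 else -1) :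
    (∑ e : Fin n, ∑ f : Fin n, if G.Adj e f then y e * y f else 0) =
      (∑ e : Fin n, ∑ f : Fin n, if G.Adj e f then 1 else 0) - 4 * cutSize G A B := by
  have hB : ∀ f, f ∈ B ↔ f ∉ A := by
    intro f
    have h1 : f ∈ A ∪ B := by rw [h.2]; exact Finset.mem_univ f
    have h2 : f ∈ A → f ∉ B := fun h' => Finset.disjoint_left.1 h.1 h'
    rw [Finset.mem_union] at h1
    tauto
  -- Each cut edge is seen in both orders, and each order turns a summand `1` into `-1`; hence the
  -- factor `4`.
  have hsymm : (cutSize G A B : ℤ) = ∑ e, ∑ f, if G.Adj e f then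
      (if f ∈ A then 1 else 0) * (if e ∈ B then 1 else 0) else 0 := by
    rw [cutSize_eq_sum, Finset.sum_comm]
    simp only [G.adj_comm]
  have h4 : (4 : ℤ) * cutSize G A B = 2 * cutSize G A B + 2 * cutSize G A B := by ring
  rw [h4]
  nth_rewrite 2 [hsymm]
  rw [cutSize_eq_sum]
  simp only [Finset.mul_sum, ← Finset.sum_add_distrib, ← Finset.sum_sub_distrib]
  refine Finset.sum_congr rfl fun e _ => Finset.sum_congr rfl fun f _ => ?_
  rw [hy, hy]
  simp only [hB]
  by_cases h1 : G.Adj e f <;> by_cases h2 : e ∈ A <;> by_cases h3 : f ∈ A <;> simp [h1, h2, h3]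

open Classical in
-- Expand the squares and sum over the vertices `v` first: the coefficient of `y e * y f` is `coin e
-- f`, which is `2` on the diagonal and the adjacency indicator off it.
theorem energy_eq (G : SimpleGraph (Fin n)) {M L : ℕ} {P Q : ℕ → ℕ} (hd : EdgeData n M L P Q)
    (hcoin : ∀ e f : Fin n, f ≠ e → coin P Q e f = if G.Adj e f then 1 else 0)
    {y : ℕ → ℤ} (hy : ∀ e, y e = 1 ∨ y e = -1) :
    energy n L P Q y (Finset.range M) =
      2 * n + ∑ e : Fin n, ∑ f : Fin n, if G.Adj e f then y e * y f else 0 := by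
  have hfil : (Finset.range M).filter (· < n) = Finset.range n := by
    ext e
    have := hd.le
    simp only [Finset.mem_filter, Finset.mem_range]
    omega
  have hK : ∀ e f : Fin n, ∑ v ∈ Finset.Icc 1 L, (wt P Q v e : ℤ) * wt P Q v f = coin P Q e f := by
    intro e f
    obtain ⟨h1, h2, h3, h4⟩ := hd.ends e e.2
    have : ∀ v, (wt P Q v e : ℤ) * wt P Q v f = (if P e = v then (wt P Q v f : ℤ) else 0) +
        if Q e = v then (wt P Q v f : ℤ) else 0 := by
      intro v
      rw [wt]
      split_ifs <;> push_cast <;> ring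
    simp only [this]
    rw [Finset.sum_add_distrib, Finset.sum_ite_eq, Finset.sum_ite_eq,
      if_pos (Finset.mem_Icc.2 ⟨h1, h2⟩), if_pos (Finset.mem_Icc.2 ⟨h3, h4⟩), coin]
    push_cast
    rfl
  have hself : ∀ e : Fin n, coin P Q e e = 2 := by
    intro e
    have := hd.ne e (by have := hd.le; omega)
    unfold coin wt
    rw [if_pos rfl, if_neg this.symm, if_neg this, if_pos rfl]
  have h1 : energy n L P Q y (Finset.range M) =
      ∑ e : Fin n, ∑ f : Fin n, y e * y f * coin P Q e f := by
    have h2 : ∀ v, imb n P Q y (Finset.range M) v ^ 2 =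
        ∑ e : Fin n, ∑ f : Fin n, y e * y f * ((wt P Q v e : ℤ) * wt P Q v f) := by
      intro v
      rw [imb, hfil, Finset.sum_range, sq, Finset.sum_mul_sum]
      refine Finset.sum_congr rfl fun e _ => Finset.sum_congr rfl fun f _ => ?_
      ring
    rw [energy, Finset.sum_congr rfl fun v _ => h2 v, Finset.sum_comm]
    refine Finset.sum_congr rfl fun e _ => ?_
    rw [Finset.sum_comm]
    refine Finset.sum_congr rfl fun f _ => ?_
    rw [← Finset.mul_sum, hK]
  have h3 : ∀ e : Fin n, ∑ f : Fin n, y e * y f * coin P Q e f =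
      2 + ∑ f : Fin n, if G.Adj e f then y e * y f else 0 := by
    intro e
    rw [← Finset.add_sum_erase _ _ (Finset.mem_univ e),
      ← Finset.add_sum_erase (a := e) _ (fun f : Fin n => if G.Adj e f then y e * y f else 0)
        (Finset.mem_univ e), hself, if_neg (G.irrefl), zero_add]
    congr 1
    · rcases hy e with h | h <;> rw [h] <;> norm_num
    · refine Finset.sum_congr rfl fun f hf => ?_
      rw [hcoin e f (Finset.ne_of_mem_erase hf)]
      split_ifs <;> simp
  rw [h1, Finset.sum_congr rfl fun e _ => h3 e, Finset.sum_add_distrib]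
  simp [mul_comm]

/-- The colouring that results from the tours is a maximum cut and a bisection. -/
theorem Toured.isMax (G : SimpleGraph (Fin n)) {M L b : ℕ} {P Q x : ℕ → ℕ}
    (hd : EdgeData n M L P Q)
    (hcoin : ∀ e f : Fin n, G.Adj e f ∧ coin P Q e f = 1 ∨ ¬ G.Adj e f ∧ (f ≠ e → coin P Q e f = 0))
    (h : Toured n M L P Q (L + 1) ∅ x b) :
    IsMaxBisection G (Finset.univ.filter fun e : Fin n => x e = 0)
        (Finset.univ.filter fun e : Fin n => x e = 1) ∧
      IsMaxCut G (Finset.univ.filter fun e : Fin n => x e = 0)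
        (Finset.univ.filter fun e : Fin n => x e = 1) := by
  classical
  set A := Finset.univ.filter fun e : Fin n => x e = 0 with hA
  set B := Finset.univ.filter fun e : Fin n => x e = 1 with hB
  have hcoin' : ∀ e f : Fin n, f ≠ e → coin P Q e f = if G.Adj e f then 1 else 0 := by
    intro e f hfe
    rcases hcoin e f with ⟨h1, h2⟩ | ⟨h1, h2⟩
    · rw [if_pos h1, h2]
    · rw [if_neg h1, h2 hfe]
  have hcut : IsCut A B := by
    refine ⟨?_, ?_⟩
    · rw [Finset.disjoint_left]
      intro e h1 h2
      simp only [hA, hB, Finset.mem_filter, Finset.mem_univ, true_and] at h1 h2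
      omega
    · ext e
      have := h.x_le e
      simp only [hA, hB, Finset.mem_union, Finset.mem_filter, Finset.mem_univ, true_and, iff_true]
      omega
  have hsx : ∀ e : Fin n, sgn x e = if e ∈ A then 1 else -1 := by
    intro e
    have := h.x_le e
    simp only [hA, Finset.mem_filter, Finset.mem_univ, true_and, sgn]
    split_ifs with h1
    · rw [h1]; norm_num
    · rw [show x e = 1 by omega]; norm_num
  have hmax : ∀ A' B' : Finset (Fin n), IsCut A' B' → cutSize G A' B' ≤ cutSize G A B := by
    intro A' B' hcut'
    let y : ℕ → ℤ := fun e => if he : e < n then if ⟨e, he⟩ ∈ A' then 1 else -1 else 1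
    have hy : ∀ e, y e = 1 ∨ y e = -1 := by
      intro e
      simp only [y]
      split_ifs <;> simp
    have hyA : ∀ e : Fin n, y e = if e ∈ A' then 1 else -1 := by
      intro e
      simp [y]
    have h1 := h.opt y hy
    rw [Finset.sdiff_empty, energy_eq G hd hcoin' (sgn_eq h.x_le), energy_eq G hd hcoin' hy,
      sum_adj_sign G hcut hsx, sum_adj_sign G hcut' hyA] at h1
    omega
  -- The difference of the class sizes is the sum of all signs, which is the colour pending after
  -- the last tour.
  have hbal : (A.card : ℤ) - B.card = b := by
    have h1 := h.bal
    have hfil : (Finset.range M).filter (· < n) = Finset.range n := by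
      ext e
      have := hd.le
      simp only [Finset.mem_filter, Finset.mem_range]
      omega
    rw [Finset.sdiff_empty, hfil, Finset.sum_range] at h1
    rw [← h1, Finset.cast_card, Finset.cast_card, hA, hB, Finset.sum_filter, Finset.sum_filter,
      ← Finset.sum_sub_distrib]
    refine Finset.sum_congr rfl fun e _ => ?_
    have := h.x_le e
    rcases (by omega : x e = 0 ∨ x e = 1) with h2 | h2 <;> simp [sgn, h2]
  have hb := h.b_le
  exact ⟨⟨⟨hcut, by omega, by omega⟩, fun A' B' h' => hmax A' B' h'.1⟩, hcut, hmax⟩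

end Cuts

/-! ### The input memory -/

namespace RAM

section Memory

variable {n : ℕ} {adj : Fin n → List (Fin n)}

/-- The adjacency lists as lists of natural numbers. -/
def natLists (adj : Fin n → List (Fin n)) (v : ℕ) : List ℕ :=
  if h : v < n then (adj ⟨v, h⟩).map Fin.val else []

theorem sum_length_natLists {G : SimpleGraph (Fin n)} (h : IsAdjLists G adj) :
    ∑ v ∈ Finset.range n, (natLists adj v).length = 2 * G.edgeSet.ncard := by
  classical
  rw [Finset.sum_range]
  have h1 : ∀ v : Fin n, (natLists adj v).length = G.degree v := by
    intro v
    have : (adj v).toFinset = G.neighborFinset v := by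
      ext w
      rw [List.mem_toFinset, SimpleGraph.mem_neighborFinset, (h v).2]
    rw [SimpleGraph.degree, ← this, List.toFinset_card_of_nodup (h v).1]
    simp [natLists]
  rw [Finset.sum_congr rfl fun v _ => h1 v, G.sum_degrees_eq_twice_card_edges,
    ← SimpleGraph.coe_edgeFinset, Set.ncard_coe_finset]

theorem inputMemory_off {v : ℕ} (hv : v ≤ n) :
    (inputMemory adj).arr 0 v = ∑ u ∈ Finset.range v, (natLists adj u).length := by
  have h1 : (inputMemory adj).arr 0 v =
      ((List.ofFn fun u => (adj u).length).take v).sum := by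
    simp [inputMemory, hv]
  rw [h1]
  clear h1
  induction v with
  | zero => simp
  | succ v ih =>
    rw [List.take_succ_eq_append_getElem (by simpa using hv), List.sum_append, ih (by omega),
      Finset.sum_range_succ]
    simp [natLists, show v < n from hv]

theorem inputMemory_nb {v : ℕ} (hv : v < n) {i : ℕ} (hi : i < (natLists adj v).length) :
    (inputMemory adj).arr 1 ((inputMemory adj).arr 0 v + i) = (natLists adj v)[i] := by
  have h1 : (List.ofFn adj).flatten.map Fin.val = (List.ofFn fun u : Fin n =>
      natLists adj u).flatten := by
    rw [List.map_flatten, List.map_ofFn]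
    congr 2
    funext u
    simp [natLists]
  have hlen : v < (List.ofFn fun u : Fin n => natLists adj u).length := by simpa using hv
  have h2 : (List.ofFn fun u : Fin n => natLists adj u) =
      (List.ofFn fun u : Fin n => natLists adj u).take v ++ natLists adj v ::
        (List.ofFn fun u : Fin n => natLists adj u).drop (v + 1) := by
    conv_lhs => rw [← List.take_append_drop v (List.ofFn fun u : Fin n => natLists adj u)]
    rw [List.drop_eq_getElem_cons hlen, List.getElem_ofFn]
  have h3 : ((List.ofFn fun u : Fin n => natLists adj u).take v).flatten.length =
      (inputMemory adj).arr 0 v := by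
    rw [List.length_flatten, List.map_take, List.map_ofFn]
    have : (inputMemory adj).arr 0 v = ((List.ofFn fun u => (adj u).length).take v).sum := by
      simp [inputMemory, hv.le]
    rw [this]
    congr 3
    funext u
    simp [natLists]
  have h4 : (inputMemory adj).arr 1 ((inputMemory adj).arr 0 v + i) =
      ((List.ofFn fun u : Fin n => natLists adj u).flatten).getD
        ((inputMemory adj).arr 0 v + i) 0 := by
    rw [← h1]
    simp [inputMemory]
  rw [h4, ← h3]
  conv_lhs => arg 1; rw [h2]
  rw [List.flatten_append, List.flatten_cons, List.getD_append_right _ _ _ _ (by omega),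
    Nat.add_sub_cancel_left, List.getD_append _ _ _ _ hi, List.getD_eq_getElem _ _ hi]

theorem input_inputMemory {G : SimpleGraph (Fin n)} (h : IsAdjLists G adj) {W : ℕ}
    (hW : 100 * (n + 1) + 2 * G.edgeSet.ncard < W) :
    Input n W ((inputMemory adj).arr 0) ((inputMemory adj).arr 1) (natLists adj) where
  off_lt v := by
    have hs := sum_length_natLists h
    rcases Nat.lt_or_ge v n with hv | hv
    · rw [inputMemory_off hv.le, ← Finset.sum_range_succ (fun u => (natLists adj u).length)]
      have : ∑ u ∈ Finset.range (v + 1), (natLists adj u).length ≤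
          ∑ u ∈ Finset.range n, (natLists adj u).length :=
        Finset.sum_le_sum_of_subset (by
          intro a ha
          rw [Finset.mem_range] at ha ⊢
          omega)
      omega
    · have h1 : (natLists adj v).length = 0 := by simp [natLists, not_lt.2 hv]
      rw [h1]
      rcases hv.eq_or_lt with rfl | hv
      · rw [inputMemory_off le_rfl]
        omega
      · have : (inputMemory adj).arr 0 v = 0 := by simp [inputMemory, not_le.2 hv]
        omega
  off_succ v hv := by
    rw [inputMemory_off hv, inputMemory_off hv.le, Finset.sum_range_succ]
  nb_get v hv i hi := inputMemory_nb hv hi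
  lt_of_mem v y hy := by
    unfold natLists at hy
    split_ifs at hy with hv
    · obtain ⟨w, -, rfl⟩ := List.mem_map.1 hy
      exact w.2
    · simp at hy
  nbl_out v hv := by simp [natLists, not_lt.2 hv]
  off_end := by simp [inputMemory]
  n_lt := by omega

theorem mem_natLists {G : SimpleGraph (Fin n)} (h : IsAdjLists G adj) (e f : Fin n) :
    (f : ℕ) ∈ natLists adj e ↔ G.Adj e f := by
  rw [← (h e).2]
  simp only [natLists, e.2, dite_true, List.mem_map]
  constructor
  · rintro ⟨a, ha, hf⟩
    rwa [← Fin.ext hf]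
  · exact fun hf => ⟨f, hf, rfl⟩

/-- The incidence relation is that of the underlying graph, transported along the isomorphism `φ`.
Simplicity holds because two distinct ends determine an element of `Sym2` and `φ` is injective. It
serves the proof only; the program never sees it. -/
theorem lineData_of_isLineGraph {G : SimpleGraph (Fin n)} (h : IsAdjLists G adj)
    (hG : IsLineGraph G) : ∃ (U : Type) (inc : ℕ → U → Prop), LineData n (natLists adj) inc := by
  obtain ⟨U, _, H, ⟨φ⟩⟩ := hG
  refine ⟨U, fun e u => ∃ he : e < n, u ∈ (φ ⟨e, he⟩ : Sym2 U), ⟨?_, ?_, ?_, ?_⟩⟩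
  · intro e
    unfold natLists
    split_ifs with he
    · exact (h _).1.map Fin.val_injective
    · exact List.nodup_nil
  · intro e y
    constructor
    · intro hy
      have he : e < n := by
        by_contra he
        simp [natLists, he] at hy
      have hyn : y < n := by
        simp only [natLists, he, dite_true, List.mem_map] at hy
        obtain ⟨a, -, rfl⟩ := hy
        exact a.2
      have hadj := (mem_natLists h ⟨e, he⟩ ⟨y, hyn⟩).1 hy
      have h1 := φ.map_adj_iff.2 hadj
      rw [SimpleGraph.lineGraph_adj_iff_exists] at h1
      obtain ⟨-, u, h2, h3⟩ := h1
      refine ⟨he, hyn, ?_, u, ⟨he, h2⟩, hyn, h3⟩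
      rintro rfl
      exact G.irrefl hadj
    · rintro ⟨he, hyn, hne, u, ⟨_, h2⟩, _, h3⟩
      refine (mem_natLists h ⟨e, he⟩ ⟨y, hyn⟩).2 (φ.map_adj_iff.1 ?_)
      rw [SimpleGraph.lineGraph_adj_iff_exists]
      refine ⟨fun heq => hne ?_, u, h2, h3⟩
      exact congrArg Fin.val (φ.injective heq)
  · intro e he
    rcases hφ : φ ⟨e, he⟩ with ⟨s, hs⟩
    induction s using Sym2.ind with
    | _ a b =>
      refine ⟨a, b, H.ne_of_adj hs, fun u => ?_⟩
      constructor
      · rintro ⟨_, hu⟩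
        rw [hφ] at hu
        exact Sym2.mem_iff.1 hu
      · intro hu
        refine ⟨he, ?_⟩
        rw [hφ]
        exact Sym2.mem_iff.2 hu
  · rintro e he y hy u v huv ⟨_, h1⟩ ⟨_, h2⟩ ⟨_, h3⟩ ⟨_, h4⟩
    have h5 := (Sym2.mem_and_mem_iff huv).1 ⟨h1, h3⟩
    have h6 := (Sym2.mem_and_mem_iff huv).1 ⟨h2, h4⟩
    exact congrArg Fin.val (φ.injective (Subtype.ext (h5.trans h6.symm)))

end Memory

end RAM

/-! ### The whole program -/

namespace RAM

/-- The program: label the vertices by the ends of the edges of the underlying graph, build the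
incidence lists, make all degrees even, and colour alternately along Euler tours. -/
def maxBisection : Prog := block [labelAll, linkAll, pairOdd, tours]

/-- With at most `6n` labels and `M ≤ 7n` edges, the four stages cost `480n + 420m`, `30n`, `40 *
6n` and `120 * 7n + 40 * 6n` steps, up to constants. -/
theorem ok_maxBisection {n W : ℕ} {G : SimpleGraph (Fin n)} {adj : Fin n → List (Fin n)}
    (hG : IsLineGraph G) (h : IsAdjLists G adj)
    (hW : 100 * (n + 1) + 2 * G.edgeSet.ncard < W) :
    Ok W maxBisection (inputMemory adj) (fun t s' =>
      t ≤ 1850 * n + 420 * G.edgeSet.ncard + 100 ∧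
      IsMaxBisection G (outputClass n s' 0) (outputClass n s' 1) ∧
      IsMaxCut G (outputClass n s' 0) (outputClass n s' 1)) := by
  have hin := input_inputMemory h hW
  obtain ⟨U, inc, hd⟩ := lineData_of_isLineGraph h hG
  have hzero : ∀ a, 1 < a → ∀ i, (inputMemory adj).arr a i = 0 := by
    intro a ha i
    simp [inputMemory, show a ≠ 0 by omega, show a ≠ 1 by omega]
  simp only [maxBisection, ok_block_cons, ok_block_nil]
  refine (ok_labelAll hin hd (s := inputMemory adj) (by simp [inputMemory])
    (fun r hr => by simp [inputMemory, hr]) rfl rfl hzero).frame.mono ?_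
  rintro t1 s1 ⟨⟨hB1, hsol, hall, hL, ht1⟩, hf1⟩
  have hgood := fun e he => hsol.good e (hall e he)
  have hsum : ∑ y ∈ Finset.range n, (480 + 210 * (natLists adj y).length) =
      480 * n + 420 * G.edgeSet.ncard := by
    rw [Finset.sum_add_distrib, ← Finset.mul_sum, sum_length_natLists h]
    simp
    ring
  rw [hsum] at ht1
  -- The labelling writes no array above `7`, so the arrays of the later stages are still clear.
  have hz1 : ∀ a, 7 < a → ∀ i, s1.arr a i = 0 := by
    intro a ha i
    rw [hf1.2 a (fun hmem => ?_), hzero a (by omega)]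
    have : ∀ a ∈ labelAll.wa, a ≤ 7 := by decide
    exact absurd (this a hmem) (by omega)
  refine (ok_linkAll hB1 (by omega) (fun e he => ?_) (fun e he => (hgood e he).2.1)
    (hz1 8 (by omega)) (hz1 14 (by omega))).frame.mono ?_
  · have := hsol.le e
    omega
  rintro t2 s2 ⟨⟨lst, hN, hI, ht2⟩, hf2⟩
  have hB2 := hB1.of_frame hf2 (by decide) (by decide)
  have e3 : s2.arr 3 = s1.arr 3 := hf2.2 3 (by decide)
  have e4 : s2.arr 4 = s1.arr 4 := hf2.2 4 (by decide)
  have e6 : s2.reg 6 = s1.reg 6 := hf2.1 6 (by decide)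
  refine (ok_pairOdd hB2 (L := s1.reg 6) (by omega) e6 (fun e he => ?_) (fun e he => ?_)
    (fun e he => ?_) hN (by rw [e3, e4]; exact hI)).frame.mono ?_
  · rw [e3, e4]
    have h1 := hsol.le e
    have h2 := hall e he
    have h3 := (hgood e he).1
    omega
  · rw [e3, e4]
    exact (hgood e he).2.1
  · rw [e4]
    refine hsol.q_zero e ?_
    by_contra hne
    have := hsol.lt e hne
    omega
  rintro t3 s3 ⟨⟨M, lst', hM, hE, h3, hN3, hI3, h27, ht3⟩, hf3⟩
  have hB3 := hB2.of_frame hf3 (by decide) (by decide)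
  have f4 : s3.arr 4 = s1.arr 4 := (hf3.2 4 (by decide)).trans e4
  have h2z : ∀ e, s3.arr 2 e = 0 := by
    intro e
    rw [hf3.2 2 (by decide), hf2.2 2 (by decide), hf1.2 2 (by decide), hzero 2 (by omega)]
  have h11z : ∀ e, s3.arr 11 e = 0 := by
    intro e
    rw [hf3.2 11 (by decide), hf2.2 11 (by decide), hz1 11 (by omega)]
  refine (ok_tours hB3 hE (by omega) h27 hN3 hI3 h2z h11z).mono ?_
  rintro t4 s4 ⟨⟨x, b, hT, hx⟩, ht4⟩
  refine ⟨by omega, ?_⟩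
  unfold outputClass
  rw [hx]
  refine hT.isMax G hE fun e f => ?_
  have hcoin : f ≠ e →
      coin (s3.arr 3) (s3.arr 4) e f = if (f : ℕ) ∈ natLists adj e then 1 else 0 := by
    intro hfe
    rw [← (hgood e e.2).2.2 f (fun h => hfe (Fin.ext h)), f4]
    unfold coin wt
    rw [h3 e e.2, h3 f f.2, e3]
  by_cases hadj : G.Adj e f
  · left
    refine ⟨hadj, ?_⟩
    rw [hcoin hadj.ne', if_pos ((mem_natLists h e f).2 hadj)]
  · right
    refine ⟨hadj, fun hfe => ?_⟩
    rw [hcoin hfe, if_neg (fun h' => hadj ((mem_natLists h e f).1 h'))]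

end RAM

/-- One fixed program computes, for every line graph `G` with `n` vertices and `m` edges, given by
adjacency lists in any order (no underlying graph is given), a maximum bisection of `G`, which is
also a maximum cut of `G`, in at most `c * (n + m + 1)` steps with words below `c * (n + m + 1)`. -/
theorem mainTheorem7 :
    ∃ (p : RAM.Prog) (c : ℕ), ∀ (n : ℕ) (G : SimpleGraph (Fin n)) (adj : Fin n → List (Fin n)),
      IsLineGraph G → RAM.IsAdjLists G adj →
        ∃ (t : ℕ) (s : RAM.Memory),
          RAM.Exec (c * (n + G.edgeSet.ncard + 1)) p (RAM.inputMemory adj) t s ∧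
          t ≤ c * (n + G.edgeSet.ncard + 1) ∧
          IsMaxBisection G (RAM.outputClass n s 0) (RAM.outputClass n s 1) ∧
          IsMaxCut G (RAM.outputClass n s 0) (RAM.outputClass n s 1) := by
  -- The constant dominates both the time `1850n + 420m + 100` and the word size `100(n + 1) + 2m`.
  refine ⟨RAM.maxBisection, 2000, fun n G adj hG h => ?_⟩
  obtain ⟨t, s, he, ht, h1, h2⟩ := RAM.ok_maxBisection
    (W := 2000 * (n + G.edgeSet.ncard + 1)) hG h (by omega)
  exact ⟨t, s, he, by omega, h1, h2⟩
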